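/- Let $0\le\lambda_0<\lambda_1<\lambda_2<\dots$ be the eigenvalues, in increasing order, of the axially symmetric Laplacian on the sphere, i.e. the numbers $\mu$ for which $-\frac{1}{\sin\theta}(\sin\theta\,\varphi_\theta)_\theta=\mu\varphi$ on $(0,\pi)$ has a nonzero solution with Neumann boundary conditions $\varphi_\theta\to 0$ as $\theta\to 0,\pi$. For $\lambda\ge 0$ consider the Chafee–Infante shooting system $$\theta_\tau=\sin\theta,\qquad u_\tau=p,\qquad p_\tau=-\lambda u(1-u^2)\sin^2\theta$$ in $\mathbb{R}^3\ni(\theta,u,p)$. For $d\in\mathbb{R}$ let $W^u(0,d,0)$ be the strong unstable manifold of the equilibrium $(0,d,0)$ (the points whose backward orbit exists for all $\tau\le 0$ and converges exponentially to $(0,d,0)$ as $\tau\to-\infty$), and for $e\in\mathbb{R}$ let $W^s(\pi,e,0)$ be the strong stable manifold of $(\pi,e,0)$ (the points whose forward orbit exists for all $\tau\ge 0$ and converges exponentially to $(\pi,e,0)$ as $\tau\to\infty$). Put $M^u=\bigcup_{d}W^u(0,d,0)$, $M^s=\bigcup_{e}W^s(\pi,e,0)$, and let $M^u_\theta,M^s_\theta\subseteq\mathbb{R}^2$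 be their cross-sections at $\theta$; the curve $M^u_\theta$ is parametrized by $d$. Let $k\in\mathbb{N}_0$. 1. If $\lambda\in(\lambda_k,\lambda_{k+1})$, then for every $\theta\in(0,\pi)$, in particular for $\theta=\pi/2$, the set $M^u_\theta\cap M^s_\theta$ has exactly $2k+3$ points. 2. For every $\lambda\ge 0$ and $\theta\in(0,\pi)$ the curve $M^u_\theta$ has a nonzero tangent vector $(\partial_d u,\partial_d p)$ at $d=0$, i.e. at the origin. Let $\nu(\theta)$ be its clockwise angle with the positive $u$-axis, $(\partial_d u,\partial_d p)=(r\cos\nu,-r\sin\nu)$ with $r>0$, chosen continuous in $\theta\in(0,\pi)$ with $\nu(\theta)\to 0$ as $\theta\to 0$, and put $\mu(\lambda)=\nu(\pi/2)$. Then, for $\lambda\ge0$, $\mu(\lambda)=\frac{\pi}{2}(k+1)$ if and only if $\lambda=\lambda_{k+1}$. -/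

import Mathlib

noncomputable section

/-- `μ` is an eigenvalue of the axially symmetric Laplacian (with the sign for which the
eigenvalues are nonnegative): there is a nonzero `φ` on `(0, π)` with
`-(1 / sin θ) (sin θ φ'(θ))' = μ φ(θ)` and Neumann boundary conditions at `0` and `π`. -/
def IsAxisymEigenvalue (μ : ℝ) : Prop :=
  ∃ φ φ' : ℝ → ℝ,
    (∀ θ ∈ Set.Ioo 0 Real.pi, HasDerivAt φ (φ' θ) θ) ∧
    (∀ θ ∈ Set.Ioo 0 Real.pi,
      HasDerivAt (fun t => Real.sin t * φ' t) (-(μ * Real.sin θ * φ θ)) θ) ∧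
    Filter.Tendsto φ' (nhdsWithin 0 (Set.Ioi 0)) (nhds 0) ∧
    Filter.Tendsto φ' (nhdsWithin Real.pi (Set.Iio Real.pi)) (nhds 0) ∧
    ∃ θ ∈ Set.Ioo 0 Real.pi, φ θ ≠ 0

/-- The eigenvalues `λ₀ < λ₁ < ⋯` of the axially symmetric Laplacian in increasing order: `λ₀` is
the smallest one, and `λ_{k+1}` is the smallest one above `λ_k`. -/
def axisymEigenvalue : ℕ → ℝ
  | 0 => sInf {μ | IsAxisymEigenvalue μ}
  | k + 1 => sInf {μ | IsAxisymEigenvalue μ ∧ axisymEigenvalue k < μ}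

/-- The Chafee–Infante shooting vector field in the variables `x = (θ, u, p)`:
`θ_τ = sin θ`, `u_τ = p`, `p_τ = -lam u (1 - u²) sin² θ`. -/
def shootField (lam : ℝ) (x : ℝ × ℝ × ℝ) : ℝ × ℝ × ℝ :=
  (Real.sin x.1, x.2.2, -(lam * x.2.1 * (1 - x.2.1 ^ 2) * Real.sin x.1 ^ 2))

/-- The strong unstable manifold of `q` for the vector field `F`: the points whose backward orbit
exists for all `τ ≤ 0` and converges exponentially to `q` as `τ → -∞`. -/
def strongUnstable (F : ℝ × ℝ × ℝ → ℝ × ℝ × ℝ) (q : ℝ × ℝ × ℝ) : Set (ℝ × ℝ × ℝ) :=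
  {x | ∃ γ : ℝ → ℝ × ℝ × ℝ, γ 0 = x ∧
    (∀ τ ≤ 0, HasDerivWithinAt γ (F (γ τ)) (Set.Iic 0) τ) ∧
    ∃ C α : ℝ, 0 < α ∧ ∀ τ ≤ 0, dist (γ τ) q ≤ C * Real.exp (α * τ)}

/-- The strong stable manifold of `q`: the points whose forward orbit exists for all `τ ≥ 0` and
converges exponentially to `q` as `τ → ∞`. -/
def strongStable (F : ℝ × ℝ × ℝ → ℝ × ℝ × ℝ) (q : ℝ × ℝ × ℝ) : Set (ℝ × ℝ × ℝ) :=
  {x | ∃ γ : ℝ → ℝ × ℝ × ℝ, γ 0 = x ∧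
    (∀ τ, 0 ≤ τ → HasDerivWithinAt γ (F (γ τ)) (Set.Ici 0) τ) ∧
    ∃ C α : ℝ, 0 < α ∧ ∀ τ, 0 ≤ τ → dist (γ τ) q ≤ C * Real.exp (-(α * τ))}

/-- The unstable shooting manifold `M^u`. -/
def unstableShooting (lam : ℝ) : Set (ℝ × ℝ × ℝ) :=
  ⋃ d : ℝ, strongUnstable (shootField lam) (0, d, 0)

/-- The stable shooting manifold `M^s`. -/
def stableShooting (lam : ℝ) : Set (ℝ × ℝ × ℝ) :=
  ⋃ e : ℝ, strongStable (shootField lam) (Real.pi, e, 0)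

/-- The cross-section `M_θ` of `M ⊆ ℝ³` at the angle `θ`, as a subset of the `(u, p)`-plane. -/
def crossSection (M : Set (ℝ × ℝ × ℝ)) (θ : ℝ) : Set (ℝ × ℝ) :=
  {y | (θ, y) ∈ M}

/-- `w` is the tangent vector `(∂u/∂d, ∂p/∂d)` at the parameter value `d₀` of the curve `M^u_θ`,
which is parametrized by `d ↦ c d`, the point over `θ` of the strong unstable manifold of
`(0, d, 0)`. -/
def IsUnstableTangent (lam θ d₀ : ℝ) (w : ℝ × ℝ) : Prop :=
  ∃ c : ℝ → ℝ × ℝ,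
    (∀ᶠ d in nhds d₀, (θ, c d) ∈ strongUnstable (shootField lam) (0, d, 0)) ∧
    HasDerivAt c w d₀

/-- `ν θ`, for `0 < θ < π`, is the clockwise angle from the positive `u`-axis of the tangent
vector of `M^u_θ` at the parameter value `d₀`, as the continuous branch in `θ` that tends to `0`
as `θ → 0`. -/
def IsUnstableTangentAngle (lam d₀ : ℝ) (ν : ℝ → ℝ) : Prop :=
  ContinuousOn ν (Set.Ioo 0 Real.pi) ∧
  Filter.Tendsto ν (nhdsWithin 0 (Set.Ioi 0)) (nhds 0) ∧
  ∀ θ ∈ Set.Ioo 0 Real.pi, ∃ r : ℝ, 0 < r ∧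
    IsUnstableTangent lam θ d₀ (r * Real.cos (ν θ), -(r * Real.sin (ν θ)))

end

namespace ChafeeInfante

open Real Set Filter Topology

/-! ### Comparison at `-∞` -/

/-! In the time `t = log tan (θ / 2)` one has `sin² θ = sech² t`, and the system becomes the scalar
equation `u'' = -λ sech² t · u (1 - u²)` with the equator at `t = 0`. A solution leaving `(0, d, 0)`
is `u = d y`, where `y'' = -λ sech² t · y (1 - κ y²)`, `κ = d²` and `y → 1` at `-∞`. The weight
decays like `e^{2t}`, so a contraction argument started at `-∞` produces `y`, and `y` depends
continuously on `(λ, κ)`; the case `κ = 0` is the tangent of the shooting curve at `d = 0`. The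
nonlinearity is cut off to be globally Lipschitz, and `IsProfile.energy_bound` shows that for `λ >
0`, `κ < 1` the cutoff is never felt on the first hemisphere.

The reflection `(θ, p, τ) ↦ (π - θ, -p, -τ)` exchanges `M^u` and `M^s`. An intersection point
therefore comes from two values `d`, `e` whose equatorial points are mirror images in `p`, and these
have equal energy `p² / 2 + λ (u² / 2 - u⁴ / 4)`. Values with `|d| > 1` never occur
(`IsFullOrbit.le_one`), and on `[0, 1]` the energy at the equator is strictly increasing in `d`
(`strictMonoOn_energy`). Hence `e = ±d`, so the orbit is even or odd about the equator and its
equatorial point lies on a coordinate axis. The clockwise angle of that point decreases strictly, as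
`d` runs from `0` to `1`, from `linearAngle λ` to `0` (`strictAntiOn_equatorAngle`), so the axis
points with `d > 0` are counted by the multiples of `π / 2` in `[0, linearAngle λ)`. The symmetry `d
↦ -d` doubles this number and `d = 0` adds one. Intersections at any other `θ` are points of the
same full orbits.

Both monotonicity statements come from `variation_cone`: with `v = ∂_d u` and `w = u_θ`, the
Wronskians of `(u, v)` and of `(w, v)` satisfy a cooperative linear system on the first hemisphere
and stay positive.

For the spectrum, an eigenfunction is a multiple of the profile with `κ = 0`, and it must be even or
odd, which means that `linearAngle λ` is a multiple of `π / 2`. Since `linearAngle` increases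
continuously and strictly from `0` without bound, `linearAngle λ_n = n π / 2`. This gives the count
`2 (k + 1) + 1` and the statement about the tangent angle. -/

theorem le_of_deriv_nonneg_atBot {g g' : ℝ → ℝ} {T l : ℝ}
    (hg : ∀ t < T, HasDerivAt g (g' t) t) (h : ∀ t < T, 0 ≤ g' t)
    (hl : Tendsto g atBot (𝓝 l)) {t : ℝ} (ht : t < T) : l ≤ g t := by
  have hmono : MonotoneOn g (Iio T) := by
    apply monotoneOn_of_deriv_nonneg (convex_Iio T)
    · exact fun x hx => (hg x hx).continuousAt.continuousWithinAt
    · intro x hx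
      rw [interior_Iio] at hx
      exact (hg x hx).differentiableAt.differentiableWithinAt
    · intro x hx
      rw [interior_Iio] at hx
      rw [(hg x hx).deriv]
      exact h x hx
  refine le_of_tendsto hl ?_
  filter_upwards [eventually_le_atBot t] with s hs
  exact hmono (lt_of_le_of_lt hs ht) ht hs

theorem lt_of_deriv_pos_atBot {g g' : ℝ → ℝ} {T l : ℝ}
    (hg : ∀ t < T, HasDerivAt g (g' t) t) (h : ∀ t < T, 0 < g' t)
    (hl : Tendsto g atBot (𝓝 l)) {t : ℝ} (ht : t < T) : l < g t := by
  have hmono : StrictMonoOn g (Iio T) := by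
    apply strictMonoOn_of_deriv_pos (convex_Iio T)
    · exact fun x hx => (hg x hx).continuousAt.continuousWithinAt
    · intro x hx
      rw [interior_Iio] at hx
      rw [(hg x hx).deriv]
      exact h x hx
  have h1 : l ≤ g (t - 1) :=
    le_of_deriv_nonneg_atBot hg (fun s hs => (h s hs).le) hl (by linarith)
  exact lt_of_le_of_lt h1 (hmono (by simp; linarith) ht (by linarith))

theorem abs_le_of_deriv_le_atBot {f f' B B' : ℝ → ℝ} {T : ℝ}
    (hf : ∀ t < T, HasDerivAt f (f' t) t) (hB : ∀ t < T, HasDerivAt B (B' t) t)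
    (h : ∀ t < T, |f' t| ≤ B' t) (hf0 : Tendsto f atBot (𝓝 0)) (hB0 : Tendsto B atBot (𝓝 0))
    {t : ℝ} (ht : t < T) : |f t| ≤ B t := by
  have h1 := le_of_deriv_nonneg_atBot (g := fun s => B s - f s) (fun s hs => (hB s hs).sub (hf s hs))
    (fun s hs => by have := (abs_le.1 (h s hs)).2; linarith) (by simpa using hB0.sub hf0) ht
  have h2 := le_of_deriv_nonneg_atBot (g := fun s => B s + f s) (fun s hs => (hB s hs).add (hf s hs))
    (fun s hs => by have := (abs_le.1 (h s hs)).1; linarith) (by simpa using hB0.add hf0) ht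
  exact abs_le.2 ⟨by linarith, by linarith⟩

/-- Both `B + f` and `B - f` are nondecreasing, and the second, together with `B ≥ 0`, bounds the
first from below. So `B + f` converges at `-∞`, and `B → 0` removes the majorant. -/
theorem exists_tendsto_atBot_of_deriv_le {f f' B B' : ℝ → ℝ} {T : ℝ}
    (hf : ∀ t < T, HasDerivAt f (f' t) t) (hB : ∀ t < T, HasDerivAt B (B' t) t)
    (h : ∀ t < T, |f' t| ≤ B' t) (hB0 : Tendsto B atBot (𝓝 0)) :
    ∃ l, Tendsto f atBot (𝓝 l) := by
  have hBnn : ∀ t < T, 0 ≤ B t := fun t ht =>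
    le_of_deriv_nonneg_atBot hB (fun s hs => (abs_nonneg _).trans (h s hs)) hB0 ht
  have hdiff : ∀ (g g' : ℝ → ℝ), (∀ t < T, HasDerivAt g (g' t) t) → (∀ t < T, 0 ≤ g' t) →
      MonotoneOn g (Iio T) := by
    intro g g' hg hg'
    apply monotoneOn_of_deriv_nonneg (convex_Iio T)
    · exact fun x hx => (hg x hx).continuousAt.continuousWithinAt
    · intro x hx
      rw [interior_Iio] at hx
      exact (hg x hx).differentiableAt.differentiableWithinAt
    · intro x hx
      rw [interior_Iio] at hx
      rw [(hg x hx).deriv]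
      exact hg' x hx
  have m1 := hdiff (fun s => B s + f s) _ (fun s hs => (hB s hs).add (hf s hs))
    (fun s hs => by have := (abs_le.1 (h s hs)).1; linarith)
  have m2 := hdiff (fun s => B s - f s) _ (fun s hs => (hB s hs).sub (hf s hs))
    (fun s hs => by have := (abs_le.1 (h s hs)).2; linarith)
  -- Freezing the argument beyond `c` gives a function monotone on all of `ℝ` with the same
  -- behaviour at `-∞`.
  set c := T - 1 with hc
  have hcT : c < T := by rw [hc]; linarith
  have hmin : ∀ s, min s c < T := fun s => lt_of_le_of_lt (min_le_right _ _) hcT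
  have hM : Monotone (fun s => B (min s c) + f (min s c)) := fun a b hab =>
    m1 (hmin a) (hmin b) (min_le_min_right c hab)
  have hbdd : BddBelow (range fun s => B (min s c) + f (min s c)) := by
    refine ⟨f c - B c, ?_⟩
    rintro _ ⟨s, rfl⟩
    have := m2 (hmin s) hcT (min_le_right s c)
    have := hBnn _ (hmin s)
    simp only at *
    linarith
  have hlim := tendsto_atBot_ciInf hM hbdd
  refine ⟨_, ((hlim.congr' ?_).sub hB0).congr (f₁ := fun s => (B s + f s) - B s) fun s => by ring⟩
  filter_upwards [eventually_le_atBot c] with s hs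
  rw [min_eq_left hs]

theorem exists_primitive_atBot {f B B' : ℝ → ℝ} {T : ℝ} (hf : Continuous f)
    (hB : ∀ t, HasDerivAt B (B' t) t) (h : ∀ t < T, |f t| ≤ B' t) (hB0 : Tendsto B atBot (𝓝 0)) :
    ∃ F : ℝ → ℝ, (∀ t, HasDerivAt F (f t) t) ∧ Tendsto F atBot (𝓝 0) := by
  have hF : ∀ t, HasDerivAt (fun s => ∫ x in (0 : ℝ)..s, f x) (f t) t := fun t =>
    intervalIntegral.integral_hasDerivAt_right (hf.intervalIntegrable _ _)
      (hf.stronglyMeasurableAtFilter _ _) hf.continuousAt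
  obtain ⟨l, hl⟩ := exists_tendsto_atBot_of_deriv_le (fun t _ => hF t) (fun t _ => hB t) h hB0
  exact ⟨fun s => (∫ x in (0 : ℝ)..s, f x) - l, fun t => (hF t).sub_const l,
    by simpa using hl.sub_const l⟩

/-! ### The weight `exp (K exp t)` and Volterra estimates -/

theorem hasDerivAt_weight (K t : ℝ) :
    HasDerivAt (fun s => exp (K * exp s)) (K * exp t * exp (K * exp t)) t := by
  have := (((Real.hasDerivAt_exp t).const_mul K)).exp
  exact this.congr_deriv (by ring)

/-- For `K ≥ 0` the second derivative of the weight is at least `K² e^{2t}` times the weight. Two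
integrations from `-∞` therefore gain a factor `1 / K²`, which is what makes the estimates below
contract. -/
theorem hasDerivAt_weight' (K t : ℝ) :
    HasDerivAt (fun s => K * exp s * exp (K * exp s))
      ((K * exp t + K ^ 2 * exp (2 * t)) * exp (K * exp t)) t := by
  have := ((Real.hasDerivAt_exp t).const_mul K).mul (hasDerivAt_weight K t)
  refine this.congr_deriv ?_
  rw [two_mul, Real.exp_add]
  ring

theorem hasDerivAt_exp_two (t : ℝ) : HasDerivAt (fun s => exp (2 * s)) (2 * exp (2 * t)) t := by
  have := ((hasDerivAt_id t).const_mul 2).exp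
  exact this.congr_deriv (by simp [mul_comm])

theorem tendsto_exp_two_atBot : Tendsto (fun s : ℝ => exp (2 * s)) atBot (𝓝 0) :=
  Real.tendsto_exp_atBot.comp (tendsto_id.const_mul_atBot (by norm_num))

theorem tendsto_weight_atBot (K : ℝ) : Tendsto (fun s => exp (K * exp s)) atBot (𝓝 1) := by
  have : Tendsto (fun s => K * exp s) atBot (𝓝 (K * 0)) := Real.tendsto_exp_atBot.const_mul K
  simpa [Function.comp_def] using (Real.continuous_exp.tendsto _).comp this

/-- Comparison for second order problems started at `-∞`. -/
theorem weighted_bound {u p p' : ℝ → ℝ} {T e A ε K : ℝ} (hK : 0 < K) (hA : 0 ≤ A)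
    (hu : ∀ t < T, HasDerivAt u (p t) t) (hp : ∀ t < T, HasDerivAt p (p' t) t)
    (h : ∀ t < T, |p' t| ≤ exp (2 * t) * (A * exp (K * exp t) + ε))
    (hu0 : Tendsto u atBot (𝓝 e)) (hp0 : Tendsto p atBot (𝓝 0)) {t : ℝ} (ht : t < T) :
    |p t| ≤ A / K * (exp t * exp (K * exp t)) + ε / 2 * exp (2 * t) ∧
      |u t - e| ≤ A / K ^ 2 * (exp (K * exp t) - 1) + ε / 4 * exp (2 * t) := by
  have key : ∀ t < T, |p t| ≤ A / K ^ 2 * (K * exp t * exp (K * exp t)) + ε / 2 * exp (2 * t) := by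
    intro t ht
    refine abs_le_of_deriv_le_atBot hp (B := fun t => A / K ^ 2 * (K * exp t * exp (K * exp t)) +
      ε / 2 * exp (2 * t)) (fun s _ => ((hasDerivAt_weight' K s).const_mul (A / K ^ 2)).add
        ((hasDerivAt_exp_two s).const_mul (ε / 2))) (fun s hs => (h s hs).trans ?_) hp0 ?_ ht
    · have h1 : A / K ^ 2 * ((K * exp s + K ^ 2 * exp (2 * s)) * exp (K * exp s)) =
          A / K * (exp s * exp (K * exp s)) + A * exp (2 * s) * exp (K * exp s) := by
        field_simp
      rw [h1]
      have : 0 ≤ A / K * (exp s * exp (K * exp s)) := by positivity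
      nlinarith
    · have h1 := ((Real.tendsto_exp_atBot.const_mul K).mul (tendsto_weight_atBot K)).const_mul
        (A / K ^ 2)
      have h2 := tendsto_exp_two_atBot.const_mul (ε / 2)
      simpa using h1.add h2
  refine ⟨(key t ht).trans_eq (by field_simp), ?_⟩
  refine abs_le_of_deriv_le_atBot (f := fun t => u t - e) (f' := p)
    (B := fun t => A / K ^ 2 * (exp (K * exp t) - 1) + ε / 4 * exp (2 * t))
    (B' := fun t => A / K ^ 2 * (K * exp t * exp (K * exp t)) + ε / 2 * exp (2 * t))
    (fun s hs => (hu s hs).sub_const e) (fun s _ => ?_) key (by simpa using hu0.sub_const e) ?_ ht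
  · have := (((hasDerivAt_weight K s).sub_const 1).const_mul (A / K ^ 2)).add
      ((hasDerivAt_exp_two s).const_mul (ε / 4))
    exact this.congr_deriv (by ring)
  · have h1 := ((tendsto_weight_atBot K).sub_const 1).const_mul (A / K ^ 2)
    simpa using h1.add (tendsto_exp_two_atBot.const_mul (ε / 4))

/-- The growth constant in `volterra_bound`. -/
noncomputable def growth (M T : ℝ) : ℝ := 2 * exp ((1 + 2 * M) * exp T)

theorem growth_pos (M T : ℝ) : 0 < growth M T := by unfold growth; positivity

/-- Gronwall inequality for second order problems started at `-∞`. -/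
theorem volterra_bound {u p p' : ℝ → ℝ} {T e M ε B : ℝ} (hM : 0 ≤ M) (hε : 0 ≤ ε)
    (hu : ∀ t < T, HasDerivAt u (p t) t) (hp : ∀ t < T, HasDerivAt p (p' t) t)
    (h : ∀ t < T, |p' t| ≤ exp (2 * t) * (M * |u t| + ε)) (hB : ∀ t < T, |u t| ≤ B)
    (hu0 : Tendsto u atBot (𝓝 e)) (hp0 : Tendsto p atBot (𝓝 0)) {t : ℝ} (ht : t < T) :
    |u t| ≤ growth M T * (|e| + ε * exp (2 * T)) ∧
    |p t| ≤ (M * (growth M T * (|e| + ε * exp (2 * T))) + ε) * exp (2 * t) ∧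
    |u t - e| ≤ (M * (growth M T * (|e| + ε * exp (2 * T))) + ε) * exp (2 * t) := by
  -- What matters is `2 M ≤ K²`: the weighted supremum `m` then satisfies `m ≤ data + M m / K² ≤
  -- data + m / 2`, and half of it is absorbed. The summand `1` keeps `K` positive when `M = 0`.
  set K := 1 + 2 * M with hK
  have hK0 : 0 < K := by linarith
  set S := (fun t => |u t| * exp (-(K * exp t))) '' Iio T with hS
  have hSb : BddAbove S := by
    refine ⟨B, ?_⟩
    rintro _ ⟨s, hs, rfl⟩
    have h1 : exp (-(K * exp s)) ≤ 1 := Real.exp_le_one_iff.2 (by have := Real.exp_pos s; nlinarith)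
    calc |u s| * exp (-(K * exp s)) ≤ |u s| * 1 := by gcongr
      _ ≤ B := by simpa using hB s hs
  set m := sSup S with hm
  have hle : ∀ s < T, |u s| ≤ m * exp (K * exp s) := by
    intro s hs
    have h1 : |u s| * exp (-(K * exp s)) ≤ m := le_csSup hSb ⟨s, hs, rfl⟩
    rw [Real.exp_neg, ← div_eq_mul_inv, div_le_iff₀ (Real.exp_pos _)] at h1
    exact h1
  have hm0 : 0 ≤ m := by
    have := (abs_nonneg _).trans (hle t ht)
    exact nonneg_of_mul_nonneg_left this (Real.exp_pos _)
  have hw : ∀ s < T, |p' s| ≤ exp (2 * s) * ((M * m) * exp (K * exp s) + ε) := by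
    intro s hs
    refine (h s hs).trans ?_
    have := hle s hs
    rw [mul_assoc]
    gcongr
  have hmb : m ≤ 2 * (|e| + ε * exp (2 * T)) := by
    have : m ≤ |e| + ε * exp (2 * T) + m / 2 := by
      refine csSup_le ⟨_, t, ht, rfl⟩ ?_
      rintro _ ⟨s, hs, rfl⟩
      simp only
      have h1 := (weighted_bound hK0 (mul_nonneg hM hm0) hu hp hw hu0 hp0 hs).2
      have h2 : M * m / K ^ 2 ≤ m / 2 := by
        rw [div_le_div_iff₀ (by positivity) (by norm_num)]
        have : 2 * M ≤ K ^ 2 := by rw [hK]; nlinarith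
        nlinarith
      have hE1 : 1 ≤ exp (K * exp s) := Real.one_le_exp (by positivity)
      have h3 : |u s| ≤ (|e| + ε * exp (2 * T) + m / 2) * exp (K * exp s) := by
        have h4 : |u s| ≤ |u s - e| + |e| := by
          have := abs_add_le (u s - e) e
          simpa using this
        have h5 : M * m / K ^ 2 * (exp (K * exp s) - 1) ≤ m / 2 * (exp (K * exp s) - 1) := by
          gcongr
        have h6 : exp (2 * s) ≤ exp (2 * T) := Real.exp_le_exp.2 (by linarith [mem_Iio.1 hs])
        have h7 : ε / 4 * exp (2 * s) ≤ ε * exp (2 * T) := by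
          have := mul_le_mul_of_nonneg_left h6 hε
          have := mul_nonneg hε (Real.exp_pos (2 * s)).le
          linarith
        have h8 : (|e| + ε * exp (2 * T)) * 1 ≤ (|e| + ε * exp (2 * T)) * exp (K * exp s) := by
          gcongr
        nlinarith
      rw [Real.exp_neg, ← div_eq_mul_inv, div_le_iff₀ (Real.exp_pos _)]
      exact h3
    linarith
  have hub : ∀ s < T, |u s| ≤ growth M T * (|e| + ε * exp (2 * T)) := by
    intro s hs
    refine (hle s hs).trans ?_
    have h1 : exp (K * exp s) ≤ exp (K * exp T) := by gcongr
    calc m * exp (K * exp s) ≤ (2 * (|e| + ε * exp (2 * T))) * exp (K * exp T) := by gcongr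
      _ = _ := by rw [growth]; ring
  set c := growth M T * (|e| + ε * exp (2 * T)) with hc
  have hc0 : 0 ≤ c := (abs_nonneg _).trans (hub t ht)
  -- A second pass with the bound just found for `|u|`: the forcing is now a constant times
  -- `e^{2t}`, so `p` and `u - e` inherit this decay rate.
  have hw2 : ∀ s < T, |p' s| ≤ exp (2 * s) * (0 * exp (K * exp s) + (M * c + ε)) := by
    intro s hs
    refine (h s hs).trans ?_
    rw [zero_mul, zero_add]
    have := hub s hs
    gcongr
  have h9 := weighted_bound hK0 le_rfl hu hp hw2 hu0 hp0 ht
  simp only [zero_div, zero_mul, zero_add] at h9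
  have hpos : 0 ≤ (M * c + ε) * exp (2 * t) := by positivity
  exact ⟨hub t ht, h9.1.trans (by linarith), h9.2.trans (by linarith)⟩

/-! ### Existence -/

theorem exists_linear_step {f : ℝ → ℝ} {A K : ℝ} (hK : 0 < K) (hA : 0 ≤ A) (hf : Continuous f)
    (h : ∀ t, |f t| ≤ exp (2 * t) * (A * exp (K * exp t))) :
    ∃ y p : ℝ → ℝ, (∀ t, HasDerivAt y (p t) t) ∧ (∀ t, HasDerivAt p (f t) t) ∧
      Tendsto y atBot (𝓝 1) ∧ Tendsto p atBot (𝓝 0) := by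
  have hB0 : Tendsto (fun t => A / K ^ 2 * (K * exp t * exp (K * exp t))) atBot (𝓝 0) := by
    have h1 := ((Real.tendsto_exp_atBot.const_mul K).mul (tendsto_weight_atBot K)).const_mul
        (A / K ^ 2)
    simpa using h1
  have hB : ∀ t, HasDerivAt (fun t => A / K ^ 2 * (K * exp t * exp (K * exp t))) _ t :=
    fun t => (hasDerivAt_weight' K t).const_mul (A / K ^ 2)
  have hle : ∀ t, |f t| ≤ A / K ^ 2 * ((K * exp t + K ^ 2 * exp (2 * t)) * exp (K * exp t)) := by
    intro s
    have h1 : A / K ^ 2 * ((K * exp s + K ^ 2 * exp (2 * s)) * exp (K * exp s)) =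
          A / K * (exp s * exp (K * exp s)) + A * exp (2 * s) * exp (K * exp s) := by
      field_simp
    rw [h1]
    have : 0 ≤ A / K * (exp s * exp (K * exp s)) := by positivity
    have := h s
    nlinarith
  obtain ⟨p, hp, hp0⟩ := exists_primitive_atBot (T := 0) hf hB (fun t _ => hle t) hB0
  have hpb : ∀ t, |p t| ≤ A / K ^ 2 * (K * exp t * exp (K * exp t)) := fun t =>
    abs_le_of_deriv_le_atBot (T := t + 1) (fun s _ => hp s) (fun s _ => hB s) (fun s _ => hle s)
      hp0 hB0 (by linarith)
  have hpc : Continuous p := continuous_iff_continuousAt.2 fun t => (hp t).continuousAt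
  obtain ⟨y, hy, hy0⟩ := exists_primitive_atBot (T := 0) hpc
    (B := fun t => A / K ^ 2 * (exp (K * exp t) - 1))
    (fun t => ((hasDerivAt_weight K t).sub_const 1).const_mul (A / K ^ 2)) (fun t _ => hpb t)
    (by simpa using ((tendsto_weight_atBot K).sub_const 1).const_mul (A / K ^ 2))
  exact ⟨fun t => y t + 1, p, fun t => (hy t).add_const 1, hp, by simpa using hy0.add_const 1, hp0⟩

/-- The double integration from `-∞` is a contraction with ratio `1 / 2` on the bounded functions `h
= y exp (-K eᵗ)`. The fixed point is a solution on the whole line at once, without a continuation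
argument. -/
theorem exists_volterra {G : ℝ → ℝ → ℝ} {M : ℝ} (hM : 0 ≤ M)
    (hG : Continuous (Function.uncurry G))
    (hL : ∀ t x y, |G t x - G t y| ≤ exp (2 * t) * (M * |x - y|)) (hG0 : ∀ t, G t 0 = 0) :
    ∃ y p : ℝ → ℝ, (∀ t, HasDerivAt y (p t) t) ∧ (∀ t, HasDerivAt p (G t (y t)) t) ∧
      Tendsto y atBot (𝓝 1) ∧ Tendsto p atBot (𝓝 0) := by
  set K := 1 + 2 * M with hK
  have hK0 : 0 < K := by linarith
  have hMK : M / K ^ 2 ≤ 1 / 2 := by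
    rw [div_le_div_iff₀ (by positivity) (by norm_num)]
    rw [hK]
    nlinarith
  have hstep : ∀ h : BoundedContinuousFunction ℝ ℝ, ∃ y p : ℝ → ℝ, (∀ t, HasDerivAt y (p t) t) ∧
      (∀ t, HasDerivAt p (G t (h t * exp (K * exp t))) t) ∧
      Tendsto y atBot (𝓝 1) ∧ Tendsto p atBot (𝓝 0) := by
    intro h
    refine exists_linear_step hK0 (A := M * ‖h‖) (by positivity) ?_ ?_
    · exact hG.comp (continuous_id.prodMk (h.continuous.mul (by fun_prop)))
    · intro t
      have h1 := hL t (h t * exp (K * exp t)) 0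
      rw [hG0, sub_zero, sub_zero, abs_mul, abs_of_pos (Real.exp_pos (K * exp t))] at h1
      refine h1.trans ?_
      have : |h t| ≤ ‖h‖ := h.norm_coe_le_norm t
      rw [mul_assoc M]
      gcongr
  choose y p hy hp hy0 hp0 using hstep
  have hdiff : ∀ h₁ h₂ : BoundedContinuousFunction ℝ ℝ, ∀ t,
      |y h₁ t - y h₂ t| ≤ (1 / 2) * ‖h₁ - h₂‖ * exp (K * exp t) := by
    intro h₁ h₂ t
    have h1 := (weighted_bound (u := fun t => y h₁ t - y h₂ t) (p := fun t => p h₁ t - p h₂ t)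
      (A := M * ‖h₁ - h₂‖) (ε := 0) (T := t + 1) hK0 (by positivity)
      (fun s _ => (hy h₁ s).sub (hy h₂ s)) (fun s _ => (hp h₁ s).sub (hp h₂ s)) ?_
      ((hy0 h₁).sub (hy0 h₂)) (by simpa using (hp0 h₁).sub (hp0 h₂)) (lt_add_one t)).2
    · simp only [sub_self, sub_zero, zero_div, zero_mul, add_zero] at h1
      refine h1.trans ?_
      have hE1 : 1 ≤ exp (K * exp t) := Real.one_le_exp (by positivity)
      calc M * ‖h₁ - h₂‖ / K ^ 2 * (exp (K * exp t) - 1)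
          = M / K ^ 2 * (‖h₁ - h₂‖ * (exp (K * exp t) - 1)) := by ring
        _ ≤ 1 / 2 * (‖h₁ - h₂‖ * (exp (K * exp t) - 1)) := by
            gcongr
        _ ≤ 1 / 2 * (‖h₁ - h₂‖ * (exp (K * exp t))) := by
            gcongr
            linarith
        _ = _ := by ring
    · intro s _
      refine (hL s _ _).trans ?_
      rw [← sub_mul, abs_mul, abs_of_pos (Real.exp_pos (K * exp s)), add_zero]
      have : |h₁ s - h₂ s| ≤ ‖h₁ - h₂‖ := (h₁ - h₂).norm_coe_le_norm s
      rw [mul_assoc M]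
      gcongr
  -- For `h = 0` the forcing vanishes and the solution is the constant `1`. With `hdiff` this shows
  -- that every image function is bounded.
  have hbase : ∀ t, |y 0 t| ≤ exp (K * exp t) := by
    intro t
    have h1 := (weighted_bound (u := y 0) (p := p 0)
      (A := 0) (ε := 0) (T := t + 1) hK0 le_rfl
      (fun s _ => hy 0 s) (fun s _ => hp 0 s) (fun s _ => by simp [hG0])
      (hy0 0) (hp0 0) (lt_add_one t)).2
    simp only [zero_div, zero_mul, add_zero, abs_nonpos_iff, sub_eq_zero] at h1
    rw [h1, abs_one]
    exact Real.one_le_exp (by positivity)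
  let Φ : BoundedContinuousFunction ℝ ℝ → BoundedContinuousFunction ℝ ℝ := fun h =>
    BoundedContinuousFunction.ofNormedAddCommGroup (fun t => y h t * exp (-(K * exp t)))
      ((continuous_iff_continuousAt.2 fun t => (hy h t).continuousAt).mul (by fun_prop))
      (1 + (1 / 2) * ‖h - 0‖) (by
        intro t
        rw [norm_mul, Real.norm_eq_abs, Real.norm_eq_abs, abs_of_pos (Real.exp_pos _),
          Real.exp_neg, ← div_eq_mul_inv, div_le_iff₀ (Real.exp_pos _)]
        have h1 := hdiff h 0 t
        have h2 := abs_add_le (y h t - y 0 t) (y 0 t)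
        rw [sub_add_cancel] at h2
        have h3 := hbase t
        nlinarith)
  have hΦ : ContractingWith (1 / 2) Φ := by
    refine ⟨by norm_num, LipschitzWith.of_dist_le_mul fun h₁ h₂ => ?_⟩
    rw [BoundedContinuousFunction.dist_le (by positivity)]
    intro t
    change dist (y h₁ t * exp (-(K * exp t))) (y h₂ t * exp (-(K * exp t))) ≤ _
    rw [Real.dist_eq, ← sub_mul, abs_mul, abs_of_pos (Real.exp_pos _),
          Real.exp_neg, ← div_eq_mul_inv, div_le_iff₀ (Real.exp_pos _), dist_eq_norm]
    simpa using hdiff h₁ h₂ t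
  have hfix : Φ (hΦ.fixedPoint Φ) = hΦ.fixedPoint Φ := hΦ.fixedPoint_isFixedPt
  set h := hΦ.fixedPoint Φ with hh
  have hval : ∀ t, h t * exp (K * exp t) = y h t := by
    intro t
    have h1 : y h t * exp (-(K * exp t)) = h t := DFunLike.congr_fun hfix t
    rw [← h1, mul_assoc, ← Real.exp_add]
    simp
  refine ⟨y h, p h, hy h, fun t => ?_, hy0 h, hp0 h⟩
  have := hp h t
  rwa [hval] at this

/-! ### Uniqueness for the initial value problem -/

/-- For `N = u² + p²` one has `|N'| ≤ (1 + M) N`, so `N e^{(1+M)t}` is nondecreasing and `N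
e^{-(1+M)t}` nonincreasing. The first handles times before `a`, the second times after. -/
theorem eq_zero_of_initial {u p p' : ℝ → ℝ} {M a : ℝ} (hM : 0 ≤ M)
    (hu : ∀ t, HasDerivAt u (p t) t) (hp : ∀ t, HasDerivAt p (p' t) t)
    (h : ∀ t, |p' t| ≤ M * |u t|) (hua : u a = 0) (hpa : p a = 0) (t : ℝ) :
    u t = 0 ∧ p t = 0 := by
  set N : ℝ → ℝ := fun t => u t ^ 2 + p t ^ 2 with hN
  have hNd : ∀ t, HasDerivAt N (2 * u t * p t + 2 * p t * p' t) t := by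
    intro t
    refine (((hu t).pow 2).add ((hp t).pow 2)).congr_deriv ?_
    push_cast
    ring
  have hb : ∀ t, |2 * u t * p t + 2 * p t * p' t| ≤ (1 + M) * N t := by
    intro t
    have h1 : |2 * u t * p t + 2 * p t * p' t| ≤ 2 * |u t| * |p t| + 2 * |p t| * (M * |u t|) := by
      refine (abs_add_le _ _).trans ?_
      rw [abs_mul, abs_mul, abs_mul, abs_mul, abs_two]
      have := h t
      gcongr
    refine h1.trans ?_
    have : 2 * |u t| * |p t| ≤ u t ^ 2 + p t ^ 2 := by
      rw [← sq_abs (u t), ← sq_abs (p t)]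
      nlinarith [sq_nonneg (|u t| - |p t|)]
    simp only [hN]
    nlinarith
  have hNa : N a = 0 := by simp [hN, hua, hpa]
  have hN0 : ∀ t, 0 ≤ N t := fun t => by simp only [hN]; positivity
  have hz : N t = 0 := by
    have hder : ∀ c t, HasDerivAt (fun s => N s * exp (c * s))
        ((2 * u t * p t + 2 * p t * p' t + c * N t) * exp (c * t)) t := by
      intro c t
      refine ((hNd t).mul ((hasDerivAt_id t).const_mul c).exp).congr_deriv ?_
      simp only [id]
      ring
    rcases le_total t a with hta | hta
    · have hmono : Monotone (fun s => N s * exp ((1 + M) * s)) :=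
        monotone_of_hasDerivAt_nonneg (hder _) fun s =>
          mul_nonneg (by have := (abs_le.1 (hb s)).1; linarith) (Real.exp_pos _).le
      have := hmono hta
      simp only [hNa, zero_mul] at this
      have h2 : N t ≤ 0 := nonpos_of_mul_nonpos_left this (Real.exp_pos _)
      exact le_antisymm h2 (hN0 t)
    · have hmono : Antitone (fun s => N s * exp (-(1 + M) * s)) :=
        antitone_of_hasDerivAt_nonpos (hder _) fun s =>
          mul_nonpos_of_nonpos_of_nonneg (by have := (abs_le.1 (hb s)).2; linarith)
            (Real.exp_pos _).le
      have := hmono hta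
      simp only [hNa, zero_mul] at this
      have h2 : N t ≤ 0 := nonpos_of_mul_nonpos_left this (Real.exp_pos _)
      exact le_antisymm h2 (hN0 t)
  have h1 : u t ^ 2 = 0 ∧ p t ^ 2 = 0 := by
    have := sq_nonneg (u t)
    have := sq_nonneg (p t)
    simp only [hN] at hz
    constructor <;> linarith
  exact ⟨pow_eq_zero_iff (two_ne_zero) |>.1 h1.1, pow_eq_zero_iff (two_ne_zero) |>.1 h1.2⟩

theorem exists_bound_Iic {u : ℝ → ℝ} {T l : ℝ} (hc : ContinuousOn u (Iic T))
    (hl : Tendsto u atBot (𝓝 l)) : ∃ B, ∀ t ≤ T, |u t| ≤ B := by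
  have h1 : ∀ᶠ t in atBot, |u t| ≤ |l| + 1 := by
    have := hl.abs.eventually (gt_mem_nhds (lt_add_one |l|))
    exact this.mono fun _ h => h.le
  obtain ⟨a, ha⟩ := eventually_atBot.1 h1
  obtain ⟨C, hC⟩ := isCompact_Icc.exists_bound_of_continuousOn
    (hc.mono (Icc_subset_Iic_self : Icc a T ⊆ Iic T))
  refine ⟨max (|l| + 1) C, fun t ht => ?_⟩
  rcases le_total t a with h | h
  · exact (ha t h).trans (le_max_left _ _)
  · exact (hC t ⟨h, ht⟩).trans (le_max_right _ _)

theorem le_of_forall_lt_of_continuousAt {f : ℝ → ℝ} {T c : ℝ} (hf : ContinuousWithinAt f (Iic T) T)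
    (h : ∀ t < T, f t ≤ c) : f T ≤ c := by
  refine le_of_tendsto (hf.mono_left (nhdsWithin_mono T Iio_subset_Iic_self)) ?_
  filter_upwards [self_mem_nhdsWithin] with t ht using h t ht

/-! ### The weight `sin² θ` and the truncated nonlinearity -/

/-- `sin² θ` along `θ = 2 arctan (exp t)`. -/
noncomputable def sech2 (t : ℝ) : ℝ := (cosh t ^ 2)⁻¹

theorem sech2_pos (t : ℝ) : 0 < sech2 t := by
  have := Real.cosh_pos t
  unfold sech2; positivity

theorem sech2_le_one (t : ℝ) : sech2 t ≤ 1 :=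
  inv_le_one_of_one_le₀ (one_le_pow₀ (Real.one_le_cosh t))

theorem sech2_neg (t : ℝ) : sech2 (-t) = sech2 t := by simp [sech2]

theorem sech2_le (t : ℝ) : sech2 t ≤ 4 * exp (2 * t) := by
  have h1 : exp (-t) / 2 ≤ cosh t := by
    rw [Real.cosh_eq]
    have := Real.exp_pos t
    linarith
  have h2 : (exp (-t) / 2) ^ 2 ≤ cosh t ^ 2 := by
    gcongr
  have h3 : (exp (-t) / 2) ^ 2 * (4 * exp (2 * t)) = 1 := by
    rw [div_pow, ← Real.exp_nat_mul]
    push_cast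
    have : exp (2 * -t) * exp (2 * t) = 1 := by rw [← Real.exp_add]; simp
    linarith
  rw [sech2, inv_le_iff_one_le_mul₀ (by have := Real.cosh_pos t; positivity), ← h3, mul_comm]
  gcongr

theorem continuous_sech2 : Continuous sech2 := by
  unfold sech2
  exact (Real.continuous_cosh.pow 2).inv₀ fun t => (pow_pos (Real.cosh_pos t) 2).ne'

/-- The nonlinearity `y (1 - κ y²)`, replaced by `0` where `κ y² > 1`. -/
noncomputable def cutoff (κ y : ℝ) : ℝ := y * max 0 (1 - κ * y ^ 2)

theorem cutoff_zero_right (κ : ℝ) : cutoff κ 0 = 0 := by simp [cutoff]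

theorem cutoff_zero_left (y : ℝ) : cutoff 0 y = y := by simp [cutoff]

theorem cutoff_neg (κ y : ℝ) : cutoff κ (-y) = -cutoff κ y := by simp [cutoff]

theorem cutoff_of_le {κ y : ℝ} (h : κ * y ^ 2 ≤ 1) : cutoff κ y = y * (1 - κ * y ^ 2) := by
  rw [cutoff, max_eq_right (by linarith)]

theorem continuous_cutoff (κ : ℝ) : Continuous (cutoff κ) := by
  unfold cutoff; fun_prop

theorem abs_cutoff_le {κ : ℝ} (hκ : 0 ≤ κ) (y : ℝ) : |cutoff κ y| ≤ |y| := by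
  rw [cutoff, abs_mul]
  refine mul_le_of_le_one_right (abs_nonneg _) ?_
  rw [abs_of_nonneg (le_max_left _ _)]
  exact max_le zero_le_one (by nlinarith [sq_nonneg y])

theorem abs_cutoff_sub_param_le (κ κ₀ y : ℝ) : |cutoff κ y - cutoff κ₀ y| ≤ |κ - κ₀| * |y| ^ 3 := by
  rw [cutoff, cutoff, ← mul_sub, abs_mul]
  have h1 := abs_max_sub_max_le_abs (1 - κ * y ^ 2) (1 - κ₀ * y ^ 2) 0
  rw [max_comm _ 0, max_comm _ 0] at h1
  have h2 : |1 - κ * y ^ 2 - (1 - κ₀ * y ^ 2)| = |κ - κ₀| * |y| ^ 2 := by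
    rw [show 1 - κ * y ^ 2 - (1 - κ₀ * y ^ 2) = -((κ - κ₀) * y ^ 2) by ring, abs_neg, abs_mul,
      abs_pow]
  rw [h2] at h1
  have := mul_le_mul_of_nonneg_left h1 (abs_nonneg y)
  linarith [this, (by ring : |y| * (|κ - κ₀| * |y| ^ 2) = |κ - κ₀| * |y| ^ 3)]

/-- The slope `1 - 3 κ y²` lies in `[-2, 1]` where `κ y² ≤ 1`, and beyond that the function is `0`.
The constant does not depend on `κ`, which keeps the later estimates uniform in `κ`. -/
theorem abs_cutoff_sub_le {κ : ℝ} (hκ : 0 ≤ κ) (x y : ℝ) :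
    |cutoff κ x - cutoff κ y| ≤ 2 * |x - y| := by
  -- With `κ = s²` the factor splits as `(1 - s |x|) (1 + s |x|)`, which settles the case where only
  -- one of the points lies in the cut-off region.
  obtain ⟨s, hs, rfl⟩ : ∃ s, 0 ≤ s ∧ κ = s ^ 2 := ⟨√κ, Real.sqrt_nonneg _, (Real.sq_sqrt hκ).symm⟩
  have mixed : ∀ x y : ℝ, s ^ 2 * x ^ 2 ≤ 1 → 1 ≤ s ^ 2 * y ^ 2 →
      |x * (1 - s ^ 2 * x ^ 2)| ≤ 2 * |x - y| := by
    intro x y hx hy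
    rw [abs_mul, abs_of_nonneg (a := 1 - s ^ 2 * x ^ 2) (by linarith)]
    have hx' : s * |x| ≤ 1 := by
      rw [← sq_abs x, ← mul_pow] at hx
      exact (sq_le_one_iff₀ (by positivity)).1 hx
    have hy' : 1 ≤ s * |y| := by
      rw [← sq_abs y, ← mul_pow] at hy
      exact (one_le_sq_iff₀ (by positivity)).1 hy
    have h3 : |y| - |x| ≤ |x - y| := by
      rw [abs_sub_comm]; exact abs_sub_abs_le_abs_sub y x
    have h4 : |x| * (1 - s * |x|) ≤ |y| - |x| := by
      have hs0 : 0 < s := by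
        rcases hs.eq_or_lt with h | h
        · rw [← h] at hy'; norm_num at hy'
        · exact h
      have h5 : (1 - s * |x|) / s ≤ |y| - |x| := by
        rw [div_le_iff₀ hs0]; linarith
      refine le_trans ?_ h5
      rw [le_div_iff₀ hs0]
      have h0 : 0 ≤ 1 - s * |x| := by linarith
      nlinarith
    have h6 : 1 - s ^ 2 * x ^ 2 = (1 - s * |x|) * (1 + s * |x|) := by
      rw [← sq_abs x]; ring
    rw [h6]
    have h7 : 0 ≤ |x| * (1 - s * |x|) := mul_nonneg (abs_nonneg x) (by linarith)
    nlinarith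
  unfold cutoff
  rcases le_total (s ^ 2 * x ^ 2) 1 with hx | hx <;> rcases le_total (s ^ 2 * y ^ 2) 1 with hy | hy
  · rw [max_eq_right (by linarith), max_eq_right (by linarith)]
    have h1 : x * (1 - s ^ 2 * x ^ 2) - y * (1 - s ^ 2 * y ^ 2) =
        (1 - (s ^ 2 * x ^ 2 + (s * x) * (s * y) + s ^ 2 * y ^ 2)) * (x - y) := by ring
    rw [h1, abs_mul]
    gcongr
    rw [abs_le]
    constructor <;> nlinarith [sq_nonneg (s * x + s * y), sq_nonneg (s * x - s * y)]
  · rw [max_eq_right (by linarith), max_eq_left (by linarith), mul_zero, sub_zero]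
    exact mixed x y hx hy
  · rw [max_eq_left (by linarith), max_eq_right (by linarith), mul_zero, zero_sub, abs_neg,
      abs_sub_comm]
    exact mixed y x hy hx
  · rw [max_eq_left (by linarith), max_eq_left (by linarith)]
    simp

/-! ### The regular solution at the pole -/

/-- `y`, `p` solve `y' = p`, `p' = -lam sech² cutoff κ y` with `y → 1`, `p → 0` at `-∞`. -/
structure IsProfile (lam κ : ℝ) (y p : ℝ → ℝ) : Prop where
  deriv_y : ∀ t, HasDerivAt y (p t) t
  deriv_p : ∀ t, HasDerivAt p (-(lam * sech2 t * cutoff κ (y t))) t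
  lim_y : Tendsto y atBot (𝓝 1)
  lim_p : Tendsto p atBot (𝓝 0)

theorem exists_isProfile (lam : ℝ) {κ : ℝ} (hκ : 0 ≤ κ) : ∃ y p, IsProfile lam κ y p := by
  have hG : Continuous (Function.uncurry fun t x => -(lam * sech2 t * cutoff κ x)) :=
    ((((continuous_sech2.comp continuous_fst).const_mul lam).mul
      ((continuous_cutoff κ).comp continuous_snd))).neg
  refine (exists_volterra (M := 8 * |lam|) (by positivity) hG (fun t x y => ?_) fun t => ?_).imp
    fun y => Exists.imp fun p h => ⟨h.1, h.2.1, h.2.2.1, h.2.2.2⟩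
  · have h1 : -(lam * sech2 t * cutoff κ x) - -(lam * sech2 t * cutoff κ y) =
        -(lam * sech2 t * (cutoff κ x - cutoff κ y)) := by ring
    rw [h1, abs_neg, abs_mul, abs_mul, abs_of_pos (sech2_pos t)]
    have h2 := sech2_le t
    have h3 := abs_cutoff_sub_le hκ x y
    calc |lam| * sech2 t * |cutoff κ x - cutoff κ y|
        ≤ |lam| * (4 * exp (2 * t)) * (2 * |x - y|) := by gcongr
      _ = _ := by ring
  · simp [cutoff_zero_right]

open Classical in
/-- The regular solution at the pole and its derivative. -/
noncomputable def profile (lam κ : ℝ) : (ℝ → ℝ) × (ℝ → ℝ) :=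
  if h : 0 ≤ κ then
    (Classical.choose (exists_isProfile lam h),
      Classical.choose (Classical.choose_spec (exists_isProfile lam h)))
  else (0, 0)

theorem isProfile_profile (lam : ℝ) {κ : ℝ} (hκ : 0 ≤ κ) :
    IsProfile lam κ (profile lam κ).1 (profile lam κ).2 := by
  unfold profile
  rw [dif_pos hκ]
  exact Classical.choose_spec (Classical.choose_spec (exists_isProfile lam hκ))

namespace IsProfile

variable {lam κ : ℝ} {y p : ℝ → ℝ}

theorem continuous_y (h : IsProfile lam κ y p) : Continuous y :=
  continuous_iff_continuousAt.2 fun t => (h.deriv_y t).continuousAt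

theorem continuous_p (h : IsProfile lam κ y p) : Continuous p :=
  continuous_iff_continuousAt.2 fun t => (h.deriv_p t).continuousAt

theorem bounds (h : IsProfile lam κ y p) (hκ : 0 ≤ κ) {L : ℝ} (hL : |lam| ≤ L) {T t : ℝ}
    (ht : t < T) :
    |y t| ≤ growth (4 * L) T ∧ |p t| ≤ 4 * L * growth (4 * L) T * exp (2 * t) ∧
      |y t - 1| ≤ 4 * L * growth (4 * L) T * exp (2 * t) := by
  have hL0 : 0 ≤ L := (abs_nonneg _).trans hL
  obtain ⟨B, hB⟩ := exists_bound_Iic (T := T) h.continuous_y.continuousOn h.lim_y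
  have := volterra_bound (M := 4 * L) (ε := 0) (T := T) (by positivity) le_rfl
    (fun s _ => h.deriv_y s) (fun s _ => h.deriv_p s) (fun s _ => ?_) (fun s hs => hB s hs.le)
    h.lim_y h.lim_p ht
  · simpa using this
  · rw [abs_neg, abs_mul, abs_mul, abs_of_pos (sech2_pos s), add_zero]
    have h2 := sech2_le s
    have h3 := abs_cutoff_le hκ (y s)
    have h4 := (sech2_pos s).le
    calc |lam| * sech2 s * |cutoff κ (y s)|
        ≤ L * (4 * exp (2 * s)) * (|y s|) := by gcongr
      _ = _ := by ring

/-- A common zero of `y` and `p` would force `y = 0` everywhere, against `y → 1`. This is what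
allows a continuous angle to be defined. -/
theorem ne_zero (h : IsProfile lam κ y p) (hκ : 0 ≤ κ) (t : ℝ) : 0 < y t ^ 2 + p t ^ 2 := by
  by_contra hcon
  have h1 : y t = 0 ∧ p t = 0 := by
    have := sq_nonneg (y t)
    have := sq_nonneg (p t)
    constructor <;> exact pow_eq_zero_iff (two_ne_zero) |>.1 (by linarith)
  have h2 : ∀ s, y s = 0 := fun s => (eq_zero_of_initial (M := |lam|) (abs_nonneg _) h.deriv_y
    h.deriv_p (fun s => by
      rw [abs_neg, abs_mul, abs_mul, abs_of_pos (sech2_pos s)]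
      have h2 := sech2_le_one s
      have h3 := abs_cutoff_le hκ (y s)
      calc |lam| * sech2 s * |cutoff κ (y s)| ≤ |lam| * 1 * |y s| := by
            gcongr
        _ = _ := by ring) h1.1 h1.2 s).1
  have h3 := h.lim_y
  simp only [funext h2] at h3
  exact zero_ne_one (tendsto_nhds_unique tendsto_const_nhds h3)

/-- Since `sech²` is even, `t ↦ y (-t)` solves the same equation, and it has the same data at the
equator. The odd case uses in addition that the nonlinearity is odd. -/
theorem even_of_p (h : IsProfile lam κ y p) (hκ : 0 ≤ κ) (h0 : p 0 = 0) (t : ℝ) :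
    y (-t) = y t ∧ p (-t) = -p t := by
  have h1 := eq_zero_of_initial (u := fun t => y t - y (-t)) (p := fun t => p t + p (-t))
    (p' := fun t => -(lam * sech2 t * cutoff κ (y t)) + lam * sech2 t * cutoff κ (y (-t)))
    (M := 2 * |lam|) (a := 0) (by positivity)
    (fun s => ((h.deriv_y s).sub ((h.deriv_y (-s)).comp s (hasDerivAt_neg s))).congr_deriv (by ring))
    (fun s => ((h.deriv_p s).add ((h.deriv_p (-s)).comp s (hasDerivAt_neg s))).congr_deriv
      (by rw [sech2_neg]; ring))
    (fun s => by
      rw [show -(lam * sech2 s * cutoff κ (y s)) + lam * sech2 s * cutoff κ (y (-s)) =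
        -(lam * sech2 s * (cutoff κ (y s) - cutoff κ (y (-s)))) by ring, abs_neg, abs_mul, abs_mul,
        abs_of_pos (sech2_pos s)]
      have h2 := sech2_le_one s
      have h3 := abs_cutoff_sub_le hκ (y s) (y (-s))
      calc _ ≤ |lam| * 1 * (2 * |y s - y (-s)|) := by gcongr
        _ = _ := by ring) (by simp) (by simp [h0]) t
  constructor <;> linarith [h1.1, h1.2]

theorem odd_of_y (h : IsProfile lam κ y p) (hκ : 0 ≤ κ) (h0 : y 0 = 0) (t : ℝ) :
    y (-t) = -y t ∧ p (-t) = p t := by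
  have h1 := eq_zero_of_initial (u := fun t => y t + y (-t)) (p := fun t => p t - p (-t))
    (p' := fun t => -(lam * sech2 t * cutoff κ (y t)) - lam * sech2 t * cutoff κ (y (-t)))
    (M := 2 * |lam|) (a := 0) (by positivity)
    (fun s => ((h.deriv_y s).add ((h.deriv_y (-s)).comp s (hasDerivAt_neg s))).congr_deriv (by ring))
    (fun s => ((h.deriv_p s).sub ((h.deriv_p (-s)).comp s (hasDerivAt_neg s))).congr_deriv
      (by rw [sech2_neg]; ring))
    (fun s => by
      rw [show -(lam * sech2 s * cutoff κ (y s)) - lam * sech2 s * cutoff κ (y (-s)) =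
        -(lam * sech2 s * (cutoff κ (y s) - cutoff κ (-y (-s)))) by rw [cutoff_neg]; ring,
        abs_neg, abs_mul, abs_mul, abs_of_pos (sech2_pos s)]
      have h2 := sech2_le_one s
      have h3 := abs_cutoff_sub_le hκ (y s) (-y (-s))
      rw [sub_neg_eq_add] at h3
      calc _ ≤ |lam| * 1 * (2 * |y s + y (-s)|) := by gcongr
        _ = _ := by ring) (by simp [h0]) (by simp) t
  constructor <;> linarith [h1.1, h1.2]

end IsProfile

/-! ### Lipschitz dependence on the parameters, and uniqueness -/

theorem exists_profile_dist_le (L T : ℝ) : ∃ C, 0 ≤ C ∧ ∀ lam κ lam₀ κ₀ y p y₀ p₀,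
    |lam| ≤ L → |lam₀| ≤ L → 0 ≤ κ → 0 ≤ κ₀ → IsProfile lam κ y p → IsProfile lam₀ κ₀ y₀ p₀ →
    ∀ t < T, |y t - y₀ t| ≤ C * (|lam - lam₀| + |κ - κ₀|) ∧
      |p t - p₀ t| ≤ C * (|lam - lam₀| + |κ - κ₀|) := by
  rcases lt_or_ge L 0 with hL0 | hL0
  · exact ⟨0, le_rfl, fun lam _ _ _ _ _ _ _ h => absurd ((abs_nonneg lam).trans h) (by linarith)⟩
  have hg0 : 0 < growth (4 * L) T := growth_pos _ _
  have hg1 : 0 < growth (8 * L) T := growth_pos _ _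
  -- The first summand bounds the forcing caused by a change of `λ`, the second the forcing caused
  -- by a change of `κ`, which is cubic in the solution.
  set a := 4 * growth (4 * L) T + 4 * L * growth (4 * L) T ^ 3 with ha
  have ha0 : 0 ≤ a := by positivity
  set b := growth (8 * L) T * (a * exp (2 * T)) with hb
  have hb0 : 0 ≤ b := by positivity
  refine ⟨b + (8 * L * b + a) * exp (2 * T), by positivity, ?_⟩
  intro lam κ lam₀ κ₀ y p y₀ p₀ hlam hlam₀ hκ hκ₀ h h₀ t ht
  set δ := |lam - lam₀| + |κ - κ₀| with hδ
  have hδ0 : 0 ≤ δ := by positivity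
  obtain ⟨B, hB⟩ := exists_bound_Iic (T := T) h.continuous_y.continuousOn h.lim_y
  obtain ⟨B₀, hB₀⟩ := exists_bound_Iic (T := T) h₀.continuous_y.continuousOn h₀.lim_y
  have := volterra_bound (M := 8 * L) (ε := a * δ) (T := T) (e := 0) (B := B + B₀)
    (u := fun t => y t - y₀ t) (p := fun t => p t - p₀ t)
    (p' := fun t => -(lam * sech2 t * cutoff κ (y t)) - -(lam₀ * sech2 t * cutoff κ₀ (y₀ t)))
    (by positivity) (by positivity)
    (fun s _ => (h.deriv_y s).sub (h₀.deriv_y s)) (fun s _ => (h.deriv_p s).sub (h₀.deriv_p s))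
    (fun s hs => ?_) (fun s hs => ?_) (by simpa using h.lim_y.sub h₀.lim_y)
    (by simpa using h.lim_p.sub h₀.lim_p) ht
  · have hT : exp (2 * t) ≤ exp (2 * T) := Real.exp_le_exp.2 (by linarith)
    simp only [abs_zero, zero_add] at this
    have hbb : growth (8 * L) T * (a * δ * exp (2 * T)) = b * δ := by rw [hb]; ring
    rw [hbb] at this
    refine ⟨this.1.trans ?_, this.2.1.trans ?_⟩
    · gcongr
      have : 0 ≤ (8 * L * b + a) * exp (2 * T) := by positivity
      linarith
    · calc (8 * L * (b * δ) + a * δ) * exp (2 * t) ≤ (8 * L * (b * δ) + a * δ) * exp (2 * T) := by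
            gcongr
        _ = ((8 * L * b + a) * exp (2 * T)) * δ := by ring
        _ ≤ _ := by gcongr; linarith
  · have hy₀ := (h₀.bounds hκ₀ hlam₀ hs).1
    have e1 : -(lam * sech2 s * cutoff κ (y s)) - -(lam₀ * sech2 s * cutoff κ₀ (y₀ s)) =
        -(sech2 s * (lam * (cutoff κ (y s) - cutoff κ (y₀ s)) + (lam - lam₀) * cutoff κ (y₀ s)
          + lam₀ * (cutoff κ (y₀ s) - cutoff κ₀ (y₀ s)))) := by ring
    rw [e1, abs_neg, abs_mul, abs_of_pos (sech2_pos s)]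
    have i1 : |lam * (cutoff κ (y s) - cutoff κ (y₀ s)) + (lam - lam₀) * cutoff κ (y₀ s)
          + lam₀ * (cutoff κ (y₀ s) - cutoff κ₀ (y₀ s))| ≤
        L * (2 * |y s - y₀ s|) + |lam - lam₀| * growth (4 * L) T +
          L * (|κ - κ₀| * growth (4 * L) T ^ 3) := by
      refine (abs_add_three _ _ _).trans ?_
      rw [abs_mul, abs_mul, abs_mul]
      have j1 := abs_cutoff_sub_le hκ (y s) (y₀ s)
      have j2 := (abs_cutoff_le hκ (y₀ s)).trans hy₀
      have j3 : |cutoff κ (y₀ s) - cutoff κ₀ (y₀ s)| ≤ |κ - κ₀| * growth (4 * L) T ^ 3 :=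
        (abs_cutoff_sub_param_le κ κ₀ (y₀ s)).trans (by gcongr)
      gcongr
    have i2 := sech2_le s
    calc sech2 s * _ ≤ 4 * exp (2 * s) * (L * (2 * |y s - y₀ s|) +
            |lam - lam₀| * growth (4 * L) T + L * (|κ - κ₀| * growth (4 * L) T ^ 3)) := by
          gcongr
      _ = exp (2 * s) * (8 * L * |y s - y₀ s| + (4 * growth (4 * L) T * |lam - lam₀| +
            4 * L * growth (4 * L) T ^ 3 * |κ - κ₀|)) := by ring
      _ ≤ exp (2 * s) * (8 * L * |y s - y₀ s| + (a * |lam - lam₀| + a * |κ - κ₀|)) := by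
          have k1 : 4 * growth (4 * L) T ≤ a := by
            rw [ha]
            have : 0 ≤ 4 * L * growth (4 * L) T ^ 3 := by positivity
            linarith
          have k2 : 4 * L * growth (4 * L) T ^ 3 ≤ a := by
            rw [ha]
            linarith
          gcongr
      _ = _ := by rw [hδ]; ring
  · exact (abs_sub _ _).trans (add_le_add (hB s hs.le) (hB₀ s hs.le))

theorem IsProfile.unique {lam κ : ℝ} (hκ : 0 ≤ κ) {y p y₀ p₀ : ℝ → ℝ} (h : IsProfile lam κ y p)
    (h₀ : IsProfile lam κ y₀ p₀) (t : ℝ) : y t = y₀ t ∧ p t = p₀ t := by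
  obtain ⟨C, -, hC⟩ := exists_profile_dist_le |lam| (t + 1)
  have := hC lam κ lam κ y p y₀ p₀ le_rfl le_rfl hκ hκ h h₀ t (by linarith)
  simpa [sub_eq_zero] using this

/-! ### Energy bound on the first hemisphere -/

/-- The square of the positive part is differentiable across the kink, so the cut-off equation still
has a differentiable potential. -/
theorem hasDerivAt_sq_max_zero (x : ℝ) : HasDerivAt (fun z : ℝ => max 0 z ^ 2) (2 * max 0 x) x := by
  rcases lt_trichotomy x 0 with hx | rfl | hx
  · rw [max_eq_left hx.le, mul_zero]
    refine (hasDerivAt_const x (0 : ℝ)).congr_of_eventuallyEq ?_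
    filter_upwards [gt_mem_nhds hx] with z hz
    simp [max_eq_left (le_of_lt hz)]
  · simp only [max_self, mul_zero]
    rw [hasDerivAt_iff_isLittleO_nhds_zero]
    simp only [zero_add, max_self, ne_eq, OfNat.ofNat_ne_zero, not_false_eq_true, zero_pow,
      sub_zero, smul_eq_mul, mul_zero]
    have h1 : (fun h : ℝ => max 0 h ^ 2) =O[𝓝 0] fun h : ℝ => h ^ 2 := by
      refine Asymptotics.isBigO_of_le _ fun z => ?_
      rw [norm_pow, norm_pow]
      gcongr
      rw [Real.norm_eq_abs, Real.norm_eq_abs, abs_of_nonneg (le_max_left _ _)]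
      exact max_le (abs_nonneg _) (le_abs_self z)
    exact h1.trans_isLittleO (Asymptotics.isLittleO_pow_id one_lt_two)
  · rw [max_eq_right hx.le]
    refine ((hasDerivAt_pow 2 x).congr_deriv (by simp)).congr_of_eventuallyEq ?_
    filter_upwards [lt_mem_nhds hx] with z hz
    simp [max_eq_right (le_of_lt hz)]

/-- The decay `p = O(e^{2t})` beats the growth `e^{-t}` of `cosh t`. As `p cosh t` is the derivative
of `y` in `θ`, this is the Neumann condition at the pole. -/
theorem IsProfile.tendsto_mul_cosh {lam κ : ℝ} {y p : ℝ → ℝ} (h : IsProfile lam κ y p)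
    (hκ : 0 ≤ κ) : Tendsto (fun t => p t * cosh t) atBot (𝓝 0) := by
  have h1 : Tendsto (fun t => 4 * |lam| * growth (4 * |lam|) 0 * exp t) atBot (𝓝 0) := by
    simpa using Real.tendsto_exp_atBot.const_mul (4 * |lam| * growth (4 * |lam|) 0)
  refine squeeze_zero_norm' ?_ h1
  filter_upwards [eventually_lt_atBot 0] with t ht
  have h2 := (h.bounds hκ le_rfl ht).2.1
  have h3 : cosh t ≤ exp (-t) := by
    rw [Real.cosh_eq]
    have : exp t ≤ exp (-t) := Real.exp_le_exp.2 (by linarith)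
    linarith
  rw [norm_mul, Real.norm_eq_abs, Real.norm_eq_abs, abs_of_pos (Real.cosh_pos t)]
  calc |p t| * cosh t ≤ 4 * |lam| * growth (4 * |lam|) 0 * exp (2 * t) * exp (-t) :=
        mul_le_mul h2 h3 (Real.cosh_pos t).le ((abs_nonneg _).trans h2)
    _ = _ := by rw [mul_assoc, ← Real.exp_add]; ring_nf

/-- The energy `κ (p cosh t)² / 2 + λ (1 - max 0 (1 - κ y²)²) / 4` has derivative `κ p² cosh t sinh
t`, which is nonpositive for `t ≤ 0`. Its limit at `-∞` has no kinetic part, so `max 0 (1 - κ y²)`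
never falls below `1 - κ > 0`; in particular the cutoff is not reached. -/
theorem IsProfile.energy_bound {lam κ : ℝ} {y p : ℝ → ℝ} (h : IsProfile lam κ y p) (hlam : 0 < lam)
    (hκ : 0 ≤ κ) (hκ1 : κ < 1) {t : ℝ} (ht : t ≤ 0) : κ * y t ^ 2 ≤ κ := by
  have key : ∀ t < 0, κ * y t ^ 2 ≤ κ := by
    intro t ht
    have hder : ∀ s, HasDerivAt (fun t => -(κ * (p t * cosh t) ^ 2 / 2 +
        lam * ((1 - max 0 (1 - κ * y t ^ 2) ^ 2) / 4))) (-(κ * p s ^ 2 * cosh s * sinh s)) s := by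
      intro s
      have e1 := ((((h.deriv_p s).mul (Real.hasDerivAt_cosh s)).pow 2).const_mul κ).div_const 2
      have e2 := (hasDerivAt_sq_max_zero (1 - κ * y s ^ 2)).comp s
        ((((h.deriv_y s).pow 2).const_mul κ).const_sub 1)
      have e3 := (((e2.const_sub 1).div_const 4).const_mul lam)
      refine (e1.add e3).neg.congr_deriv ?_
      have hc := (Real.cosh_pos s).ne'
      simp only [cutoff, sech2, Pi.mul_apply]
      field_simp
      push_cast
      ring
    have hlim : Tendsto (fun t => -(κ * (p t * cosh t) ^ 2 / 2 +
        lam * ((1 - max 0 (1 - κ * y t ^ 2) ^ 2) / 4))) atBot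
        (𝓝 (-(κ * 0 ^ 2 / 2 + lam * ((1 - max 0 (1 - κ * 1 ^ 2) ^ 2) / 4)))) := by
      refine ((((h.tendsto_mul_cosh hκ).pow 2).const_mul κ |>.div_const 2).add
        ((((?_ : Tendsto _ _ _).pow 2).const_sub 1 |>.div_const 4).const_mul lam)).neg
      exact tendsto_const_nhds.max (((h.lim_y.pow 2).const_mul κ).const_sub 1)
    have h1 := le_of_deriv_nonneg_atBot (T := 0) (fun s _ => hder s) (fun s hs => ?_) hlim ht
    · have h2 : 0 ≤ κ * (p t * cosh t) ^ 2 / 2 := by positivity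
      have h3 : lam * max 0 (1 - κ * 1 ^ 2) ^ 2 ≤ lam * max 0 (1 - κ * y t ^ 2) ^ 2 := by
        generalize max 0 (1 - κ * 1 ^ 2) = m₁ at h1 ⊢
        generalize max 0 (1 - κ * y t ^ 2) = m₂ at h1 ⊢
        linarith
      have h4 := le_of_mul_le_mul_left h3 hlam
      have h5 := (pow_le_pow_iff_left₀ (le_max_left _ _) (le_max_left _ _) two_ne_zero).1 h4
      rw [max_eq_right (by linarith : (0 : ℝ) ≤ 1 - κ * 1 ^ 2)] at h5
      rcases le_max_iff.1 h5 with h6 | h6 <;> linarith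
    · have hs' : sinh s ≤ 0 := Real.sinh_nonpos_iff.2 hs.le
      have hc := Real.cosh_pos s
      have : 0 ≤ κ * p s ^ 2 * cosh s := by positivity
      nlinarith
  rcases ht.eq_or_lt with rfl | ht
  · exact le_of_forall_lt_of_continuousAt
      (f := fun t => κ * y t ^ 2)
      ((h.continuous_y.pow 2).const_mul κ).continuousWithinAt key
  · exact key t ht

theorem isProfile_one (lam : ℝ) : IsProfile lam 1 (fun _ => 1) (fun _ => 0) where
  deriv_y t := hasDerivAt_const t 1
  deriv_p t := by simpa [cutoff] using hasDerivAt_const t (0 : ℝ)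
  lim_y := tendsto_const_nhds
  lim_p := tendsto_const_nhds

theorem isProfile_lam_zero (κ : ℝ) : IsProfile 0 κ (fun _ => 1) (fun _ => 0) where
  deriv_y t := hasDerivAt_const t 1
  deriv_p t := by simpa using hasDerivAt_const t (0 : ℝ)
  lim_y := tendsto_const_nhds
  lim_p := tendsto_const_nhds

/-! ### Angle functions -/

/-- `η` is the continuous clockwise angle of the plane curve `(u, p)` that tends to `0` at `-∞`. -/
structure IsAngle (u p η : ℝ → ℝ) : Prop where
  cont : Continuous η
  lim : Tendsto η atBot (𝓝 0)
  eq_cos : ∀ t, u t = √(u t ^ 2 + p t ^ 2) * cos (η t)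
  eq_sin : ∀ t, p t = -(√(u t ^ 2 + p t ^ 2) * sin (η t))

/-- Starting from `0`, the function would have to pass `±π / 2`, where the cosine vanishes. Applied
to a difference of two angles, this fixes the branch. -/
theorem abs_lt_of_cos_pos {δ : ℝ → ℝ} {T : ℝ} (hc : Continuous δ) (hl : Tendsto δ atBot (𝓝 0))
    (h : ∀ t ≤ T, 0 < cos (δ t)) {t : ℝ} (ht : t ≤ T) : |δ t| < π / 2 := by
  by_contra! hcon
  have h1 : ∀ᶠ s in atBot, |δ s| < π / 2 := by
    have := hl.abs
    rw [abs_zero] at this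
    exact this.eventually (gt_mem_nhds (by positivity))
  obtain ⟨s, hs, hst⟩ := (h1.and (eventually_le_atBot t)).exists
  obtain ⟨x, hx, hx'⟩ := intermediate_value_Icc hst hc.abs.continuousOn ⟨hs.le, hcon⟩
  have h2 := h x (hx.2.trans ht)
  simp only at hx'
  rw [← Real.cos_abs, hx', Real.cos_pi_div_two] at h2
  exact lt_irrefl _ h2

theorem abs_sub_lt_pi_of_cos_pos {δ : ℝ → ℝ} {a b : ℝ} (hab : a ≤ b) (hc : Continuous δ)
    (h : ∀ t ∈ Icc a b, 0 < cos (δ t)) : |δ b - δ a| < π := by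
  by_contra! hcon
  have key : ∀ x y : ℝ, x + π ≤ y → ∃ z ∈ Icc x y, cos z = 0 := by
    intro x y hxy
    set n := ⌈(x - π / 2) / π⌉ with hn
    refine ⟨π / 2 + n * π, ⟨?_, ?_⟩, ?_⟩
    · have := Int.le_ceil ((x - π / 2) / π)
      rw [div_le_iff₀ pi_pos] at this
      linarith
    · have := (Int.ceil_lt_add_one ((x - π / 2) / π)).le
      rw [← hn, ← sub_le_iff_le_add, le_div_iff₀ pi_pos] at this
      linarith
    · rw [Real.cos_eq_zero_iff]
      exact ⟨n, by ring⟩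
  rcases le_abs.1 hcon with h1 | h1
  · obtain ⟨z, hz, hz0⟩ := key (δ a) (δ b) (by linarith)
    obtain ⟨x, hx, hx'⟩ := intermediate_value_Icc hab hc.continuousOn hz
    have := h x hx
    rw [hx', hz0] at this
    exact lt_irrefl _ this
  · obtain ⟨z, hz, hz0⟩ := key (δ b) (δ a) (by linarith)
    obtain ⟨x, hx, hx'⟩ := intermediate_value_Icc' hab hc.continuousOn hz
    have := h x hx
    rw [hx', hz0] at this
    exact lt_irrefl _ this

/-- The quantity is `sin²` of the discrepancy between `η` and the true clockwise angle of `(u, p)`.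
Since `η` has the correct angular speed, the discrepancy is constant. -/
theorem lift_invariant {u p u' p' η : ℝ → ℝ} (hu : ∀ t, HasDerivAt u (u' t) t)
    (hp : ∀ t, HasDerivAt p (p' t) t) (hN : ∀ t, 0 < u t ^ 2 + p t ^ 2)
    (hη : ∀ t, HasDerivAt η ((p t * u' t - u t * p' t) / (u t ^ 2 + p t ^ 2)) t) (s t : ℝ) :
    (u s * sin (η s) + p s * cos (η s)) ^ 2 / (u s ^ 2 + p s ^ 2) =
      (u t * sin (η t) + p t * cos (η t)) ^ 2 / (u t ^ 2 + p t ^ 2) := by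
  have hder : ∀ t, HasDerivAt
      (fun t => (u t * sin (η t) + p t * cos (η t)) ^ 2 / (u t ^ 2 + p t ^ 2)) 0 t := by
    intro t
    have h1 := ((((hu t).mul (hη t).sin).add ((hp t).mul (hη t).cos)).pow 2).div
      (((hu t).pow 2).add ((hp t).pow 2)) (hN t).ne'
    refine h1.congr_deriv ?_
    have := (hN t).ne'
    simp only [Pi.add_apply, Pi.mul_apply, Pi.pow_apply]
    field_simp
    push_cast
    ring
  exact is_const_of_deriv_eq_zero (fun t => (hder t).differentiableAt) (fun t => (hder t).deriv) s t

/-- By the invariant, `η` is the true angle up to a multiple of `π`. Then `u cos η - p sin η` equals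
plus or minus the radius, so it never vanishes and keeps its sign from time `a`, which excludes odd
multiples. -/
theorem lift_of_initial {u p u' p' η : ℝ → ℝ} (hu : ∀ t, HasDerivAt u (u' t) t)
    (hp : ∀ t, HasDerivAt p (p' t) t) (hN : ∀ t, 0 < u t ^ 2 + p t ^ 2)
    (hη : ∀ t, HasDerivAt η ((p t * u' t - u t * p' t) / (u t ^ 2 + p t ^ 2)) t) {a : ℝ}
    (hB : u a * sin (η a) + p a * cos (η a) = 0) (hA : 0 < u a * cos (η a) - p a * sin (η a))
    (t : ℝ) : u t = √(u t ^ 2 + p t ^ 2) * cos (η t) ∧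
      p t = -(√(u t ^ 2 + p t ^ 2) * sin (η t)) := by
  have hB0 : ∀ t, u t * sin (η t) + p t * cos (η t) = 0 := by
    intro t
    have h1 := lift_invariant hu hp hN hη t a
    rw [hB] at h1
    have h2 := (hN t).ne'
    field_simp at h1
    simpa using h1
  have hAsq : ∀ t, (u t * cos (η t) - p t * sin (η t)) ^ 2 = u t ^ 2 + p t ^ 2 := by
    intro t
    have h1 := hB0 t
    have h2 := Real.sin_sq_add_cos_sq (η t)
    have : (u t * cos (η t) - p t * sin (η t)) ^ 2 + (u t * sin (η t) + p t * cos (η t)) ^ 2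
      = (u t ^ 2 + p t ^ 2) * (sin (η t) ^ 2 + cos (η t) ^ 2) := by ring
    rw [h1, h2] at this
    linarith
  have hcont : Continuous fun t => u t * cos (η t) - p t * sin (η t) := by
    have h1 : Continuous u := continuous_iff_continuousAt.2 fun t => (hu t).continuousAt
    have h2 : Continuous p := continuous_iff_continuousAt.2 fun t => (hp t).continuousAt
    have h3 : Continuous η := continuous_iff_continuousAt.2 fun t => (hη t).continuousAt
    fun_prop
  have hpos : 0 < u t * cos (η t) - p t * sin (η t) := by
    by_contra! hcon
    obtain ⟨x, hx⟩ := mem_range_of_exists_le_of_exists_ge hcont ⟨t, hcon⟩ ⟨a, hA.le⟩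
    have h1 := hAsq x
    simp only at hx
    rw [hx] at h1
    have := hN x
    norm_num at h1
    linarith
  have hsq : √(u t ^ 2 + p t ^ 2) = u t * cos (η t) - p t * sin (η t) := by
    rw [← hAsq t, Real.sqrt_sq hpos.le]
  rw [hsq]
  have h1 := hB0 t
  have h2 := Real.sin_sq_add_cos_sq (η t)
  constructor
  · linear_combination (-u t) * h2 + sin (η t) * h1
  · linear_combination (-p t) * h2 + cos (η t) * h1

namespace IsAngle

variable {u p η u₀ p₀ η₀ : ℝ → ℝ}

theorem inner_eq (h : IsAngle u p η) (h₀ : IsAngle u₀ p₀ η₀) (s t : ℝ) :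
    u s * u₀ t + p s * p₀ t =
      √(u s ^ 2 + p s ^ 2) * √(u₀ t ^ 2 + p₀ t ^ 2) * cos (η s - η₀ t) := by
  have h1 := h.eq_cos s
  have h2 := h.eq_sin s
  have h3 := h₀.eq_cos t
  have h4 := h₀.eq_sin t
  generalize √(u s ^ 2 + p s ^ 2) = r at *
  generalize √(u₀ t ^ 2 + p₀ t ^ 2) = r₀ at *
  rw [h1, h2, h3, h4, Real.cos_sub]
  ring

theorem cross_eq (h : IsAngle u p η) (h₀ : IsAngle u₀ p₀ η₀) (s t : ℝ) :
    u₀ t * p s - p₀ t * u s =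
      -(√(u s ^ 2 + p s ^ 2) * √(u₀ t ^ 2 + p₀ t ^ 2) * sin (η s - η₀ t)) := by
  have h1 := h.eq_cos s
  have h2 := h.eq_sin s
  have h3 := h₀.eq_cos t
  have h4 := h₀.eq_sin t
  generalize √(u s ^ 2 + p s ^ 2) = r at *
  generalize √(u₀ t ^ 2 + p₀ t ^ 2) = r₀ at *
  rw [h1, h2, h3, h4, Real.sin_sub]
  ring

theorem unique (h : IsAngle u p η) (h₀ : IsAngle u p η₀) (hN : ∀ t, 0 < u t ^ 2 + p t ^ 2)
    (t : ℝ) : η t = η₀ t := by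
  have hcos : ∀ t, cos (η t - η₀ t) = 1 := by
    intro t
    have h1 := inner_eq h h₀ t t
    rw [Real.mul_self_sqrt (hN t).le] at h1
    have := hN t
    nlinarith
  have h1 := abs_lt_of_cos_pos (δ := fun t => η t - η₀ t) (T := t) (h.cont.sub h₀.cont) (by simpa using h.lim.sub h₀.lim)
    (fun s _ => by rw [hcos]; exact one_pos) le_rfl
  have h2 := hcos t
  have h3 := abs_lt.1 h1
  have h4 := (Real.cos_eq_one_iff_of_lt_of_lt (by linarith [pi_pos]) (by linarith [pi_pos])).1 h2
  linarith

end IsAngle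

/-! ### The angle of the regular solution -/

/-- The angular speed `ω` is `O(e^{2t})` at `-∞`, so it has a primitive `η` vanishing there. The
lift invariant tends to `0` because `(y, p) → (1, 0)`, so it is `0` throughout. Finally `ω ≥ 0`,
since `y` and its cut-off nonlinearity have the same sign. -/
theorem IsProfile.exists_angle {lam κ : ℝ} {y p : ℝ → ℝ} (h : IsProfile lam κ y p) (hlam : 0 ≤ lam)
    (hκ : 0 ≤ κ) : ∃ η, IsAngle y p η ∧ ∀ t, 0 ≤ η t := by
  have hN := h.ne_zero hκ
  set ω : ℝ → ℝ := fun t => (p t * p t - y t * -(lam * sech2 t * cutoff κ (y t))) /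
    (y t ^ 2 + p t ^ 2) with hω
  have hωc : Continuous ω := by
    have h1 := h.continuous_y
    have h2 := h.continuous_p
    have h3 := continuous_sech2
    have h4 := continuous_cutoff κ
    exact Continuous.div (by fun_prop) (by fun_prop) fun t => (hN t).ne'
  have hcut : ∀ t, 0 ≤ y t * cutoff κ (y t) := fun t => by
    rw [cutoff, ← mul_assoc]
    exact mul_nonneg (mul_self_nonneg _) (le_max_left _ _)
  have hω0 : ∀ t, 0 ≤ ω t := fun t => by
    refine div_nonneg ?_ (hN t).le
    have h1 := mul_nonneg (mul_nonneg hlam (sech2_pos t).le) (hcut t)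
    nlinarith [mul_self_nonneg (p t)]
  have hev : ∀ᶠ t in atBot, 1 / 2 < y t := h.lim_y.eventually (lt_mem_nhds (by norm_num))
  obtain ⟨T, hT⟩ := eventually_atBot.1 (hev.and (eventually_le_atBot 0))
  have hT0 : T ≤ 0 := (hT T le_rfl).2
  set c := 4 * |lam| * growth (4 * |lam|) T with hc
  have hbound : ∀ t < T, |ω t| ≤ (2 * c ^ 2 + 2 * lam) * (2 * exp (2 * t)) := by
    intro t ht
    rw [abs_of_nonneg (hω0 t), hω]
    simp only
    have h1 := (hT t ht.le).1
    have h2 := (h.bounds hκ le_rfl ht).2.1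
    rw [← hc] at h2
    have h3 : 1 / 4 ≤ y t ^ 2 := by nlinarith
    rw [div_le_iff₀ (hN t)]
    have h4 : y t * cutoff κ (y t) ≤ y t ^ 2 := by
      have := abs_cutoff_le hκ (y t)
      calc y t * cutoff κ (y t) ≤ |y t * cutoff κ (y t)| := le_abs_self _
        _ = |y t| * |cutoff κ (y t)| := abs_mul _ _
        _ ≤ |y t| * |y t| := by gcongr
        _ = y t ^ 2 := by rw [abs_mul_abs_self, sq]
    have h5 : lam * sech2 t * (y t * cutoff κ (y t)) ≤ lam * (4 * exp (2 * t)) * y t ^ 2 := by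
      have := sech2_le t
      have := hcut t
      have := (sech2_pos t).le
      gcongr
    have h6 : p t ^ 2 ≤ c ^ 2 * exp (2 * t) := by
      have h7 : exp (2 * t) ≤ 1 := Real.exp_le_one_iff.2 (by linarith)
      have h8 := Real.exp_pos (2 * t)
      calc p t ^ 2 = |p t| ^ 2 := (sq_abs _).symm
        _ ≤ (c * exp (2 * t)) ^ 2 := by gcongr
        _ = c ^ 2 * exp (2 * t) * exp (2 * t) := by ring
        _ ≤ c ^ 2 * exp (2 * t) * 1 := by gcongr
        _ = _ := mul_one _
    have h9 := Real.exp_pos (2 * t)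
    have h10 : c ^ 2 * exp (2 * t) ≤ 4 * (c ^ 2 * exp (2 * t)) * y t ^ 2 := by
      have : 0 ≤ c ^ 2 * exp (2 * t) := by positivity
      nlinarith
    have h11 : 0 ≤ (2 * c ^ 2 + 2 * lam) * (2 * exp (2 * t)) * p t ^ 2 := by positivity
    nlinarith
  obtain ⟨η, hη, hη0⟩ := exists_primitive_atBot (T := T) hωc
    (fun t => (hasDerivAt_exp_two t).const_mul (2 * c ^ 2 + 2 * lam)) hbound
    (by simpa using tendsto_exp_two_atBot.const_mul (2 * c ^ 2 + 2 * lam))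
  have hηc : Continuous η := continuous_iff_continuousAt.2 fun t => (hη t).continuousAt
  have hBlim : Tendsto (fun t => (y t * sin (η t) + p t * cos (η t)) ^ 2 / (y t ^ 2 + p t ^ 2))
      atBot (𝓝 ((1 * sin 0 + 0 * cos 0) ^ 2 / (1 ^ 2 + 0 ^ 2))) := by
    have hs := (Real.continuous_sin.tendsto 0).comp hη0
    have hcs := (Real.continuous_cos.tendsto 0).comp hη0
    exact (((h.lim_y.mul hs).add (h.lim_p.mul hcs)).pow 2).div
      ((h.lim_y.pow 2).add (h.lim_p.pow 2)) (by norm_num)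
  have hAlim : Tendsto (fun t => y t * cos (η t) - p t * sin (η t))
      atBot (𝓝 (1 * cos 0 - 0 * sin 0)) := by
    have hs := (Real.continuous_sin.tendsto 0).comp hη0
    have hcs := (Real.continuous_cos.tendsto 0).comp hη0
    exact (h.lim_y.mul hcs).sub (h.lim_p.mul hs)
  obtain ⟨a, ha⟩ := (hAlim.eventually (lt_mem_nhds (a := 0) (by simp))).exists
  have hBa : y a * sin (η a) + p a * cos (η a) = 0 := by
    have h1 : ∀ t, (y t * sin (η t) + p t * cos (η t)) ^ 2 / (y t ^ 2 + p t ^ 2) =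
      (y a * sin (η a) + p a * cos (η a)) ^ 2 / (y a ^ 2 + p a ^ 2) :=
      fun t => lift_invariant h.deriv_y h.deriv_p hN hη t a
    simp only [h1] at hBlim
    have h2 := tendsto_nhds_unique tendsto_const_nhds hBlim
    have h3 := (hN a).ne'
    simp only [Real.sin_zero, mul_zero, zero_mul, add_zero] at h2
    field_simp at h2
    simpa using h2
  have hl := lift_of_initial h.deriv_y h.deriv_p hN hη hBa ha
  refine ⟨η, ⟨hηc, hη0, fun t => (hl t).1, fun t => (hl t).2⟩, fun t => ?_⟩
  exact le_of_deriv_nonneg_atBot (T := t + 1) (fun s _ => hη s) (fun s _ => hω0 s) hη0 (by linarith)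

open Classical in
/-- The angle of the regular solution at the pole. -/
noncomputable def profileAngle (lam κ : ℝ) : ℝ → ℝ :=
  if h : 0 ≤ lam ∧ 0 ≤ κ then
    Classical.choose ((isProfile_profile lam h.2).exists_angle h.1 h.2)
  else 0

theorem isAngle_profileAngle {lam κ : ℝ} (hlam : 0 ≤ lam) (hκ : 0 ≤ κ) :
    IsAngle (profile lam κ).1 (profile lam κ).2 (profileAngle lam κ) ∧
      ∀ t, 0 ≤ profileAngle lam κ t := by
  unfold profileAngle
  rw [dif_pos ⟨hlam, hκ⟩]
  exact Classical.choose_spec ((isProfile_profile lam hκ).exists_angle hlam hκ)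

/-! ### Continuity of angle and solution in the parameters -/

theorem exists_angle_dist_le {lam₀ κ₀ : ℝ} (hlam₀ : 0 ≤ lam₀) (hκ₀ : 0 ≤ κ₀) (T : ℝ) :
    ∃ C δ : ℝ, 0 < δ ∧ ∀ lam κ, 0 ≤ lam → 0 ≤ κ → |lam - lam₀| + |κ - κ₀| ≤ δ →
      |profileAngle lam κ T - profileAngle lam₀ κ₀ T| ≤ C * (|lam - lam₀| + |κ - κ₀|) := by
  have h₀ := isProfile_profile lam₀ hκ₀
  have a₀ := (isAngle_profileAngle hlam₀ hκ₀).1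
  set y₀ := (profile lam₀ κ₀).1
  set p₀ := (profile lam₀ κ₀).2
  set η₀ := profileAngle lam₀ κ₀
  obtain ⟨C, hC0, hC⟩ := exists_profile_dist_le (lam₀ + 1) (T + 1)
  obtain ⟨By, hBy⟩ := exists_bound_Iic (T := T) h₀.continuous_y.continuousOn h₀.lim_y
  obtain ⟨Bp, hBp⟩ := exists_bound_Iic (T := T) h₀.continuous_p.continuousOn h₀.lim_p
  obtain ⟨Bi, hBi⟩ := exists_bound_Iic (T := T) (u := fun t => (y₀ t ^ 2 + p₀ t ^ 2)⁻¹)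
    (l := (1 ^ 2 + 0 ^ 2)⁻¹)
    (Continuous.continuousOn (Continuous.inv₀
      ((h₀.continuous_y.pow 2).add (h₀.continuous_p.pow 2)) fun t => (h₀.ne_zero hκ₀ t).ne'))
    (((h₀.lim_y.pow 2).add (h₀.lim_p.pow 2)).inv₀ (by norm_num))
  have hBi0 : 0 < Bi := by
    refine lt_of_lt_of_le ?_ (hBi T le_rfl)
    rw [abs_pos]
    exact inv_ne_zero (h₀.ne_zero hκ₀ T).ne'
  -- A lower bound for `y₀² + p₀²` on the whole half-line: its reciprocal is continuous and tends to
  -- `1` at `-∞`, hence is bounded.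
  set m := Bi⁻¹ with hm
  have hm0 : 0 < m := inv_pos.2 hBi0
  have hmle : ∀ t ≤ T, m ≤ y₀ t ^ 2 + p₀ t ^ 2 := by
    intro t ht
    have h1 := hBi t ht
    rw [abs_of_pos (inv_pos.2 (h₀.ne_zero hκ₀ t))] at h1
    exact inv_le_of_inv_le₀ (h₀.ne_zero hκ₀ t) h1
  have hBy0 : 0 ≤ By := (abs_nonneg _).trans (hBy T le_rfl)
  have hBp0 : 0 ≤ Bp := (abs_nonneg _).trans (hBp T le_rfl)
  set D := C * (By + Bp) with hD
  have hD0 : 0 ≤ D := by positivity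
  refine ⟨π / 2 * (D * (2 / m)), min 1 (m / (2 * (D + 1))), by positivity, ?_⟩
  intro lam κ hlam hκ hd
  set d := |lam - lam₀| + |κ - κ₀| with hdd
  have hd0 : 0 ≤ d := by positivity
  have h := isProfile_profile lam hκ
  have a := (isAngle_profileAngle hlam hκ).1
  set y := (profile lam κ).1
  set p := (profile lam κ).2
  set η := profileAngle lam κ
  have hd1 : d ≤ 1 := hd.trans (min_le_left _ _)
  have hd2 : D * d ≤ m / 2 := by
    have h1 := hd.trans (min_le_right _ _)
    rw [le_div_iff₀ (by positivity)] at h1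
    nlinarith
  have hlam1 : |lam| ≤ lam₀ + 1 := by
    rw [abs_of_nonneg hlam]
    have := le_abs_self (lam - lam₀)
    have := abs_nonneg (κ - κ₀)
    linarith
  have hdist := fun t (ht : t ≤ T) => hC lam κ lam₀ κ₀ y p y₀ p₀ hlam1
    (by rw [abs_of_nonneg hlam₀]; linarith) hκ hκ₀ h h₀ t (by linarith)
  rw [← hdd] at hdist
  have hlow : ∀ t ≤ T, m / 2 ≤ y t * y₀ t + p t * p₀ t := by
    intro t ht
    have h1 := hmle t ht
    have h2 : |(y t - y₀ t) * y₀ t + (p t - p₀ t) * p₀ t| ≤ D * d := by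
      refine (abs_add_le _ _).trans ?_
      rw [abs_mul, abs_mul]
      have h3 := hdist t ht
      have h4 := hBy t ht
      have h5 := hBp t ht
      calc |y t - y₀ t| * |y₀ t| + |p t - p₀ t| * |p₀ t| ≤ C * d * By + C * d * Bp := by
            have := h3.1
            have := h3.2
            gcongr
        _ = D * d := by rw [hD]; ring
    have h3 := (abs_le.1 h2).1
    nlinarith
  -- The two vectors form an acute angle at every `t ≤ T`. As both angles start from `0`, their
  -- difference stays below `π / 2`, and Jordan's inequality then turns a bound for its sine into a
  -- bound for the difference itself.
  have hcos : ∀ t ≤ T, 0 < cos (η t - η₀ t) := by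
    intro t ht
    have h1 := hlow t ht
    rw [a.inner_eq a₀] at h1
    exact pos_of_mul_pos_right (lt_of_lt_of_le (by positivity) h1) (by positivity)
  have hlt := abs_lt_of_cos_pos (δ := fun t => η t - η₀ t) (a.cont.sub a₀.cont) (by simpa using a.lim.sub a₀.lim) hcos
    (le_refl T)
  have hsin : |sin (η T - η₀ T)| ≤ D * d * (2 / m) := by
    have h1 := a.cross_eq a₀ T T
    have h2 := hlow T le_rfl
    rw [a.inner_eq a₀] at h2
    set R := √(y T ^ 2 + p T ^ 2) * √(y₀ T ^ 2 + p₀ T ^ 2) with hR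
    have hR0 : 0 ≤ R := by positivity
    have hRm : m / 2 ≤ R := h2.trans (mul_le_of_le_one_right hR0 (Real.cos_le_one _))
    have h3 : R * |sin (η T - η₀ T)| ≤ D * d := by
      rw [← abs_of_nonneg hR0, ← abs_mul, ← abs_neg, ← h1,
        show y₀ T * p T - p₀ T * y T = (p T - p₀ T) * y₀ T - (y T - y₀ T) * p₀ T by ring]
      refine (abs_sub _ _).trans ?_
      rw [abs_mul, abs_mul]
      have h3 := hdist T le_rfl
      have h4 := hBy T le_rfl
      have h5 := hBp T le_rfl
      calc |p T - p₀ T| * |y₀ T| + |y T - y₀ T| * |p₀ T| ≤ C * d * By + C * d * Bp := by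
            have := h3.1
            have := h3.2
            gcongr
        _ = D * d := by rw [hD]; ring
    have h4 : m / 2 * |sin (η T - η₀ T)| ≤ D * d :=
      (mul_le_mul_of_nonneg_right hRm (abs_nonneg _)).trans h3
    rw [show D * d * (2 / m) = D * d / (m / 2) by field_simp]
    rw [le_div_iff₀ (by positivity)]
    linarith
  have hj := Real.mul_abs_le_abs_sin hlt.le
  have h6 : |η T - η₀ T| ≤ π / 2 * |sin (η T - η₀ T)| := by
    have : |η T - η₀ T| = π / 2 * (2 / π * |η T - η₀ T|) := by
      have := pi_pos.ne'
      field_simp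
    rw [this]
    gcongr
  calc |η T - η₀ T| ≤ π / 2 * |sin (η T - η₀ T)| := h6
    _ ≤ π / 2 * (D * d * (2 / m)) := by gcongr
    _ = _ := by ring

theorem tendsto_profileAngle {α : Type*} {l : Filter α} {f g : α → ℝ} {lam₀ κ₀ : ℝ}
    (hlam₀ : 0 ≤ lam₀) (hκ₀ : 0 ≤ κ₀) (hf : Tendsto f l (𝓝 lam₀)) (hg : Tendsto g l (𝓝 κ₀))
    (hf0 : ∀ᶠ x in l, 0 ≤ f x) (hg0 : ∀ᶠ x in l, 0 ≤ g x) (T : ℝ) :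
    Tendsto (fun x => profileAngle (f x) (g x) T) l (𝓝 (profileAngle lam₀ κ₀ T)) := by
  obtain ⟨C, δ, hδ, hC⟩ := exists_angle_dist_le hlam₀ hκ₀ T
  have hd : Tendsto (fun x => |f x - lam₀| + |g x - κ₀|) l (𝓝 0) := by
    simpa using ((hf.sub_const lam₀).abs.add (hg.sub_const κ₀).abs)
  rw [tendsto_iff_norm_sub_tendsto_zero]
  refine squeeze_zero_norm' ?_ (by simpa using hd.const_mul C)
  filter_upwards [hf0, hg0, hd.eventually (gt_mem_nhds hδ)] with x h1 h2 h3
  rw [norm_norm]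
  exact hC _ _ h1 h2 h3.le

theorem tendsto_profile {α : Type*} {l : Filter α} {f g : α → ℝ} {lam₀ κ₀ : ℝ}
    (hκ₀ : 0 ≤ κ₀) (hf : Tendsto f l (𝓝 lam₀)) (hg : Tendsto g l (𝓝 κ₀))
    (hg0 : ∀ᶠ x in l, 0 ≤ g x) (T : ℝ) :
    Tendsto (fun x => (profile (f x) (g x)).1 T) l (𝓝 ((profile lam₀ κ₀).1 T)) ∧
    Tendsto (fun x => (profile (f x) (g x)).2 T) l (𝓝 ((profile lam₀ κ₀).2 T)) := by
  obtain ⟨C, hC0, hC⟩ := exists_profile_dist_le (|lam₀| + 1) (T + 1)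
  have hd : Tendsto (fun x => C * (|f x - lam₀| + |g x - κ₀|)) l (𝓝 0) := by
    simpa using ((hf.sub_const lam₀).abs.add (hg.sub_const κ₀).abs).const_mul C
  have hev := hf.abs.eventually (gt_mem_nhds (lt_add_one |lam₀|))
  constructor
  all_goals
    rw [tendsto_iff_norm_sub_tendsto_zero]
    refine squeeze_zero_norm' ?_ hd
    filter_upwards [hg0, hev] with x h1 h2
    rw [norm_norm]
    have := hC _ _ _ _ _ _ _ _ h2.le (by linarith) h1 hκ₀ (isProfile_profile (f x) h1)
      (isProfile_profile lam₀ hκ₀) T (by linarith)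
    first | exact this.1 | exact this.2

/-! ### Cooperative systems and the cone containing the variation -/

theorem exists_first_zero {f : ℝ → ℝ} {a b t : ℝ} (hc : ContinuousOn f (Icc a b)) (ha : 0 < f a)
    (ht : t ∈ Icc a b) (hft : f t ≤ 0) :
    ∃ T ∈ Ioc a b, f T = 0 ∧ ∀ s ∈ Ico a T, 0 < f s := by
  have hcl : IsClosed (Icc a b ∩ f ⁻¹' Iic 0) := hc.preimage_isClosed_of_isClosed isClosed_Icc isClosed_Iic
  obtain ⟨T, hT, hmin⟩ := (isCompact_Icc.of_isClosed_subset hcl inter_subset_left).exists_isLeast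
    ⟨t, ht, hft⟩
  have hpos : ∀ s ∈ Ico a T, 0 < f s := by
    intro s hs
    by_contra! hcon
    exact absurd (hmin ⟨⟨hs.1, hs.2.le.trans hT.1.2⟩, hcon⟩) (not_le.2 hs.2)
  have haT : a < T := by
    rcases hT.1.1.eq_or_lt with h | h
    · exact absurd hT.2 (by simpa [← h] using ha)
    · exact h
  refine ⟨T, ⟨haT, hT.1.2⟩, le_antisymm hT.2 ?_, hpos⟩
  have h1 : Tendsto f (𝓝[Ico a T] T) (𝓝 (f T)) :=
    (hc T hT.1).mono_left (nhdsWithin_mono T fun s hs => ⟨hs.1, hs.2.le.trans hT.1.2⟩)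
  have : (𝓝[Ico a T] T).NeBot := by
    rw [← mem_closure_iff_nhdsWithin_neBot, closure_Ico haT.ne]
    exact ⟨haT.le, le_rfl⟩
  refine ge_of_tendsto h1 ?_
  filter_upwards [self_mem_nhdsWithin] with s hs using (hpos s hs).le

theorem nonneg_of_hasDerivAt_of_neg_left {f : ℝ → ℝ} {f' a T : ℝ} (haT : a < T)
    (hf : HasDerivAt f f' T) (h0 : f T = 0) (h : ∀ s ∈ Ico a T, f s < 0) : 0 ≤ f' := by
  have h1 := (hasDerivAt_iff_tendsto_slope.1 hf).mono_left
    (nhdsWithin_mono T (fun s (hs : s ∈ Iio T) => (ne_of_lt hs : s ≠ T)))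
  refine ge_of_tendsto h1 ?_
  filter_upwards [Ico_mem_nhdsLT haT] with s hs
  rw [slope_def_field, h0, sub_zero]
  exact (div_pos_of_neg_of_neg (h s hs) (by linarith [hs.2])).le

/-- Positivity for a planar cooperative linear system. -/
theorem cooperative_pos {X Y a₁ b₁ a₂ b₂ : ℝ → ℝ} {a b : ℝ} (hab : a ≤ b)
    (hXc : ContinuousOn X (Icc a b)) (hYc : ContinuousOn Y (Icc a b))
    (hX : ∀ t ∈ Ioo a b, HasDerivAt X (a₁ t * X t + b₁ t * Y t) t)
    (hY : ∀ t ∈ Ioo a b, HasDerivAt Y (a₂ t * Y t + b₂ t * X t) t)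
    (ha₁ : ContinuousOn a₁ (Icc a b)) (ha₂ : ContinuousOn a₂ (Icc a b))
    (hb₁ : ∀ t ∈ Ioo a b, 0 ≤ b₁ t) (hb₂ : ∀ t ∈ Ioo a b, 0 ≤ b₂ t)
    (hXa : 0 < X a) (hYa : 0 < Y a) : 0 < X b ∧ 0 < Y b := by
  by_contra hcon
  have hneg : min (X b) (Y b) ≤ 0 := by
    by_contra! h
    exact hcon (lt_min_iff.1 h)
  obtain ⟨T, hT, hT0, hpos⟩ := exists_first_zero (f := fun t => min (X t) (Y t))
    (fun t ht => (hXc t ht).min (hYc t ht))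
    (lt_min hXa hYa) ⟨hab, le_rfl⟩ hneg
  -- Before the first zero `T` of the minimum the off-diagonal term only helps, so `X e^{Kt}` is
  -- nondecreasing when `K` bounds the diagonal coefficient. Thus `X` is still positive at `T`, and
  -- by exchanging the roles so is `Y`.
  have step : ∀ {X Y a₁ b₁ : ℝ → ℝ}, ContinuousOn X (Icc a b) →
      (∀ t ∈ Ioo a b, HasDerivAt X (a₁ t * X t + b₁ t * Y t) t) → ContinuousOn a₁ (Icc a b) →
      (∀ t ∈ Ioo a b, 0 ≤ b₁ t) → 0 < X a → (∀ s ∈ Ico a T, 0 < X s ∧ 0 < Y s) → 0 < X T := by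
    intro X Y a₁ b₁ hXc hX ha₁ hb₁ hXa hpos
    obtain ⟨K, hK⟩ := isCompact_Icc.exists_bound_of_continuousOn ha₁
    have hmono : MonotoneOn (fun t => X t * exp (K * t)) (Icc a T) := by
      have hder : ∀ t ∈ Ioo a T, HasDerivAt (fun t => X t * exp (K * t))
          ((a₁ t * X t + b₁ t * Y t + K * X t) * exp (K * t)) t := by
        intro t ht
        refine ((hX t ⟨ht.1, ht.2.trans_le hT.2⟩).mul
          ((hasDerivAt_id t).const_mul K).exp).congr_deriv ?_
        simp only [id]
        ring
      apply monotoneOn_of_deriv_nonneg (convex_Icc a T)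
      · exact (hXc.mono (Icc_subset_Icc_right hT.2)).mul (by fun_prop)
      · intro t ht
        rw [interior_Icc] at ht
        exact (hder t ht).differentiableAt.differentiableWithinAt
      · intro t ht
        rw [interior_Icc] at ht
        rw [(hder t ht).deriv]
        have h1 := hpos t ⟨ht.1.le, ht.2⟩
        have h2 := hK t ⟨ht.1.le, ht.2.le.trans hT.2⟩
        have h3 := (abs_le.1 h2).1
        have h4 := hb₁ t ⟨ht.1, ht.2.trans_le hT.2⟩
        refine mul_nonneg ?_ (Real.exp_pos _).le
        nlinarith [mul_nonneg h4 h1.2.le]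
    have h1 := hmono ⟨le_rfl, hT.1.le⟩ ⟨hT.1.le, le_rfl⟩ hT.1.le
    simp only at h1
    have h2 : 0 < X T * exp (K * T) := lt_of_lt_of_le (mul_pos hXa (Real.exp_pos _)) h1
    exact pos_of_mul_pos_left h2 (Real.exp_pos _).le
  have h1 := step hXc hX ha₁ hb₁ hXa fun s hs => lt_min_iff.1 (hpos s hs)
  have h2 := step hYc hY ha₂ hb₂ hYa fun s hs => (lt_min_iff.1 (hpos s hs)).symm
  have := lt_min h1 h2
  linarith

/-- The variation of a shooting solution with respect to its initial value lies in the open cone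
between the solution and its `θ`-derivative on the first hemisphere. -/
theorem variation_cone {u p v q : ℝ → ℝ} {lam d : ℝ} (hlam : 0 < lam) (hd : 0 < d)
    (hu : ∀ t ≤ 0, HasDerivAt u (p t) t)
    (hp : ∀ t ≤ 0, HasDerivAt p (-(lam * sech2 t * (u t * (1 - u t ^ 2)))) t)
    (hv : ∀ t ≤ 0, HasDerivAt v (q t) t)
    (hq : ∀ t ≤ 0, HasDerivAt q (-(lam * sech2 t * ((1 - 3 * u t ^ 2) * v t))) t)
    (hu1 : ∀ t ≤ 0, u t ^ 2 < 1) (hN : ∀ t ≤ 0, 0 < u t ^ 2 + p t ^ 2)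
    (hulim : Tendsto u atBot (𝓝 d)) (hplim : Tendsto p atBot (𝓝 0))
    (hvlim : Tendsto v atBot (𝓝 1)) (hqlim : Tendsto q atBot (𝓝 0))
    (hwlim : Tendsto (fun t => p t * cosh t) atBot (𝓝 0)) :
    0 < u 0 * q 0 - p 0 * v 0 ∧ 0 < p 0 * q 0 + lam * (u 0 * (1 - u 0 ^ 2)) * v 0 := by
  -- Here `w` is `u_θ`, `x` is its derivative in `t`, and `w` solves the linearized equation up to
  -- an extra term `w`. `W₁`, `W₂`, `D` are the Wronskians of `(u, v)`, `(w, v)`, `(u, w)`.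
  set w : ℝ → ℝ := fun t => p t * cosh t with hw
  set x : ℝ → ℝ := fun t => -(lam * (u t * (1 - u t ^ 2)) / cosh t) + p t * sinh t with hx
  set W₁ : ℝ → ℝ := fun t => u t * q t - p t * v t with hW₁
  set W₂ : ℝ → ℝ := fun t => w t * q t - x t * v t with hW₂
  set D : ℝ → ℝ := fun t => u t * x t - p t * w t with hD
  have hch := fun t => (Real.cosh_pos t).ne'
  have hwd : ∀ t ≤ 0, HasDerivAt w (x t) t := by
    intro t ht
    refine ((hp t ht).mul (Real.hasDerivAt_cosh t)).congr_deriv ?_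
    have := hch t
    simp only [hx, sech2]
    field_simp
  have hxd : ∀ t ≤ 0, HasDerivAt x (w t - lam * sech2 t * ((1 - 3 * u t ^ 2) * w t)) t := by
    intro t ht
    refine (((((hu t ht).mul (((hu t ht).pow 2).const_sub 1)).const_mul lam).div
      (Real.hasDerivAt_cosh t) (hch t)).neg.add
        ((hp t ht).mul (Real.hasDerivAt_sinh t))).congr_deriv ?_
    have := hch t
    simp only [hw, sech2, Pi.mul_apply, Pi.pow_apply]
    field_simp
    push_cast
    ring
  have hW₁d : ∀ t ≤ 0, HasDerivAt W₁ (2 * lam * sech2 t * u t ^ 3 * v t) t := by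
    intro t ht
    refine (((hu t ht).mul (hq t ht)).sub ((hp t ht).mul (hv t ht))).congr_deriv ?_
    ring
  have hW₂d : ∀ t ≤ 0, HasDerivAt W₂ (-(w t * v t)) t := by
    intro t ht
    refine (((hwd t ht).mul (hq t ht)).sub ((hxd t ht).mul (hv t ht))).congr_deriv ?_
    ring
  have hDd : ∀ t ≤ 0, HasDerivAt D (u t * w t * (1 + 2 * lam * sech2 t * u t ^ 2)) t := by
    intro t ht
    refine (((hu t ht).mul (hxd t ht)).sub ((hp t ht).mul (hwd t ht))).congr_deriv ?_
    have := hch t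
    simp only [hw, hx, sech2]
    field_simp
    ring
  -- Three vectors in the plane are linearly dependent. Dividing by `D` expresses `v` through `W₁`
  -- and `W₂`, which closes the system of their derivatives.
  have hid : ∀ t, v t * D t = -(W₂ t * u t) + W₁ t * w t := by
    intro t
    simp only [hD, hW₁, hW₂]
    ring
  have hxlim : Tendsto x atBot (𝓝 0) := by
    have hsech : Tendsto (fun t => (cosh t)⁻¹) atBot (𝓝 0) := by
      have h1 : Tendsto (fun t => 2 * exp t) atBot (𝓝 0) := by
        simpa using Real.tendsto_exp_atBot.const_mul 2
      refine squeeze_zero (fun t => (inv_pos.2 (Real.cosh_pos t)).le) (fun t => ?_) h1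
      rw [inv_le_iff_one_le_mul₀ (Real.cosh_pos t), Real.cosh_eq]
      have : exp t * exp (-t) = 1 := by rw [← Real.exp_add]; simp
      have := Real.exp_pos t
      nlinarith
    have h1 : Tendsto (fun t => p t * sinh t) atBot (𝓝 0) := by
      refine squeeze_zero_norm (fun t => ?_) (by simpa using hwlim.norm)
      rw [norm_mul, show |w t| = ‖p t‖ * cosh t by
        simp only [hw, abs_mul, abs_of_pos (Real.cosh_pos t), Real.norm_eq_abs]]
      gcongr
      rw [Real.norm_eq_abs, abs_le]
      rw [Real.cosh_eq, Real.sinh_eq]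
      have := Real.exp_pos t
      have := Real.exp_pos (-t)
      constructor <;> linarith
    have h2 := (((hulim.mul ((hulim.pow 2).const_sub 1)).const_mul lam).mul hsech).neg.add h1
    simpa [hx, div_eq_mul_inv] using h2
  have hW₁lim : Tendsto W₁ atBot (𝓝 0) := by simpa using (hulim.mul hqlim).sub (hplim.mul hvlim)
  have hW₂lim : Tendsto W₂ atBot (𝓝 0) := by simpa using (hwlim.mul hqlim).sub (hxlim.mul hvlim)
  have hDlim : Tendsto D atBot (𝓝 0) := by simpa using (hulim.mul hxlim).sub (hplim.mul hwlim)
  -- Near the pole `u` and `v` are positive, so `p` and `w` are negative. All three Wronskians then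
  -- have derivatives of known sign, and they start from `0`.
  obtain ⟨τ, hτ⟩ := eventually_atBot.1 ((hulim.eventually (lt_mem_nhds hd)).and
    ((hvlim.eventually (lt_mem_nhds one_pos)).and (eventually_le_atBot 0)))
  have hτ0 : τ ≤ 0 := (hτ τ le_rfl).2.2
  have hpneg : ∀ t < τ, p t < 0 := by
    intro t ht
    have := lt_of_deriv_pos_atBot (g := fun t => -p t) (fun s hs => (hp s (hs.le.trans hτ0)).neg)
      (fun s hs => ?_) (by simpa using hplim.neg) ht
    · linarith
    · rw [neg_neg]
      have h1 := (hτ s hs.le).1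
      have h2 := hu1 s (hs.le.trans hτ0)
      have h3 := sech2_pos s
      have h4 : 0 < 1 - u s ^ 2 := by linarith
      positivity
  set a := τ - 1 with ha
  have haτ : a < τ := by rw [ha]; linarith
  have ha0 : a ≤ 0 := by linarith
  have hW₁a : 0 < W₁ a := by
    refine lt_of_deriv_pos_atBot (fun s (hs : s < τ) => hW₁d s (hs.le.trans hτ0))
      (fun s hs => ?_) hW₁lim haτ
    have h1 := (hτ s hs.le).1
    have h2 := (hτ s hs.le).2.1
    have h3 := sech2_pos s
    positivity
  have hW₂a : 0 < W₂ a := by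
    refine lt_of_deriv_pos_atBot (fun s (hs : s < τ) => hW₂d s (hs.le.trans hτ0))
      (fun s hs => ?_) hW₂lim haτ
    have h2 := (hτ s hs.le).2.1
    have h3 : w s < 0 := mul_neg_of_neg_of_pos (hpneg s hs) (Real.cosh_pos s)
    nlinarith
  have hDa : D a < 0 := by
    have := lt_of_deriv_pos_atBot (g := fun t => -D t)
      (fun s (hs : s < τ) => (hDd s (hs.le.trans hτ0)).neg) (fun s hs => ?_)
      (by simpa using hDlim.neg) haτ
    · linarith
    have h1 := (hτ s hs.le).1
    have h3 : w s < 0 := mul_neg_of_neg_of_pos (hpneg s hs) (Real.cosh_pos s)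
    have h4 := sech2_pos s
    have h5 : 0 < 1 + 2 * lam * sech2 s * u s ^ 2 := by positivity
    have h6 : u s * w s < 0 := mul_neg_of_pos_of_neg h1 h3
    exact neg_pos.2 (mul_neg_of_neg_of_pos h6 h5)
  have cont : ∀ {f f' : ℝ → ℝ}, (∀ t ≤ 0, HasDerivAt f (f' t) t) → ContinuousOn f (Icc a 0) :=
    fun hf t ht => (hf t ht.2).continuousAt.continuousWithinAt
  -- At a first zero `T` of `D` the derivative is nonnegative, which forces `u p ≥ 0`. For `T ≤ 0`
  -- every term of `D = -λ u² (1 - u²) / cosh + u p sinh - p² cosh` is then nonpositive, and they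
  -- cannot all vanish because `(u, p) ≠ 0` and `u² < 1`.
  have hDneg : ∀ t ∈ Icc a 0, D t < 0 := by
    intro t ht
    by_contra! hcon
    obtain ⟨T, hT, hT0, hTneg⟩ := exists_first_zero (f := fun t => -D t) (cont hDd).neg
      (by linarith) ht (by linarith)
    have hT0' : D T = 0 := by linarith
    have hder := nonneg_of_hasDerivAt_of_neg_left hT.1 (hDd T hT.2) hT0'
      fun s hs => by have := hTneg s hs; linarith
    have hupnn : 0 ≤ u T * p T := by
      have h1 := Real.cosh_pos T
      have h4 := sech2_pos T
      have h5 : 0 < 1 + 2 * lam * sech2 T * u T ^ 2 := by positivity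
      have h6 := nonneg_of_mul_nonneg_left hder h5
      simp only [hw] at h6
      rw [← mul_assoc] at h6
      exact nonneg_of_mul_nonneg_left h6 h1
    have h1 := Real.cosh_pos T
    have h2 : sinh T ≤ 0 := Real.sinh_nonpos_iff.2 hT.2
    have h3 := hu1 T hT.2
    have h4 := hN T hT.2
    have h5 : D T = -(lam * (u T ^ 2 * (1 - u T ^ 2)) / cosh T) + (u T * p T) * sinh T
        - p T ^ 2 * cosh T := by
      simp only [hD, hx, hw]
      field_simp
    have h6 : 0 ≤ lam * (u T ^ 2 * (1 - u T ^ 2)) / cosh T := by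
      have : 0 ≤ 1 - u T ^ 2 := by linarith
      positivity
    have h7 : (u T * p T) * sinh T ≤ 0 := mul_nonpos_of_nonneg_of_nonpos hupnn h2
    have h8 : 0 ≤ p T ^ 2 * cosh T := by positivity
    have h9 : p T ^ 2 * cosh T = 0 := by linarith
    have h10 : p T ^ 2 = 0 := by
      rcases mul_eq_zero.1 h9 with h | h
      · exact h
      · exact absurd h h1.ne'
    have h11 : 0 < u T ^ 2 := by linarith
    have h12 : 0 < lam * (u T ^ 2 * (1 - u T ^ 2)) / cosh T := by
      have : 0 < 1 - u T ^ 2 := by linarith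
      positivity
    linarith
  have hwc := cont hwd
  have huc := cont hu
  have hDc := cont hDd
  have hDne : ∀ t ∈ Icc a 0, D t ≠ 0 := fun t ht => (hDneg t ht).ne
  have key := cooperative_pos (X := W₁) (Y := W₂)
    (a₁ := fun t => 2 * lam * sech2 t * u t ^ 3 * w t / D t)
    (b₁ := fun t => 2 * lam * sech2 t * u t ^ 4 * (-D t)⁻¹)
    (a₂ := fun t => w t * u t / D t) (b₂ := fun t => w t ^ 2 * (-D t)⁻¹)
    ha0 (cont hW₁d) (cont hW₂d) ?_ ?_ ?_ ?_ ?_ ?_ hW₁a hW₂a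
  · simp only [hW₁, hW₂, hw, hx, Real.cosh_zero, Real.sinh_zero] at key
    refine ⟨key.1, ?_⟩
    have := key.2
    linarith
  · intro t ht
    refine (hW₁d t ht.2.le).congr_deriv ?_
    have h1 := hDne t ⟨ht.1.le, ht.2.le⟩
    have h2 : v t = (-(W₂ t * u t) + W₁ t * w t) / D t := by
      rw [eq_div_iff h1, hid]
    rw [h2, inv_neg]
    field_simp
    ring
  · intro t ht
    refine (hW₂d t ht.2.le).congr_deriv ?_
    have h1 := hDne t ⟨ht.1.le, ht.2.le⟩
    have h2 : v t = (-(W₂ t * u t) + W₁ t * w t) / D t := by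
      rw [eq_div_iff h1, hid]
    rw [h2, inv_neg]
    field_simp
    ring
  · exact (((continuous_sech2.continuousOn.const_mul (2 * lam)).mul (huc.pow 3)).mul hwc).div hDc hDne
  · exact (hwc.mul huc).div hDc hDne
  · intro t ht
    have h1 := hDneg t ⟨ht.1.le, ht.2.le⟩
    have h2 := sech2_pos t
    have h3 : 0 < -D t := by linarith
    positivity
  · intro t ht
    have h1 := hDneg t ⟨ht.1.le, ht.2.le⟩
    have h3 : 0 < -D t := by linarith
    positivity

/-! ### Shooting solutions -/

/-- The shooting solution from `(0, d, 0)`, in the variable `t = log tan (θ / 2)`. -/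
noncomputable def shootU (lam d t : ℝ) : ℝ := d * (profile lam (d ^ 2)).1 t

/-- The derivative of `shootU`. -/
noncomputable def shootP (lam d t : ℝ) : ℝ := d * (profile lam (d ^ 2)).2 t

theorem hasDerivAt_shootU (lam d t : ℝ) : HasDerivAt (shootU lam d) (shootP lam d t) t :=
  ((isProfile_profile lam (sq_nonneg d)).deriv_y t).const_mul d

theorem hasDerivAt_shootP {lam d t : ℝ} (h : shootU lam d t ^ 2 ≤ 1) :
    HasDerivAt (shootP lam d)
      (-(lam * sech2 t * (shootU lam d t * (1 - shootU lam d t ^ 2)))) t := by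
  refine (((isProfile_profile lam (sq_nonneg d)).deriv_p t).const_mul d).congr_deriv ?_
  rw [shootU, mul_pow] at h
  rw [cutoff_of_le h, shootU]
  ring

theorem tendsto_shootU (lam d : ℝ) : Tendsto (shootU lam d) atBot (𝓝 d) := by
  have h := (isProfile_profile lam (sq_nonneg d)).lim_y.const_mul d
  rwa [mul_one] at h

theorem tendsto_shootP (lam d : ℝ) : Tendsto (shootP lam d) atBot (𝓝 0) := by
  have h := (isProfile_profile lam (sq_nonneg d)).lim_p.const_mul d
  rwa [mul_zero] at h

theorem shootU_sq_le {lam d t : ℝ} (hlam : 0 < lam) (hd : d ^ 2 ≤ 1) (ht : t ≤ 0) :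
    shootU lam d t ^ 2 ≤ d ^ 2 := by
  rw [shootU, mul_pow]
  rcases hd.lt_or_eq with h | h
  · exact (isProfile_profile lam (sq_nonneg d)).energy_bound hlam (sq_nonneg d) h ht
  · have h0 := isProfile_profile lam (sq_nonneg d)
    rw [h] at h0 ⊢
    rw [(h0.unique zero_le_one (isProfile_one lam) t).1]
    norm_num

theorem exists_variation {lam d : ℝ} (hlam : 0 < lam) (hd : d ^ 2 ≤ 1) :
    ∃ v q : ℝ → ℝ, (∀ t, HasDerivAt v (q t) t) ∧
      (∀ t ≤ 0, HasDerivAt q (-(lam * sech2 t * ((1 - 3 * shootU lam d t ^ 2) * v t))) t) ∧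
      Tendsto v atBot (𝓝 1) ∧ Tendsto q atBot (𝓝 0) := by
  have hcU : Continuous (shootU lam d) :=
    continuous_iff_continuousAt.2 fun t => (hasDerivAt_shootU lam d t).continuousAt
  -- The coefficient is frozen after `t = 0`, where no bound on `shootU` is at hand; this keeps the
  -- linear equation Lipschitz on the whole line.
  have hG : Continuous (Function.uncurry fun t x =>
      -(lam * sech2 t * ((1 - 3 * shootU lam d (min t 0) ^ 2) * x))) := by
    have := continuous_sech2
    simp only [Function.uncurry_def]
    fun_prop
  have hL : ∀ t x y, |-(lam * sech2 t * ((1 - 3 * shootU lam d (min t 0) ^ 2) * x)) -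
        -(lam * sech2 t * ((1 - 3 * shootU lam d (min t 0) ^ 2) * y))| ≤
        exp (2 * t) * (8 * lam * |x - y|) := by
    intro t x y
    have e : -(lam * sech2 t * ((1 - 3 * shootU lam d (min t 0) ^ 2) * x)) -
        -(lam * sech2 t * ((1 - 3 * shootU lam d (min t 0) ^ 2) * y)) =
        -(lam * sech2 t * ((1 - 3 * shootU lam d (min t 0) ^ 2) * (x - y))) := by ring
    rw [e, abs_neg, abs_mul, abs_mul, abs_mul, abs_of_pos hlam, abs_of_pos (sech2_pos t)]
    have h1 : |1 - 3 * shootU lam d (min t 0) ^ 2| ≤ 2 := by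
      have h2 := (shootU_sq_le hlam hd (min_le_right t 0)).trans hd
      have h3 := sq_nonneg (shootU lam d (min t 0))
      rw [abs_le]
      constructor <;> linarith
    have h2 := sech2_le t
    have h3 := (sech2_pos t).le
    calc _ ≤ lam * (4 * exp (2 * t)) * (2 * |x - y|) := by gcongr
      _ = _ := by ring
  obtain ⟨v, q, hv, hq, hv0, hq0⟩ := exists_volterra (M := 8 * lam) (by positivity) hG hL
    (fun t => by simp)
  refine ⟨v, q, hv, fun t ht => ?_, hv0, hq0⟩
  have := hq t
  simp only [min_eq_left ht] at this
  exact this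

theorem abs_one_sub_le {x y : ℝ} (hx : x ^ 2 ≤ 1) (hy : y ^ 2 ≤ 1) :
    |1 - (x ^ 2 + x * y + y ^ 2)| ≤ 2 := by
  rw [abs_le]
  constructor <;> nlinarith [sq_nonneg (x + y), sq_nonneg (x - y)]

/-- The difference quotient solves a linear equation with coefficient `1 - (U² + U U₀ + U₀²)`, which
differs from the coefficient `1 - 3 U₀²` of the variation by `O(|d - d₀|)`. The Gronwall inequality
from `-∞` gives convergence at this rate. -/
theorem hasDerivAt_shoot_param {lam d₀ : ℝ} (hlam : 0 < lam) (hd₀ : d₀ ∈ Ioo (0 : ℝ) 1)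
    {v q : ℝ → ℝ} (hv : ∀ t, HasDerivAt v (q t) t)
    (hq : ∀ t ≤ 0, HasDerivAt q (-(lam * sech2 t * ((1 - 3 * shootU lam d₀ t ^ 2) * v t))) t)
    (hv0 : Tendsto v atBot (𝓝 1)) (hq0 : Tendsto q atBot (𝓝 0)) :
    HasDerivAt (fun d => shootU lam d 0) (v 0) d₀ ∧ HasDerivAt (fun d => shootP lam d 0) (q 0) d₀ := by
  have hsq₀ : d₀ ^ 2 ≤ 1 := by nlinarith [hd₀.1, hd₀.2]
  have hvc : Continuous v := continuous_iff_continuousAt.2 fun t => (hv t).continuousAt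
  obtain ⟨B, hB⟩ := exists_bound_Iic (T := 0) hvc.continuousOn hv0
  have hB0 : 0 ≤ B := (abs_nonneg _).trans (hB 0 le_rfl)
  set g := growth (8 * lam) 0 with hg
  have hg0 : 0 < g := growth_pos _ _
  have hu₀ : ∀ t ≤ 0, shootU lam d₀ t ^ 2 ≤ 1 := fun t ht => (shootU_sq_le hlam hsq₀ ht).trans hsq₀
  have hexp : ∀ t < 0, exp (2 * t) ≤ 1 := fun t ht => Real.exp_le_one_iff.2 (by linarith)
  -- The factor `12` is `4 · 3`: `4` from `sech2_le`, and `3` bounds `|U + 2 U₀|` in the difference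
  -- `(U - U₀) (U + 2 U₀)` of the two coefficients.
  set c := 12 * lam * g * B with hc
  have hc0 : 0 ≤ c := by positivity
  set K := g * c + (8 * lam * (g * c) + c) with hK
  have main : ∀ d ∈ Ioo (0 : ℝ) 1, d ≠ d₀ →
      |(shootU lam d 0 - shootU lam d₀ 0) / (d - d₀) - v 0| ≤ K * |d - d₀| ∧
      |(shootP lam d 0 - shootP lam d₀ 0) / (d - d₀) - q 0| ≤ K * |d - d₀| := by
    intro d hd hne
    have hsub : d - d₀ ≠ 0 := sub_ne_zero.2 hne
    have hsq : d ^ 2 ≤ 1 := by nlinarith [hd.1, hd.2]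
    have hu : ∀ t ≤ 0, shootU lam d t ^ 2 ≤ 1 := fun t ht => (shootU_sq_le hlam hsq ht).trans hsq
    set z : ℝ → ℝ := fun t => (shootU lam d t - shootU lam d₀ t) / (d - d₀) with hz
    set r : ℝ → ℝ := fun t => (shootP lam d t - shootP lam d₀ t) / (d - d₀) with hr
    have hzd : ∀ t, HasDerivAt z (r t) t := fun t =>
      ((hasDerivAt_shootU lam d t).sub (hasDerivAt_shootU lam d₀ t)).div_const _
    have hrd : ∀ t ≤ 0, HasDerivAt r (-(lam * sech2 t * ((1 - (shootU lam d t ^ 2 +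
        shootU lam d t * shootU lam d₀ t + shootU lam d₀ t ^ 2)) * z t))) t := by
      intro t ht
      refine (((hasDerivAt_shootP (hu t ht)).sub (hasDerivAt_shootP (hu₀ t ht))).div_const
        (d - d₀)).congr_deriv ?_
      simp only [hz]
      field_simp
      ring
    have hzlim : Tendsto z atBot (𝓝 1) := by
      have := ((tendsto_shootU lam d).sub (tendsto_shootU lam d₀)).div_const (d - d₀)
      rwa [div_self hsub] at this
    have hrlim : Tendsto r atBot (𝓝 0) := by
      have := ((tendsto_shootP lam d).sub (tendsto_shootP lam d₀)).div_const (d - d₀)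
      simpa using this
    have hzc : Continuous z := continuous_iff_continuousAt.2 fun t => (hzd t).continuousAt
    obtain ⟨Bz, hBz⟩ := exists_bound_Iic (T := 0) hzc.continuousOn hzlim
    have hzb : ∀ t < 0, |z t| ≤ g := by
      intro t ht
      have := (volterra_bound (M := 8 * lam) (ε := 0) (T := 0) (by positivity) le_rfl
        (fun s _ => hzd s) (fun s hs => hrd s hs.le) (fun s hs => ?_) (fun s hs => hBz s hs.le)
        hzlim hrlim ht).1
      · simpa using this
      · rw [abs_neg, abs_mul, abs_mul, abs_mul, abs_of_pos hlam, abs_of_pos (sech2_pos s), add_zero]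
        have h1 := abs_one_sub_le (hu s hs.le) (hu₀ s hs.le)
        have h2 := sech2_le s
        have h3 := (sech2_pos s).le
        calc _ ≤ lam * (4 * exp (2 * s)) * (2 * |z s|) := by gcongr
          _ = _ := by ring
    have hdiff : ∀ t < 0, |shootU lam d t - shootU lam d₀ t| ≤ g * |d - d₀| := by
      intro t ht
      have h1 := hzb t ht
      rw [hz] at h1
      simp only at h1
      rw [abs_div, div_le_iff₀ (abs_pos.2 hsub)] at h1
      exact h1
    have hfin : ∀ t < 0, |z t - v t| ≤ K * |d - d₀| ∧ |r t - q t| ≤ K * |d - d₀| := by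
      intro t ht
      have := volterra_bound (M := 8 * lam) (ε := c * |d - d₀|) (T := 0) (e := 0) (B := Bz + B)
        (u := fun t => z t - v t) (p := fun t => r t - q t)
        (by positivity) (by positivity)
        (fun s _ => (hzd s).sub (hv s)) (fun s hs => (hrd s hs.le).sub (hq s hs.le))
        (fun s hs => ?_) (fun s hs => (abs_sub _ _).trans (add_le_add (hBz s hs.le) (hB s hs.le)))
        (by simpa using hzlim.sub hv0) (by simpa using hrlim.sub hq0) ht
      · simp only [abs_zero, zero_add, mul_zero, Real.exp_zero, mul_one, ← hg] at this
        have hd0 := abs_nonneg (d - d₀)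
        refine ⟨this.1.trans ?_, this.2.1.trans ?_⟩
        · rw [hK, ← mul_assoc]
          refine mul_le_mul_of_nonneg_right ?_ hd0
          have : 0 ≤ 8 * lam * (g * c) + c := by positivity
          linarith
        · calc (8 * lam * (g * (c * |d - d₀|)) + c * |d - d₀|) * exp (2 * t)
              ≤ (8 * lam * (g * (c * |d - d₀|)) + c * |d - d₀|) * 1 := by
                have := hexp t ht
                gcongr
            _ = (8 * lam * (g * c) + c) * |d - d₀| := by ring
            _ ≤ K * |d - d₀| := by
                rw [hK]
                refine mul_le_mul_of_nonneg_right ?_ hd0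
                have : 0 ≤ g * c := by positivity
                linarith
      · set U := shootU lam d s with hU
        set U₀ := shootU lam d₀ s with hU₀
        have e : -(lam * sech2 s * ((1 - (U ^ 2 + U * U₀ + U₀ ^ 2)) * z s)) -
            -(lam * sech2 s * ((1 - 3 * U₀ ^ 2) * v s)) =
            -(lam * (sech2 s * ((1 - (U ^ 2 + U * U₀ + U₀ ^ 2)) * (z s - v s) -
              (U - U₀) * (U + 2 * U₀) * v s))) := by ring
        rw [e, abs_neg, abs_mul, abs_mul, abs_of_pos hlam, abs_of_pos (sech2_pos s)]
        have h1 := abs_one_sub_le (hu s hs.le) (hu₀ s hs.le)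
        have h2 := sech2_le s
        have h4 : |U + 2 * U₀| ≤ 3 := by
          have h5 := abs_le.1 ((sq_le_one_iff_abs_le_one U).1 (hu s hs.le))
          have h6 := abs_le.1 ((sq_le_one_iff_abs_le_one U₀).1 (hu₀ s hs.le))
          rw [abs_le]
          constructor <;> linarith [h5.1, h5.2, h6.1, h6.2]
        have h5 := hdiff s hs
        have h6 := hB s hs.le
        have h7 : |(1 - (U ^ 2 + U * U₀ + U₀ ^ 2)) * (z s - v s) -
              (U - U₀) * (U + 2 * U₀) * v s| ≤ 2 * |z s - v s| + g * |d - d₀| * 3 * B := by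
          refine (abs_sub _ _).trans ?_
          rw [abs_mul, abs_mul, abs_mul]
          gcongr
        calc _ ≤ lam * (4 * exp (2 * s) * (2 * |z s - v s| + g * |d - d₀| * 3 * B)) := by gcongr
          _ = _ := by rw [hc]; ring
    have hrc : ContinuousWithinAt r (Iic 0) 0 := (hrd 0 le_rfl).continuousAt.continuousWithinAt
    have hqc : ContinuousWithinAt q (Iic 0) 0 := (hq 0 le_rfl).continuousAt.continuousWithinAt
    exact ⟨le_of_forall_lt_of_continuousAt (f := fun t => |z t - v t|)
        (hzc.continuousWithinAt.sub hvc.continuousWithinAt).abs fun t ht => (hfin t ht).1,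
      le_of_forall_lt_of_continuousAt (f := fun t => |r t - q t|)
        (hrc.sub hqc).abs fun t ht => (hfin t ht).2⟩
  have hlim0 : Tendsto (fun d => K * |d - d₀|) (𝓝[≠] d₀) (𝓝 0) := by
    have : Tendsto (fun d => K * |d - d₀|) (𝓝 d₀) (𝓝 (K * |d₀ - d₀|)) :=
      Continuous.tendsto (by fun_prop) _
    simp only [sub_self, abs_zero, mul_zero] at this
    exact this.mono_left nhdsWithin_le_nhds
  have hev : ∀ᶠ d in 𝓝[≠] d₀, d ∈ Ioo (0 : ℝ) 1 ∧ d ≠ d₀ :=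
    Filter.Eventually.and (mem_nhdsWithin_of_mem_nhds (Ioo_mem_nhds hd₀.1 hd₀.2))
      self_mem_nhdsWithin
  constructor
  all_goals
    rw [hasDerivAt_iff_tendsto_slope, tendsto_iff_norm_sub_tendsto_zero]
    refine squeeze_zero_norm' ?_ hlim0
    filter_upwards [hev] with d hd
    rw [norm_norm, slope_def_field]
    first | exact (main d hd.1 hd.2).1 | exact (main d hd.1 hd.2).2

/-- For `a < x < y` the maximum over `[x, y]` can only sit at `y`, since any earlier point is beaten
just to its right. Such one-sided local information is what the sign of a sine provides for the
angles below. -/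
theorem strictMonoOn_of_eventually_right {f : ℝ → ℝ} {a b : ℝ} (hc : ContinuousOn f (Icc a b))
    (h : ∀ x ∈ Ioo a b, ∀ᶠ y in 𝓝[>] x, f x < f y) : StrictMonoOn f (Icc a b) := by
  have key : ∀ x y, a < x → x < y → y ≤ b → f x < f y := by
    intro x y hax hxy hyb
    have hsub : Icc x y ⊆ Icc a b := Icc_subset_Icc hax.le hyb
    have hno : ∀ z ∈ Ico x y, ¬ ∀ s ∈ Icc x y, f s ≤ f z := by
      intro z hz hmax
      obtain ⟨s, hs, hs'⟩ := ((h z ⟨hax.trans_le hz.1, hz.2.trans_le hyb⟩).and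
        (Ioo_mem_nhdsGT hz.2)).exists
      exact absurd (hmax s ⟨hz.1.trans hs'.1.le, hs'.2.le⟩) (not_le.2 hs)
    obtain ⟨z, hz, hmax⟩ := isCompact_Icc.exists_isMaxOn (nonempty_Icc.2 hxy.le) (hc.mono hsub)
    have hzy : z = y := by
      by_contra hne
      exact hno z ⟨hz.1, lt_of_le_of_ne hz.2 hne⟩ fun s hs => hmax hs
    subst hzy
    by_contra! hcon
    exact hno x ⟨le_rfl, hxy⟩ fun s hs => (hmax hs : f s ≤ f z).trans hcon
  intro x hx y hy hxy
  rcases hx.1.eq_or_lt with rfl | hax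
  · set m := (a + y) / 2 with hm
    have ham : a < m := by rw [hm]; linarith
    have hmy : m < y := by rw [hm]; linarith
    refine lt_of_le_of_lt ?_ (key m y ham hmy hy.2)
    have h1 : Tendsto f (𝓝[Ioc a m] a) (𝓝 (f a)) := (hc a ⟨le_rfl, hx.2⟩).mono_left
      (nhdsWithin_mono a fun s hs => ⟨hs.1.le, hs.2.trans (hmy.le.trans hy.2)⟩)
    have : (𝓝[Ioc a m] a).NeBot := by
      rw [← mem_closure_iff_nhdsWithin_neBot, closure_Ioc ham.ne]
      exact ⟨le_rfl, ham.le⟩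
    refine le_of_tendsto h1 ?_
    filter_upwards [self_mem_nhdsWithin] with s hs
    rcases hs.2.eq_or_lt with h2 | h2
    · rw [h2]
    · exact (key s m hs.1 h2 (hmy.le.trans hy.2)).le
  · exact key x y hax hxy hy.2

theorem sign_of_sin {x : ℝ} (hx : |x| < π) : (0 < sin x → 0 < x) ∧ (sin x < 0 → x < 0) := by
  have h1 := abs_lt.1 hx
  constructor
  · intro h
    by_contra! hcon
    linarith [Real.sin_nonpos_of_nonpos_of_neg_pi_le hcon h1.1.le]
  · intro h
    by_contra! hcon
    linarith [Real.sin_nonneg_of_nonneg_of_le_pi hcon h1.2.le]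

/-! ### Monotonicity in the initial value -/

/-- The energy of a point of the equatorial section. -/
noncomputable def energy (lam u p : ℝ) : ℝ := p ^ 2 / 2 + lam * (u ^ 2 / 2 - u ^ 4 / 4)

theorem continuous_shoot_param (lam t : ℝ) :
    Continuous (fun d => shootU lam d t) ∧ Continuous (fun d => shootP lam d t) := by
  have h : ∀ d₀ : ℝ, _ := fun d₀ : ℝ =>
    tendsto_profile (l := 𝓝 d₀) (f := fun _ => lam) (g := fun d => d ^ 2) (κ₀ := d₀ ^ 2)
      (sq_nonneg d₀) tendsto_const_nhds ((continuous_pow 2).tendsto d₀)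
      (Eventually.of_forall fun d => sq_nonneg d) t
  exact ⟨continuous_iff_continuousAt.2 fun d₀ => tendsto_id.mul (h d₀).1,
    continuous_iff_continuousAt.2 fun d₀ => tendsto_id.mul (h d₀).2⟩

/-- The first inequality says that the equatorial shooting curve turns counterclockwise about the
origin as `d` grows, the second that the energy grows along it. -/
theorem exists_variation_cone {lam d : ℝ} (hlam : 0 < lam) (hd : d ∈ Ioo (0 : ℝ) 1) :
    ∃ a b : ℝ, HasDerivAt (fun d => shootU lam d 0) a d ∧ HasDerivAt (fun d => shootP lam d 0) b d ∧
      0 < shootU lam d 0 * b - shootP lam d 0 * a ∧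
      0 < shootP lam d 0 * b + lam * (shootU lam d 0 * (1 - shootU lam d 0 ^ 2)) * a := by
  have hsq : d ^ 2 < 1 := by nlinarith [hd.1, hd.2]
  obtain ⟨v, q, hv, hq, hv0, hq0⟩ := exists_variation hlam hsq.le
  have h1 := hasDerivAt_shoot_param hlam hd hv hq hv0 hq0
  have hu1 : ∀ t ≤ 0, shootU lam d t ^ 2 < 1 := fun t ht =>
    (shootU_sq_le hlam hsq.le ht).trans_lt hsq
  have hpr := isProfile_profile lam (sq_nonneg d)
  have h2 := variation_cone hlam hd.1 (fun t _ => hasDerivAt_shootU lam d t)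
    (fun t ht => hasDerivAt_shootP (hu1 t ht).le) (fun t _ => hv t) hq hu1 (fun t _ => ?_)
    (tendsto_shootU lam d) (tendsto_shootP lam d) hv0 hq0 ?_
  · exact ⟨v 0, q 0, h1.1, h1.2, h2.1, h2.2⟩
  · have h3 := hpr.ne_zero (sq_nonneg d) t
    have h4 : shootU lam d t ^ 2 + shootP lam d t ^ 2 =
        d ^ 2 * ((profile lam (d ^ 2)).1 t ^ 2 + (profile lam (d ^ 2)).2 t ^ 2) := by
      rw [shootU, shootP]; ring
    rw [h4]
    have := hd.1
    positivity
  · have := (hpr.tendsto_mul_cosh (sq_nonneg d)).const_mul d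
    rw [mul_zero] at this
    refine this.congr fun t => ?_
    rw [shootP]
    ring

theorem strictMonoOn_energy {lam : ℝ} (hlam : 0 < lam) :
    StrictMonoOn (fun d => energy lam (shootU lam d 0) (shootP lam d 0)) (Icc 0 1) := by
  have hc := continuous_shoot_param lam 0
  have h1 := hc.1
  have h2 := hc.2
  refine strictMonoOn_of_deriv_pos (convex_Icc 0 1) ?_ fun d hd => ?_
  · unfold energy
    fun_prop
  · rw [interior_Icc] at hd
    obtain ⟨a, b, ha, hb, -, hpos⟩ := exists_variation_cone hlam hd
    have h3 : HasDerivAt (fun d => energy lam (shootU lam d 0) (shootP lam d 0))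
        (shootP lam d 0 * b + lam * (shootU lam d 0 * (1 - shootU lam d 0 ^ 2)) * a) d := by
      refine (((hb.pow 2).div_const 2).add ((((ha.pow 2).div_const 2).sub
        ((ha.pow 4).div_const 4)).const_mul lam)).congr_deriv ?_
      push_cast
      ring
    rwa [h3.deriv]

/-- The angle of the shooting curve at the equator. -/
noncomputable def equatorAngle (lam d : ℝ) : ℝ := profileAngle lam (d ^ 2) 0

theorem continuous_equatorAngle {lam : ℝ} (hlam : 0 ≤ lam) : Continuous (equatorAngle lam) :=
  continuous_iff_continuousAt.2 fun d₀ =>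
    tendsto_profileAngle (l := 𝓝 d₀) (f := fun _ => lam) (g := fun d => d ^ 2) (κ₀ := d₀ ^ 2) hlam
      (sq_nonneg d₀) tendsto_const_nhds ((continuous_pow 2).tendsto d₀)
      (Eventually.of_forall fun _ => hlam) (Eventually.of_forall fun d => sq_nonneg d) 0

theorem strictAntiOn_equatorAngle {lam : ℝ} (hlam : 0 < lam) :
    StrictAntiOn (equatorAngle lam) (Icc 0 1) := by
  have hcont := continuous_equatorAngle hlam.le
  suffices h : StrictMonoOn (fun d => -equatorAngle lam d) (Icc 0 1) by
    intro x hx y hy hxy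
    have := h hx hy hxy
    simp only at this
    linarith
  refine strictMonoOn_of_eventually_right hcont.neg.continuousOn fun d hd => ?_
  obtain ⟨a, b, ha, hb, hpos, -⟩ := exists_variation_cone hlam hd
  have hder : HasDerivAt (fun s => shootU lam d 0 * shootP lam s 0 - shootP lam d 0 * shootU lam s 0)
      (shootU lam d 0 * b - shootP lam d 0 * a) d :=
    (hb.const_mul _).sub (ha.const_mul _)
  have hslope := (hasDerivAt_iff_tendsto_slope.1 hder).mono_left
    (nhdsWithin_mono d (fun s (hs : s ∈ Ioi d) => (ne_of_gt hs : s ≠ d)))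
  have hnear : ∀ᶠ s in 𝓝[>] d, |equatorAngle lam s - equatorAngle lam d| < π := by
    have h1 : Tendsto (fun s => |equatorAngle lam s - equatorAngle lam d|) (𝓝 d) (𝓝 0) := by
      have : Continuous fun s => |equatorAngle lam s - equatorAngle lam d| := by fun_prop
      simpa using this.tendsto d
    exact (h1.mono_left nhdsWithin_le_nhds).eventually (gt_mem_nhds pi_pos)
  filter_upwards [hslope.eventually (lt_mem_nhds hpos), hnear, self_mem_nhdsWithin] with s h1 h2 hs
  have hs' : d < s := hs
  rw [slope_def_field, sub_eq_zero.2 (mul_comm (shootU lam d 0) _), sub_zero] at h1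
  have h3 := (div_pos_iff_of_pos_right (sub_pos.2 hs')).1 h1
  have h4 := (isAngle_profileAngle hlam.le (sq_nonneg s)).1.cross_eq
    (isAngle_profileAngle hlam.le (sq_nonneg d)).1 0 0
  have h5 : shootU lam d 0 * shootP lam s 0 - shootP lam d 0 * shootU lam s 0 =
      d * s * ((profile lam (d ^ 2)).1 0 * (profile lam (s ^ 2)).2 0 -
        (profile lam (d ^ 2)).2 0 * (profile lam (s ^ 2)).1 0) := by
    simp only [shootU, shootP]
    ring
  rw [h5, h4] at h3
  have h6 : 0 < d * s := mul_pos hd.1 (hd.1.trans hs')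
  have h7 := pos_of_mul_pos_right h3 h6.le
  have h8 : sin (profileAngle lam (s ^ 2) 0 - profileAngle lam (d ^ 2) 0) < 0 := by
    by_contra! hcon
    have : 0 ≤ √((profile lam (s ^ 2)).1 0 ^ 2 + (profile lam (s ^ 2)).2 0 ^ 2) *
      √((profile lam (d ^ 2)).1 0 ^ 2 + (profile lam (d ^ 2)).2 0 ^ 2) *
      sin (profileAngle lam (s ^ 2) 0 - profileAngle lam (d ^ 2) 0) := by positivity
    linarith
  have h9 := (sign_of_sin h2).2 h8
  linarith

theorem profileAngle_eq_zero {lam κ : ℝ} (hlam : 0 ≤ lam) (hκ : 0 ≤ κ)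
    (h : IsProfile lam κ (fun _ => 1) (fun _ => 0)) (t : ℝ) : profileAngle lam κ t = 0 := by
  have hpr := isProfile_profile lam hκ
  have h0 : IsAngle (profile lam κ).1 (profile lam κ).2 (fun _ => 0) :=
    ⟨continuous_const, tendsto_const_nhds, fun t => by
      rw [(hpr.unique hκ h t).1, (hpr.unique hκ h t).2]; norm_num, fun t => by
      rw [(hpr.unique hκ h t).1, (hpr.unique hκ h t).2]; norm_num⟩
  exact (isAngle_profileAngle hlam hκ).1.unique h0 (hpr.ne_zero hκ) t

theorem equatorAngle_one {lam : ℝ} (hlam : 0 ≤ lam) : equatorAngle lam 1 = 0 := by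
  rw [equatorAngle]
  exact profileAngle_eq_zero hlam (sq_nonneg 1) (by rw [one_pow]; exact isProfile_one lam) 0

/-! ### Monotonicity in the parameter -/

/-- The angle of the tangent at the origin of the shooting curve at the equator. -/
noncomputable def linearAngle (lam : ℝ) : ℝ := profileAngle lam 0 0

theorem equatorAngle_zero (lam : ℝ) : equatorAngle lam 0 = linearAngle lam := by
  rw [equatorAngle, linearAngle, zero_pow two_ne_zero]

theorem linearAngle_zero : linearAngle 0 = 0 :=
  profileAngle_eq_zero le_rfl le_rfl (isProfile_lam_zero 0) 0

theorem continuousOn_linearAngle : ContinuousOn linearAngle (Ici 0) := fun lam hlam =>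
  tendsto_profileAngle (l := 𝓝[Ici 0] lam) (f := id) (g := fun _ => 0) hlam le_rfl
    (tendsto_id.mono_left nhdsWithin_le_nhds) tendsto_const_nhds self_mem_nhdsWithin
    (Eventually.of_forall fun _ => le_rfl) 0

/-- The Wronskian of the solutions for `λ` and `s`, divided by `λ - s`, is the integral of `sech² y₁
y₂` from `-∞`. For `s` near `λ` this is close to the integral `Z₀` of `sech² y₁²`, which is positive
at the equator, and the sign of the Wronskian is the sign of the sine of the angle difference. -/
theorem linearAngle_lt_right {lam : ℝ} (hlam : 0 < lam) :
    ∀ᶠ s in 𝓝[>] lam, linearAngle lam < linearAngle s := by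
  have h₁ := isProfile_profile lam le_rfl
  set y₁ := (profile lam 0).1 with hy₁
  set p₁ := (profile lam 0).2 with hp₁
  obtain ⟨C, hC0, hC⟩ := exists_profile_dist_le (lam + 1) 1
  obtain ⟨B, hB⟩ := exists_bound_Iic (T := 1) h₁.continuous_y.continuousOn h₁.lim_y
  have hB0 : 0 ≤ B := (abs_nonneg _).trans (hB 1 le_rfl)
  obtain ⟨Z₀, hZ₀, hZ₀lim⟩ := exists_primitive_atBot (T := 1)
    (f := fun t => sech2 t * y₁ t ^ 2) (continuous_sech2.mul (h₁.continuous_y.pow 2))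
    (fun t => (hasDerivAt_exp_two t).const_mul (2 * B ^ 2)) (fun t ht => by
      have h1 := hB t ht.le
      have h2 := sech2_le t
      have h3 := sech2_pos t
      rw [abs_of_nonneg (by positivity), ← sq_abs (y₁ t)]
      calc sech2 t * |y₁ t| ^ 2 ≤ 4 * exp (2 * t) * B ^ 2 := by gcongr
        _ = _ := by ring) (by simpa using tendsto_exp_two_atBot.const_mul (2 * B ^ 2))
  have hZ₀pos : 0 < Z₀ 0 := by
    obtain ⟨τ, hτ⟩ := eventually_atBot.1 ((h₁.lim_y.eventually (lt_mem_nhds one_pos)).and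
      (eventually_le_atBot 0))
    have h1 : 0 < Z₀ (τ - 1) := lt_of_deriv_pos_atBot (T := τ) (fun s _ => hZ₀ s) (fun s hs => by
      have := (hτ s hs.le).1
      have := sech2_pos s
      positivity) hZ₀lim (by linarith)
    have hmono : Monotone Z₀ := monotone_of_hasDerivAt_nonneg hZ₀ fun s => by
      have := sech2_pos s
      simp only [Pi.zero_apply]
      positivity
    exact h1.trans_le (hmono (by linarith [(hτ τ le_rfl).2]))
  have hsmall : ∀ᶠ s in 𝓝[>] lam, 2 * B * C * (s - lam) < Z₀ 0 := by
    have h1 : Tendsto (fun s => 2 * B * C * (s - lam)) (𝓝 lam) (𝓝 0) := by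
      have : Continuous fun s => 2 * B * C * (s - lam) := by fun_prop
      simpa using this.tendsto lam
    exact (h1.mono_left nhdsWithin_le_nhds).eventually (gt_mem_nhds hZ₀pos)
  have hnear : ∀ᶠ s in 𝓝[>] lam, |linearAngle s - linearAngle lam| < π := by
    have h1 : Tendsto (fun s => |linearAngle s - linearAngle lam|) (𝓝[>] lam) (𝓝 0) := by
      have := (((continuousOn_linearAngle lam hlam.le).mono_left
        (nhdsWithin_mono lam (Ioi_subset_Ici hlam.le))).sub_const (linearAngle lam)).abs
      simpa using this
    exact h1.eventually (gt_mem_nhds pi_pos)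
  filter_upwards [hsmall, hnear, Ioo_mem_nhdsGT (lt_add_one lam)] with s hs1 hs2 hs3
  have hs0 : 0 ≤ s := hlam.le.trans hs3.1.le
  have hsub : 0 < s - lam := sub_pos.2 hs3.1
  have h₂ := isProfile_profile s le_rfl
  set y₂ := (profile s 0).1 with hy₂
  set p₂ := (profile s 0).2 with hp₂
  set Z : ℝ → ℝ := fun t => -(y₁ t * p₂ t - p₁ t * y₂ t) / (s - lam) with hZ
  have hZd : ∀ t, HasDerivAt Z (sech2 t * (y₁ t * y₂ t)) t := by
    intro t
    refine ((((h₁.deriv_y t).mul (h₂.deriv_p t)).sub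
      ((h₁.deriv_p t).mul (h₂.deriv_y t))).neg.div_const (s - lam)).congr_deriv ?_
    rw [cutoff_zero_left, cutoff_zero_left]
    have := hsub.ne'
    field_simp
    ring
  have hZlim : Tendsto Z atBot (𝓝 0) := by
    have := ((h₁.lim_y.mul h₂.lim_p).sub (h₁.lim_p.mul h₂.lim_y)).neg.div_const (s - lam)
    simpa only [mul_zero, zero_mul, sub_self, neg_zero, zero_div] using this
  have hdist : |Z 0 - Z₀ 0| ≤ 2 * B * C * (s - lam) * exp (2 * 0) := by
    refine abs_le_of_deriv_le_atBot (T := 1) (f := fun t => Z t - Z₀ t)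
      (B := fun t => 2 * B * C * (s - lam) * exp (2 * t)) (fun t _ => (hZd t).sub (hZ₀ t))
      (fun t _ => (hasDerivAt_exp_two t).const_mul (2 * B * C * (s - lam))) (fun t ht => ?_)
      (by simpa using hZlim.sub hZ₀lim)
      (by simpa using tendsto_exp_two_atBot.const_mul (2 * B * C * (s - lam))) one_pos
    have e : sech2 t * (y₁ t * y₂ t) - sech2 t * y₁ t ^ 2 =
        sech2 t * (y₁ t * (y₂ t - y₁ t)) := by ring
    rw [e, abs_mul, abs_mul, abs_of_pos (sech2_pos t)]
    have h1 := (hC s 0 lam 0 y₂ p₂ y₁ p₁ (by rw [abs_of_nonneg hs0]; exact hs3.2.le)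
      (by rw [abs_of_pos hlam]; linarith) le_rfl le_rfl h₂ h₁ t ht).1
    rw [sub_self, abs_zero, add_zero, abs_of_pos hsub] at h1
    have h2 := hB t ht.le
    have h3 := sech2_le t
    calc sech2 t * (|y₁ t| * |y₂ t - y₁ t|)
        ≤ 4 * exp (2 * t) * (B * (C * (s - lam))) := by gcongr
      _ = _ := by ring
  rw [mul_zero, Real.exp_zero, mul_one] at hdist
  have hZpos : 0 < Z 0 := by linarith [(abs_le.1 hdist).1]
  have hW := (div_pos_iff_of_pos_right hsub).1 hZpos
  have hcross := (isAngle_profileAngle hs0 le_rfl).1.cross_eq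
    (isAngle_profileAngle hlam.le le_rfl).1 0 0
  rw [← hy₁, ← hp₁, ← hy₂, ← hp₂] at hcross
  rw [hcross, neg_neg] at hW
  have hsin : 0 < sin (linearAngle s - linearAngle lam) := pos_of_mul_pos_right hW (by positivity)
  linarith [(sign_of_sin hs2).1 hsin]

theorem strictMonoOn_linearAngle : StrictMonoOn linearAngle (Ici 0) := by
  intro x hx y hy hxy
  exact strictMonoOn_of_eventually_right (a := 0) (b := y)
    (continuousOn_linearAngle.mono Icc_subset_Ici_self) (fun z hz => linearAngle_lt_right hz.1)
    ⟨hx, hxy.le⟩ ⟨hy, le_rfl⟩ hxy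

/-- The angle `ζ` of the rescaled vector `(ω y, p)` turns at speed at least `ω` on `[-1, 0]`. The
rescaled and the original vector always form an acute angle, so the increments of the two angles
differ by less than `π`. -/
theorem exists_le_linearAngle (N : ℝ) : ∃ lam, 0 ≤ lam ∧ N ≤ linearAngle lam := by
  set ω := max 1 (N + π) with hω
  have hω0 : 0 < ω := lt_of_lt_of_le one_pos (le_max_left _ _)
  -- Chosen so that `λ sech² t ≥ ω²` for `|t| ≤ 1`.
  set lam := ω ^ 2 * cosh 1 ^ 2 with hlamdef
  have hlam : 0 ≤ lam := by positivity
  refine ⟨lam, hlam, ?_⟩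
  have h := isProfile_profile lam le_rfl
  obtain ⟨hang, hnn⟩ := isAngle_profileAngle hlam (le_refl (0 : ℝ))
  have hN := h.ne_zero le_rfl
  set y := (profile lam 0).1
  set p := (profile lam 0).2
  set η := profileAngle lam 0 with hη
  have hder : ∀ t, HasDerivAt p (-(lam * sech2 t * y t)) t := fun t => by
    have := h.deriv_p t
    rwa [cutoff_zero_left] at this
  have hN2 : ∀ t, 0 < (ω * y t) ^ 2 + p t ^ 2 := by
    intro t
    by_contra! hcon
    have h1 := sq_nonneg (ω * y t)
    have h2 := sq_nonneg (p t)
    have h3 : p t = 0 := pow_eq_zero_iff two_ne_zero |>.1 (by linarith)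
    have h4 : ω * y t = 0 := pow_eq_zero_iff two_ne_zero |>.1 (by linarith)
    have h5 : y t = 0 := by
      rcases mul_eq_zero.1 h4 with h | h
      · exact absurd h hω0.ne'
      · exact h
    have := hN t
    rw [h3, h5] at this
    norm_num at this
  set rate : ℝ → ℝ := fun t => (p t * (ω * p t) - ω * y t * -(lam * sech2 t * y t)) /
    ((ω * y t) ^ 2 + p t ^ 2) with hrate
  have hratec : Continuous rate := by
    have h1 := h.continuous_y
    have h2 := h.continuous_p
    have h3 := continuous_sech2
    exact Continuous.div (by fun_prop) (by fun_prop) fun t => (hN2 t).ne'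
  -- The starting value of `ζ` is read off from the complex argument, negated because angles are
  -- clockwise. Its branch is irrelevant, as only increments over `[-1, 0]` are compared.
  set z : ℂ := ⟨ω * y (-1), p (-1)⟩ with hz
  set ζ : ℝ → ℝ := fun t => -z.arg + ∫ s in (-1 : ℝ)..t, rate s with hζ
  have hζd : ∀ t, HasDerivAt ζ (rate t) t := fun t =>
    (intervalIntegral.integral_hasDerivAt_right (hratec.intervalIntegrable _ _)
      (hratec.stronglyMeasurableAtFilter _ _) hratec.continuousAt).const_add _
  have hζ1 : ζ (-1) = -z.arg := by simp [hζ]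
  have hre : ω * y (-1) = ‖z‖ * cos z.arg := (Complex.norm_mul_cos_arg z).symm
  have him : p (-1) = ‖z‖ * sin z.arg := (Complex.norm_mul_sin_arg z).symm
  have hznorm : 0 < ‖z‖ := by
    rw [norm_pos_iff]
    intro hz0
    have := hN2 (-1)
    rw [hre, him, hz0] at this
    norm_num at this
  have hlift := lift_of_initial (u := fun t => ω * y t) (p := p) (η := ζ) (a := -1)
    (fun t => (h.deriv_y t).const_mul ω) hder hN2 hζd
    (by rw [hζ1, hre, him, Real.sin_neg, Real.cos_neg]; ring)
    (by
      rw [hζ1, hre, him, Real.sin_neg, Real.cos_neg]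
      have : ‖z‖ * cos z.arg * cos z.arg - ‖z‖ * sin z.arg * -sin z.arg =
        ‖z‖ * (sin z.arg ^ 2 + cos z.arg ^ 2) := by ring
      rw [this, Real.sin_sq_add_cos_sq, mul_one]
      exact hznorm)
  have hcos : ∀ t, 0 < cos (ζ t - η t) := by
    intro t
    obtain ⟨h1, h2⟩ := hlift t
    have h3 := hang.eq_cos t
    have h4 := hang.eq_sin t
    have h5 : 0 < ω * y t * y t + p t * p t := by
      have h6 := hN t
      have h7 : (1 : ℝ) ≤ ω := le_max_left _ _
      nlinarith [sq_nonneg (y t)]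
    have h8 : ω * y t * y t + p t * p t = √((ω * y t) ^ 2 + p t ^ 2) * √(y t ^ 2 + p t ^ 2) *
        cos (ζ t - η t) := by
      have h9 : ω * y t * y t + p t * p t =
          (√((ω * y t) ^ 2 + p t ^ 2) * cos (ζ t)) * (√(y t ^ 2 + p t ^ 2) * cos (η t)) +
          (-(√((ω * y t) ^ 2 + p t ^ 2) * sin (ζ t))) *
            (-(√(y t ^ 2 + p t ^ 2) * sin (η t))) := by
        rw [← h1, ← h2, ← h3, ← h4]
      rw [h9, Real.cos_sub]
      ring
    rw [h8] at h5
    exact pos_of_mul_pos_right h5 (by positivity)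
  have hζc : Continuous ζ := continuous_iff_continuousAt.2 fun t => (hζd t).continuousAt
  have hlt := abs_sub_lt_pi_of_cos_pos (δ := fun t => ζ t - η t) (a := -1) (b := 0) (by norm_num)
    (hζc.sub hang.cont) fun t _ => hcos t
  have hincr : ζ (-1) + ω ≤ ζ 0 := by
    have hmono : MonotoneOn (fun t => ζ t - ω * t) (Icc (-1) 0) := by
      have hd : ∀ t, HasDerivAt (fun t => ζ t - ω * t) (rate t - ω) t := fun t =>
        ((hζd t).sub ((hasDerivAt_id t).const_mul ω)).congr_deriv (by simp)
      apply monotoneOn_of_deriv_nonneg (convex_Icc _ _)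
      · exact fun t _ => (hd t).continuousAt.continuousWithinAt
      · exact fun t _ => (hd t).differentiableAt.differentiableWithinAt
      · intro t ht
        rw [interior_Icc] at ht
        rw [(hd t).deriv, sub_nonneg, hrate]
        simp only
        rw [le_div_iff₀ (hN2 t)]
        have h1 : ω ^ 2 ≤ lam * sech2 t := by
          rw [hlamdef, sech2, ← div_eq_mul_inv, le_div_iff₀ (by have := Real.cosh_pos t; positivity)]
          have : cosh t ≤ cosh 1 := by
            rw [Real.cosh_le_cosh, abs_one, abs_le]
            exact ⟨ht.1.le, by linarith [ht.2]⟩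
          have := Real.cosh_pos t
          gcongr
        have h2 := mul_le_mul_of_nonneg_left h1 (mul_nonneg hω0.le (sq_nonneg (y t)))
        nlinarith
    have := hmono (by norm_num : (-1 : ℝ) ∈ Icc (-1 : ℝ) 0) (by norm_num : (0 : ℝ) ∈ Icc (-1 : ℝ) 0)
      (by norm_num)
    simp only at this
    linarith
  have h1 := (abs_lt.1 hlt).2
  have h2 := hnn (-1)
  have h3 : N + π ≤ ω := le_max_right _ _
  rw [linearAngle]
  linarith

theorem exists_linearAngle_eq {x : ℝ} (hx : 0 ≤ x) : ∃ lam, 0 ≤ lam ∧ linearAngle lam = x := by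
  obtain ⟨b, hb, hxb⟩ := exists_le_linearAngle x
  obtain ⟨lam, hlam, h⟩ := intermediate_value_Icc hb
    (continuousOn_linearAngle.mono Icc_subset_Ici_self) ⟨by rw [linearAngle_zero]; exact hx, hxb⟩
  exact ⟨lam, hlam.1, h⟩

/-! ### The polar angle as a function of `t = log tan (θ / 2)` -/

/-- The solution `2 arctan (exp t)` of `θ' = sin θ`. -/
noncomputable def polar (t : ℝ) : ℝ := 2 * arctan (exp t)

/-- The inverse `log tan (θ / 2)` of `polar`. -/
noncomputable def polarInv (θ : ℝ) : ℝ := log (tan (θ / 2))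

theorem inv_cosh_le (t : ℝ) : (cosh t)⁻¹ ≤ 2 * exp t := by
  rw [inv_le_iff_one_le_mul₀ (Real.cosh_pos t), Real.cosh_eq]
  have : exp t * exp (-t) = 1 := by rw [← Real.exp_add]; simp
  have := Real.exp_pos t
  nlinarith

theorem polar_mem (t : ℝ) : polar t ∈ Ioo 0 π := by
  have h1 := Real.arctan_pos.2 (Real.exp_pos t)
  have h2 := Real.arctan_lt_pi_div_two (exp t)
  constructor <;> simp only [polar] <;> linarith

theorem sin_polar (t : ℝ) : sin (polar t) = (cosh t)⁻¹ := by
  have h1 : 0 < 1 + exp t ^ 2 := by positivity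
  rw [polar, Real.sin_two_mul, Real.sin_arctan, Real.cos_arctan, Real.cosh_eq, Real.exp_neg]
  have h2 : √(1 + exp t ^ 2) * √(1 + exp t ^ 2) = 1 + exp t ^ 2 := Real.mul_self_sqrt h1.le
  have h3 := Real.exp_pos t
  have h4 : 0 < √(1 + exp t ^ 2) := Real.sqrt_pos.2 h1
  rw [show 2 * (exp t / √(1 + exp t ^ 2)) * (1 / √(1 + exp t ^ 2)) =
    2 * exp t / (√(1 + exp t ^ 2) * √(1 + exp t ^ 2)) by field_simp, h2]
  field_simp
  ring

theorem sin_polar_sq (t : ℝ) : sin (polar t) ^ 2 = sech2 t := by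
  rw [sin_polar, sech2, inv_pow]

theorem hasDerivAt_polar (t : ℝ) : HasDerivAt polar (sin (polar t)) t := by
  refine ((Real.hasDerivAt_exp t).arctan.const_mul 2).congr_deriv ?_
  rw [sin_polar, Real.cosh_eq, Real.exp_neg]
  have h3 := Real.exp_pos t
  field_simp
  ring

theorem polar_zero : polar 0 = π / 2 := by
  rw [polar, Real.exp_zero, Real.arctan_one]
  ring

theorem polar_le (t : ℝ) : polar t ≤ 2 * exp t := by
  have h0 : arctan (exp t) ≤ exp t := by
    have h1 : 0 ≤ arctan (exp t) := (Real.arctan_pos.2 (Real.exp_pos t)).le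
    have h2 := Real.le_tan h1 (Real.arctan_lt_pi_div_two _)
    rwa [Real.tan_arctan] at h2
  unfold polar
  linarith

theorem tan_half_pos {θ : ℝ} (hθ : θ ∈ Ioo 0 π) : 0 < tan (θ / 2) :=
  Real.tan_pos_of_pos_of_lt_pi_div_two (by linarith [hθ.1]) (by linarith [hθ.2])

theorem polar_polarInv {θ : ℝ} (hθ : θ ∈ Ioo 0 π) : polar (polarInv θ) = θ := by
  rw [polar, polarInv, Real.exp_log (tan_half_pos hθ),
    Real.arctan_tan (by linarith [hθ.1, pi_pos]) (by linarith [hθ.2])]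
  ring

theorem polarInv_polar (t : ℝ) : polarInv (polar t) = t := by
  rw [polar, polarInv, mul_div_cancel_left₀ _ two_ne_zero, Real.tan_arctan, Real.log_exp]

theorem polarInv_pi_sub (θ : ℝ) : polarInv (π - θ) = -polarInv θ := by
  rw [polarInv, polarInv, sub_div, Real.tan_pi_div_two_sub, Real.log_inv]

theorem sin_eq_inv_cosh {θ : ℝ} (hθ : θ ∈ Ioo 0 π) : sin θ = (cosh (polarInv θ))⁻¹ := by
  rw [← sin_polar, polar_polarInv hθ]

theorem continuousAt_polarInv {θ : ℝ} (hθ : θ ∈ Ioo 0 π) : ContinuousAt polarInv θ := by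
  have h1 : cos (θ / 2) ≠ 0 :=
    (Real.cos_pos_of_mem_Ioo ⟨by linarith [hθ.1, pi_pos], by linarith [hθ.2]⟩).ne'
  have h2 : ContinuousAt (fun θ : ℝ => tan (θ / 2)) θ :=
    ContinuousAt.comp (f := fun θ : ℝ => θ / 2) (Real.continuousAt_tan.2 h1)
      (by fun_prop)
  exact h2.log (tan_half_pos hθ).ne'

theorem hasDerivAt_polarInv {θ : ℝ} (hθ : θ ∈ Ioo 0 π) : HasDerivAt polarInv (sin θ)⁻¹ θ := by
  have h1 := hasDerivAt_polar (polarInv θ)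
  rw [polar_polarInv hθ] at h1
  refine h1.of_local_left_inverse (continuousAt_polarInv hθ)
    (Real.sin_pos_of_mem_Ioo hθ).ne' ?_
  filter_upwards [Ioo_mem_nhds hθ.1 hθ.2] with x hx using polar_polarInv hx

theorem tendsto_polarInv_zero : Tendsto polarInv (𝓝[>] 0) atBot := by
  refine Real.tendsto_log_nhdsGT_zero.comp (tendsto_nhdsWithin_iff.2 ⟨?_, ?_⟩)
  · have : ContinuousAt (fun θ : ℝ => tan (θ / 2)) 0 :=
      ContinuousAt.comp (f := fun θ : ℝ => θ / 2) (Real.continuousAt_tan.2 (by simp))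
        (by fun_prop)
    have h := this.tendsto
    simp only [zero_div, Real.tan_zero] at h
    exact h.mono_left nhdsWithin_le_nhds
  · filter_upwards [Ioo_mem_nhdsGT pi_pos] with x hx using tan_half_pos hx

theorem tendsto_polarInv_pi : Tendsto polarInv (𝓝[<] π) atTop := by
  have h1 : Tendsto (fun θ => π - θ) (𝓝[<] π) (𝓝[>] 0) := by
    refine tendsto_nhdsWithin_iff.2 ⟨?_, ?_⟩
    · have : Continuous fun θ => π - θ := by fun_prop
      simpa using (this.tendsto π).mono_left nhdsWithin_le_nhds
    · filter_upwards [self_mem_nhdsWithin] with x hx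
      simpa using hx
  have h2 := tendsto_neg_atBot_atTop.comp (tendsto_polarInv_zero.comp h1)
  refine h2.congr fun θ => ?_
  simp only [Function.comp_apply, polarInv_pi_sub, neg_neg]

theorem polar_neg (t : ℝ) : polar (-t) = π - polar t := by
  have h1 : π - polar t ∈ Ioo 0 π := by
    have := polar_mem t
    exact ⟨by linarith [this.2], by linarith [this.1]⟩
  rw [← polar_polarInv h1, polarInv_pi_sub, polarInv_polar]

theorem tendsto_polar_atBot : Tendsto polar atBot (𝓝[>] 0) := by
  refine tendsto_nhdsWithin_iff.2 ⟨?_, Eventually.of_forall fun t => (polar_mem t).1⟩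
  have h1 : Tendsto (fun t => 2 * exp t) atBot (𝓝 0) := by
    simpa using Real.tendsto_exp_atBot.const_mul 2
  exact squeeze_zero (fun t => (polar_mem t).1.le) polar_le h1

/-! ### Eigenvalues -/

theorem eq_mul_profile {lam e : ℝ} {u p : ℝ → ℝ} (hu : ∀ t, HasDerivAt u (p t) t)
    (hp : ∀ t, HasDerivAt p (-(lam * sech2 t * u t)) t) (hu0 : Tendsto u atBot (𝓝 e))
    (hp0 : Tendsto p atBot (𝓝 0)) (t : ℝ) :
    u t = e * (profile lam 0).1 t ∧ p t = e * (profile lam 0).2 t := by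
  have h := isProfile_profile lam le_rfl
  set y := (profile lam 0).1
  set q := (profile lam 0).2
  have hyl := h.lim_y.const_mul e
  have hql := h.lim_p.const_mul e
  rw [mul_one] at hyl
  rw [mul_zero] at hql
  have hd : ∀ t, HasDerivAt (fun t => u t - e * y t) (p t - e * q t) t := fun t =>
    (hu t).sub ((h.deriv_y t).const_mul e)
  have hdl : Tendsto (fun t => u t - e * y t) atBot (𝓝 0) := by simpa using hu0.sub hyl
  have hc : Continuous fun t => u t - e * y t :=
    continuous_iff_continuousAt.2 fun t => (hd t).continuousAt
  obtain ⟨B, hB⟩ := exists_bound_Iic (T := t + 1) hc.continuousOn hdl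
  have := volterra_bound (M := 4 * |lam|) (ε := 0) (T := t + 1) (by positivity) le_rfl
    (fun s _ => hd s) (fun s _ => (hp s).sub ((h.deriv_p s).const_mul e)) (fun s _ => ?_)
    (fun s hs => hB s hs.le) hdl (by simpa using hp0.sub hql) (lt_add_one t)
  · simp only [abs_zero, zero_mul, add_zero, mul_zero, abs_nonpos_iff] at this
    exact ⟨by linarith [this.1], by linarith [this.2.1]⟩
  · rw [cutoff_zero_left, add_zero, show -(lam * sech2 s * u s) - e * -(lam * sech2 s * y s) =
      -(lam * sech2 s * (u s - e * y s)) by ring, abs_neg, abs_mul, abs_mul, abs_of_pos (sech2_pos s)]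
    have h2 := sech2_le s
    calc _ ≤ |lam| * (4 * exp (2 * s)) * |u s - e * y s| := by gcongr
      _ = _ := by ring

theorem exists_limit_of_abs_le_exp {u p : ℝ → ℝ} (hu : ∀ t, HasDerivAt u (p t) t)
    (h : ∀ᶠ t in atBot, |p t| ≤ 2 * exp t) :
    ∃ e, Tendsto u atBot (𝓝 e) ∧ Tendsto p atBot (𝓝 0) := by
  obtain ⟨T, hT⟩ := eventually_atBot.1 h
  have h1 : Tendsto (fun t => 2 * exp t) atBot (𝓝 0) := by
    simpa using Real.tendsto_exp_atBot.const_mul 2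
  obtain ⟨e, he⟩ := exists_tendsto_atBot_of_deriv_le (T := T) (fun t _ => hu t)
    (fun t _ => (Real.hasDerivAt_exp t).const_mul 2) (fun t ht => hT t ht.le) h1
  exact ⟨e, he, squeeze_zero_norm' h h1⟩

/-- The Neumann conditions make an eigenfunction regular at both poles, so both it and its
reflection are multiples `e`, `e'` of the profile. Comparison at the equator leaves only a vanishing
value or a vanishing slope. A negative `λ` is excluded because `u p` would be nondecreasing with
limit `0` at both ends. Conversely, an even or odd profile is regular at the second pole too. -/
theorem isAxisymEigenvalue_iff (lam : ℝ) : IsAxisymEigenvalue lam ↔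
    0 ≤ lam ∧ ((profile lam 0).1 0 = 0 ∨ (profile lam 0).2 0 = 0) := by
  have h := isProfile_profile lam le_rfl
  constructor
  · rintro ⟨φ, φ', hφ, hφ', hl0, hlπ, θ₀, hθ₀, hne⟩
    set u : ℝ → ℝ := fun t => φ (polar t) with hudef
    set p : ℝ → ℝ := fun t => sin (polar t) * φ' (polar t) with hpdef
    have hu : ∀ t, HasDerivAt u (p t) t := fun t =>
      ((hφ _ (polar_mem t)).comp t (hasDerivAt_polar t)).congr_deriv (by simp only [hpdef]; ring)
    have hp : ∀ t, HasDerivAt p (-(lam * sech2 t * u t)) t := fun t =>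
      ((hφ' _ (polar_mem t)).comp t (hasDerivAt_polar t)).congr_deriv (by
        simp only [hudef, ← sin_polar_sq]; ring)
    have small : ∀ᶠ t in atBot, |φ' (polar t)| ≤ 1 ∧ |φ' (polar (-t))| ≤ 1 := by
      have h1 := (hl0.comp tendsto_polar_atBot).abs
      have h2 : Tendsto (fun t => polar (-t)) atBot (𝓝[<] π) := by
        have : Tendsto (fun θ : ℝ => π - θ) (𝓝[>] 0) (𝓝[<] π) := by
          refine tendsto_nhdsWithin_iff.2 ⟨?_, ?_⟩
          · have : Continuous fun θ : ℝ => π - θ := by fun_prop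
            simpa using (this.tendsto 0).mono_left nhdsWithin_le_nhds
          · filter_upwards [self_mem_nhdsWithin] with x hx
            simpa using hx
        refine (this.comp tendsto_polar_atBot).congr fun t => ?_
        rw [polar_neg]
        rfl
      have h3 := (hlπ.comp h2).abs
      rw [abs_zero] at h1 h3
      filter_upwards [h1.eventually (gt_mem_nhds one_pos), h3.eventually (gt_mem_nhds one_pos)]
        with t h4 h5 using ⟨h4.le, h5.le⟩
    obtain ⟨e, hue, hpe⟩ := exists_limit_of_abs_le_exp hu (by
      filter_upwards [small] with t ht
      rw [hpdef]
      simp only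
      rw [sin_polar, abs_mul, abs_of_pos (inv_pos.2 (Real.cosh_pos t))]
      calc (cosh t)⁻¹ * |φ' (polar t)| ≤ 2 * exp t * 1 := by
            have := inv_cosh_le t
            have := ht.1
            gcongr
        _ = _ := mul_one _)
    have hu' : ∀ t, HasDerivAt (fun t => u (-t)) (-p (-t)) t := fun t =>
      ((hu (-t)).comp t (hasDerivAt_neg t)).congr_deriv (by ring)
    have hp' : ∀ t, HasDerivAt (fun t => -p (-t)) (-(lam * sech2 t * u (-t))) t := fun t =>
      ((hp (-t)).comp t (hasDerivAt_neg t)).neg.congr_deriv (by rw [sech2_neg]; ring)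
    obtain ⟨e', hue', hpe'⟩ := exists_limit_of_abs_le_exp hu' (by
      filter_upwards [small] with t ht
      rw [abs_neg, hpdef]
      simp only
      rw [sin_polar, abs_mul, Real.cosh_neg, abs_of_pos (inv_pos.2 (Real.cosh_pos t))]
      calc (cosh t)⁻¹ * |φ' (polar (-t))| ≤ 2 * exp t * 1 := by
            have := inv_cosh_le t
            have := ht.2
            gcongr
        _ = _ := mul_one _)
    have hnz : ∃ t, u t ≠ 0 := ⟨polarInv θ₀, by simpa only [hudef, polar_polarInv hθ₀] using hne⟩
    have key := eq_mul_profile hu hp hue hpe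
    have key' := eq_mul_profile hu' hp' hue' hpe'
    have he : e ≠ 0 := by
      rintro rfl
      obtain ⟨t, ht⟩ := hnz
      exact ht (by rw [(key t).1, zero_mul])
    refine ⟨?_, ?_⟩
    · by_contra! hneg
      have hder : ∀ t, HasDerivAt (fun t => u t * p t) (p t ^ 2 + -lam * sech2 t * u t ^ 2) t :=
        fun t => ((hu t).mul (hp t)).congr_deriv (by ring)
      have hnn : ∀ t, 0 ≤ p t ^ 2 + -lam * sech2 t * u t ^ 2 := fun t => by
        have h1 := sech2_pos t
        have h2 : 0 < -lam := by linarith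
        positivity
      have hmono : Monotone fun t => u t * p t := monotone_of_hasDerivAt_nonneg hder hnn
      have hl1 : Tendsto (fun t => u t * p t) atBot (𝓝 0) := by simpa using hue.mul hpe
      have hl2 : Tendsto (fun t => u t * p t) atTop (𝓝 0) := by
        have h1 := (hue'.mul hpe').neg.comp tendsto_neg_atTop_atBot
        simp only [mul_zero, neg_zero] at h1
        refine h1.congr fun t => ?_
        simp
      have hz : ∀ t, u t * p t = 0 := fun t =>
        le_antisymm (hmono.ge_of_tendsto hl2 t) (hmono.le_of_tendsto hl1 t)
      obtain ⟨t, ht⟩ := hnz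
      have h1 := hder t
      simp only [hz] at h1
      have h2 := h1.unique (hasDerivAt_const t (0 : ℝ))
      have h3 := sech2_pos t
      have h4 : 0 < -lam * sech2 t * u t ^ 2 := by
        have : 0 < -lam := by linarith
        positivity
      have := sq_nonneg (p t)
      linarith
    · have h1 := key 0
      have h2 := key' 0
      rw [neg_zero] at h2
      by_contra! hcon
      have h3 : e = e' := mul_right_cancel₀ hcon.1 (h1.1.symm.trans h2.1)
      have h4 : e * (profile lam 0).2 0 = 0 := by
        have h5 := h2.2
        rw [← h3] at h5
        linarith [h1.2]
      exact (mul_ne_zero he hcon.2) h4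
  · rintro ⟨-, h0⟩
    set y := (profile lam 0).1
    set p := (profile lam 0).2
    have hlim := h.tendsto_mul_cosh le_rfl
    have hlim' : Tendsto (fun t => p t * cosh t) atTop (𝓝 0) := by
      have h1 := hlim.comp tendsto_neg_atTop_atBot
      rcases h0 with h0 | h0
      · refine h1.congr fun t => ?_
        simp only [Function.comp_apply, Real.cosh_neg, (h.odd_of_y le_rfl h0 t).2]
      · rw [← neg_zero]
        refine h1.neg.congr fun t => ?_
        simp only [Function.comp_apply, Real.cosh_neg, (h.even_of_p le_rfl h0 t).2]
        ring
    have hder : ∀ t, HasDerivAt p (-(lam * sech2 t * y t)) t := fun t => by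
      have := h.deriv_p t
      rwa [cutoff_zero_left] at this
    refine ⟨fun θ => y (polarInv θ), fun θ => p (polarInv θ) * cosh (polarInv θ), ?_, ?_,
      hlim.comp tendsto_polarInv_zero, hlim'.comp tendsto_polarInv_pi, ?_⟩
    · intro θ hθ
      refine ((h.deriv_y _).comp θ (hasDerivAt_polarInv hθ)).congr_deriv ?_
      rw [sin_eq_inv_cosh hθ, inv_inv]
    · intro θ hθ
      have h1 := (hder _).comp θ (hasDerivAt_polarInv hθ)
      refine (h1.congr_deriv ?_).congr_of_eventuallyEq ?_
      · rw [← sin_polar_sq, polar_polarInv hθ]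
        have := (Real.sin_pos_of_mem_Ioo hθ).ne'
        field_simp
      · filter_upwards [Ioo_mem_nhds hθ.1 hθ.2] with x hx
        rw [sin_eq_inv_cosh hx]
        have := (Real.cosh_pos (polarInv x)).ne'
        simp only [Function.comp_apply]
        field_simp
    · obtain ⟨t, ht⟩ := (h.lim_y.eventually (lt_mem_nhds one_pos)).exists
      exact ⟨polar t, polar_mem t, by simpa only [polarInv_polar] using ht.ne'⟩

theorem IsAngle.vanish_iff {u p η : ℝ → ℝ} (h : IsAngle u p η) {t : ℝ}
    (hN : 0 < u t ^ 2 + p t ^ 2) (hη : 0 ≤ η t) :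
    (u t = 0 ∨ p t = 0) ↔ ∃ n : ℕ, η t = n * (π / 2) := by
  have h1 := h.eq_cos t
  have h2 := h.eq_sin t
  have h3 : √(u t ^ 2 + p t ^ 2) ≠ 0 := (Real.sqrt_pos.2 hN).ne'
  have h4 : (u t = 0 ∨ p t = 0) ↔ sin (2 * η t) = 0 := by
    generalize √(u t ^ 2 + p t ^ 2) = r at *
    rw [Real.sin_two_mul, h1, h2]
    simp [h3, or_comm]
  rw [h4, Real.sin_eq_zero_iff]
  constructor
  · rintro ⟨n, hn⟩
    have hn0 : 0 ≤ n := by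
      have : 0 ≤ (n : ℝ) * π := by rw [hn]; linarith
      exact_mod_cast nonneg_of_mul_nonneg_left this pi_pos
    lift n to ℕ using hn0
    exact ⟨n, by push_cast at hn; linarith⟩
  · rintro ⟨n, hn⟩
    exact ⟨n, by push_cast; rw [hn]; ring⟩

theorem isAxisymEigenvalue_iff_linearAngle (lam : ℝ) : IsAxisymEigenvalue lam ↔
    0 ≤ lam ∧ ∃ n : ℕ, linearAngle lam = n * (π / 2) := by
  rw [isAxisymEigenvalue_iff]
  refine and_congr_right fun hlam => ?_
  have h := isAngle_profileAngle hlam (le_refl (0 : ℝ))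
  exact h.1.vanish_iff ((isProfile_profile lam le_rfl).ne_zero le_rfl 0) (h.2 0)

/-- `linearAngle` is strictly increasing and takes every nonnegative value, so the ordered
eigenvalues correspond to consecutive multiples of `π / 2` and each infimum is attained. -/
theorem linearAngle_axisymEigenvalue (n : ℕ) :
    0 ≤ axisymEigenvalue n ∧ linearAngle (axisymEigenvalue n) = n * (π / 2) := by
  induction n with
  | zero =>
    have h : IsLeast {μ | IsAxisymEigenvalue μ} 0 := by
      refine ⟨(isAxisymEigenvalue_iff_linearAngle 0).2 ⟨le_rfl, 0, by simp [linearAngle_zero]⟩, ?_⟩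
      intro μ hμ
      exact ((isAxisymEigenvalue_iff_linearAngle μ).1 hμ).1
    rw [axisymEigenvalue, h.csInf_eq]
    exact ⟨le_rfl, by simp [linearAngle_zero]⟩
  | succ k ih =>
    obtain ⟨lam, hlam, heq⟩ := exists_linearAngle_eq (x := ((k + 1 : ℕ) : ℝ) * (π / 2))
      (by positivity)
    have h : IsLeast {μ | IsAxisymEigenvalue μ ∧ axisymEigenvalue k < μ} lam := by
      refine ⟨⟨(isAxisymEigenvalue_iff_linearAngle lam).2 ⟨hlam, _, heq⟩, ?_⟩, ?_⟩
      · rw [← strictMonoOn_linearAngle.lt_iff_lt ih.1 hlam, ih.2, heq]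
        push_cast
        nlinarith [pi_pos]
      · rintro μ ⟨hμ, hlt⟩
        obtain ⟨hμ0, n, hn⟩ := (isAxisymEigenvalue_iff_linearAngle μ).1 hμ
        rw [← strictMonoOn_linearAngle.lt_iff_lt ih.1 hμ0, ih.2, hn] at hlt
        rw [← strictMonoOn_linearAngle.le_iff_le hlam hμ0, heq, hn]
        have h1 := lt_of_mul_lt_mul_right hlt (by positivity)
        have h2 : k + 1 ≤ n := by exact_mod_cast h1
        have h3 : ((k + 1 : ℕ) : ℝ) ≤ n := by exact_mod_cast h2
        gcongr
    rw [axisymEigenvalue, h.csInf_eq]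
    exact ⟨hlam, heq⟩

/-! ### Orbits of the shooting system -/

/-- `(u, p)` solves the shooting system for `t ≤ t₀` and tends to `(d, 0)` at `-∞`. -/
structure IsHalfOrbit (lam d t₀ : ℝ) (u p : ℝ → ℝ) : Prop where
  deriv_u : ∀ t ≤ t₀, HasDerivWithinAt u (p t) (Iic t₀) t
  deriv_p : ∀ t ≤ t₀,
    HasDerivWithinAt p (-(lam * sech2 t * (u t * (1 - u t ^ 2)))) (Iic t₀) t
  lim_u : Tendsto u atBot (𝓝 d)
  lim_p : Tendsto p atBot (𝓝 0)

theorem shootU_neg (lam d t : ℝ) : shootU lam (-d) t = -shootU lam d t := by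
  simp [shootU]

theorem shootP_neg (lam d t : ℝ) : shootP lam (-d) t = -shootP lam d t := by
  simp [shootP]

theorem hasDerivWithinAt_of_lt {f : ℝ → ℝ} {f' t t₀ : ℝ} (h : HasDerivWithinAt f f' (Iic t₀) t)
    (ht : t < t₀) : HasDerivAt f f' t :=
  h.hasDerivAt (Iic_mem_nhds ht)

/-- The cubic is only locally Lipschitz, but a half orbit is bounded because it converges at `-∞`.
Its own bound `B` supplies the constant in the Gronwall inequality. -/
theorem IsHalfOrbit.eq_shoot {lam d t₀ : ℝ} {u p : ℝ → ℝ} (h : IsHalfOrbit lam d t₀ u p)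
    (hd : ∀ t ≤ t₀, shootU lam d t ^ 2 ≤ 1) {t : ℝ} (ht : t ≤ t₀) :
    u t = shootU lam d t ∧ p t = shootP lam d t := by
  have huc : ContinuousOn u (Iic t₀) := fun s hs => (h.deriv_u s hs).continuousWithinAt
  have hpc : ContinuousOn p (Iic t₀) := fun s hs => (h.deriv_p s hs).continuousWithinAt
  have hUc : Continuous (shootU lam d) :=
    continuous_iff_continuousAt.2 fun s => (hasDerivAt_shootU lam d s).continuousAt
  have hPc : ContinuousOn (shootP lam d) (Iic t₀) := fun s hs =>
    (hasDerivAt_shootP (hd s hs)).continuousAt.continuousWithinAt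
  obtain ⟨B, hB⟩ := exists_bound_Iic huc h.lim_u
  have hB0 : 0 ≤ B := (abs_nonneg _).trans (hB t₀ le_rfl)
  have key : ∀ t < t₀, |u t - shootU lam d t| ≤ 0 ∧ |p t - shootP lam d t| ≤ 0 := by
    intro t ht
    have := volterra_bound (M := 4 * |lam| * (1 + (B ^ 2 + B + 1))) (ε := 0) (T := t₀) (e := 0)
      (B := B + 1)
      (u := fun t => u t - shootU lam d t) (p := fun t => p t - shootP lam d t)
      (by positivity) le_rfl
      (fun s hs => (hasDerivWithinAt_of_lt (h.deriv_u s hs.le) hs).sub (hasDerivAt_shootU lam d s))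
      (fun s hs => (hasDerivWithinAt_of_lt (h.deriv_p s hs.le) hs).sub
        (hasDerivAt_shootP (hd s hs.le)))
      (fun s hs => ?_) (fun s hs => (abs_sub _ _).trans (add_le_add (hB s hs.le)
        ((sq_le_one_iff_abs_le_one _).1 (hd s hs.le))))
      (by simpa using h.lim_u.sub (tendsto_shootU lam d))
      (by simpa using h.lim_p.sub (tendsto_shootP lam d)) ht
    · simp only [abs_zero, zero_mul, add_zero, mul_zero] at this
      exact ⟨this.1, this.2.1⟩
    · set U := shootU lam d s with hU
      have e : -(lam * sech2 s * (u s * (1 - u s ^ 2))) - -(lam * sech2 s * (U * (1 - U ^ 2))) =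
          -(lam * sech2 s * ((1 - (u s ^ 2 + u s * U + U ^ 2)) * (u s - U))) := by ring
      rw [e, abs_neg, abs_mul, abs_mul, abs_mul, abs_of_pos (sech2_pos s), add_zero]
      have h1 := hB s hs.le
      have h2 := (sq_le_one_iff_abs_le_one _).1 (hd s hs.le)
      have h3 : |1 - (u s ^ 2 + u s * U + U ^ 2)| ≤ 1 + (B ^ 2 + B + 1) := by
        have h4 : |u s ^ 2 + u s * U + U ^ 2| ≤ B ^ 2 + B * 1 + 1 ^ 2 := by
          refine (abs_add_three _ _ _).trans ?_
          rw [abs_pow, abs_mul, abs_pow]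
          gcongr
        refine (abs_sub _ _).trans ?_
        rw [abs_one]
        linarith
      have h4 := sech2_le s
      calc _ ≤ |lam| * (4 * exp (2 * s)) * ((1 + (B ^ 2 + B + 1)) * |u s - U|) := by gcongr
        _ = _ := by ring
  have key' : |u t - shootU lam d t| ≤ 0 ∧ |p t - shootP lam d t| ≤ 0 := by
    rcases ht.eq_or_lt with rfl | ht
    · exact ⟨le_of_forall_lt_of_continuousAt (f := fun s => |u s - shootU lam d s|)
        ((huc t (mem_Iic.2 le_rfl)).sub hUc.continuousWithinAt).abs fun s hs => (key s hs).1,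
        le_of_forall_lt_of_continuousAt (f := fun s => |p s - shootP lam d s|)
        ((hpc t (mem_Iic.2 le_rfl)).sub (hPc t (mem_Iic.2 le_rfl))).abs fun s hs => (key s hs).2⟩
    · exact key t ht
  rw [abs_nonpos_iff, abs_nonpos_iff, sub_eq_zero, sub_eq_zero] at key'
  exact key'

/-- As the sine is `1`-Lipschitz, the squared difference times `e^{2τ}` is nondecreasing, and it
vanishes at `τ = 0`. -/
theorem eq_polar {γ : ℝ → ℝ} {t₀ : ℝ} (h0 : γ 0 = polar t₀)
    (h : ∀ τ ≤ 0, HasDerivWithinAt γ (sin (γ τ)) (Iic 0) τ) {τ : ℝ} (hτ : τ ≤ 0) :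
    γ τ = polar (t₀ + τ) := by
  set δ : ℝ → ℝ := fun τ => γ τ - polar (t₀ + τ) with hδ
  have hpol : ∀ τ, HasDerivAt (fun τ => polar (t₀ + τ)) (sin (polar (t₀ + τ))) τ := fun τ =>
    ((hasDerivAt_polar (t₀ + τ)).comp τ ((hasDerivAt_id τ).const_add t₀)).congr_deriv (by simp)
  have hd : ∀ τ ≤ 0, HasDerivWithinAt δ (sin (γ τ) - sin (polar (t₀ + τ))) (Iic 0) τ := fun τ hτ =>
    (h τ hτ).sub (hpol τ).hasDerivWithinAt
  have hmono : MonotoneOn (fun τ => δ τ ^ 2 * exp (2 * τ)) (Iic 0) := by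
    apply monotoneOn_of_deriv_nonneg (convex_Iic 0)
    · exact fun s hs => ((hd s hs).continuousWithinAt.pow 2).mul (by fun_prop)
    · intro s hs
      rw [interior_Iic] at hs
      exact (((hasDerivWithinAt_of_lt (hd s (le_of_lt hs)) hs).pow 2).mul
        (hasDerivAt_exp_two s)).differentiableAt.differentiableWithinAt
    · intro s hs
      rw [interior_Iic] at hs
      have h1 := ((hasDerivWithinAt_of_lt (hd s (le_of_lt hs)) hs).pow 2).mul (hasDerivAt_exp_two s)
      have h2 : |sin (γ s) - sin (polar (t₀ + s))| ≤ |δ s| := Real.abs_sin_sub_sin_le _ _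
      have h3 : 0 ≤ 2 * δ s * (sin (γ s) - sin (polar (t₀ + s))) + 2 * δ s ^ 2 := by
        have h4 : |δ s * (sin (γ s) - sin (polar (t₀ + s)))| ≤ |δ s| * |δ s| := by
          rw [abs_mul]
          gcongr
        rw [abs_mul_abs_self] at h4
        have := (abs_le.1 h4).1
        linarith
      refine (mul_nonneg h3 (Real.exp_pos (2 * s)).le).trans_eq ?_
      refine Eq.trans ?_ h1.deriv.symm
      simp only [Pi.pow_apply]
      push_cast
      ring
  have h1 := hmono hτ (mem_Iic.2 le_rfl) hτ
  simp only [hδ, h0, add_zero, sub_self] at h1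
  have h2 : (γ τ - polar (t₀ + τ)) ^ 2 ≤ 0 := by
    refine nonpos_of_mul_nonpos_left (a := (γ τ - polar (t₀ + τ)) ^ 2) ?_ (Real.exp_pos (2 * τ))
    linarith
  have h3 := pow_eq_zero_iff two_ne_zero |>.1 (le_antisymm h2 (sq_nonneg _))
  linarith

theorem hasDerivWithinAt_fst {E F : Type*} [NormedAddCommGroup E] [NormedSpace ℝ E]
    [NormedAddCommGroup F] [NormedSpace ℝ F] {f : ℝ → E × F} {f' : E × F} {s : Set ℝ} {t : ℝ}
    (h : HasDerivWithinAt f f' s t) : HasDerivWithinAt (fun t => (f t).1) f'.1 s t :=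
  (hasFDerivAt_fst (p := f t) (𝕜 := ℝ)).comp_hasDerivWithinAt t h

theorem hasDerivWithinAt_snd {E F : Type*} [NormedAddCommGroup E] [NormedSpace ℝ E]
    [NormedAddCommGroup F] [NormedSpace ℝ F] {f : ℝ → E × F} {f' : E × F} {s : Set ℝ} {t : ℝ}
    (h : HasDerivWithinAt f f' s t) : HasDerivWithinAt (fun t => (f t).2) f'.2 s t :=
  (hasFDerivAt_snd (p := f t) (𝕜 := ℝ)).comp_hasDerivWithinAt t h

theorem exists_halfOrbit {lam d t₀ u₀ p₀ : ℝ}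
    (h : (polar t₀, u₀, p₀) ∈ strongUnstable (shootField lam) (0, d, 0)) :
    ∃ u p, IsHalfOrbit lam d t₀ u p ∧ u t₀ = u₀ ∧ p t₀ = p₀ := by
  obtain ⟨γ, h0, hγ, C, α, hα, hC⟩ := h
  have hfst : ∀ τ ≤ 0, HasDerivWithinAt (fun τ => (γ τ).1) (sin (γ τ).1) (Iic 0) τ := fun τ hτ =>
    hasDerivWithinAt_fst (hγ τ hτ)
  have hu : ∀ τ ≤ 0, HasDerivWithinAt (fun τ => (γ τ).2.1) (γ τ).2.2 (Iic 0) τ := fun τ hτ =>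
    hasDerivWithinAt_fst (hasDerivWithinAt_snd (hγ τ hτ))
  have hp : ∀ τ ≤ 0, HasDerivWithinAt (fun τ => (γ τ).2.2)
      (-(lam * (γ τ).2.1 * (1 - (γ τ).2.1 ^ 2) * sin (γ τ).1 ^ 2)) (Iic 0) τ := fun τ hτ =>
    hasDerivWithinAt_snd (hasDerivWithinAt_snd (hγ τ hτ))
  have hθ : ∀ τ ≤ 0, (γ τ).1 = polar (t₀ + τ) := fun τ hτ =>
    eq_polar (γ := fun τ => (γ τ).1) (by simp only [h0]) hfst hτ
  have hshift : MapsTo (fun s => s - t₀) (Iic t₀) (Iic 0) := fun s hs => by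
    simpa using hs
  have hsub : ∀ t, HasDerivWithinAt (fun s => s - t₀) 1 (Iic t₀) t := fun t =>
    ((hasDerivAt_id t).sub_const t₀).hasDerivWithinAt
  have hlim : Tendsto γ atBot (𝓝 (0, d, 0)) := by
    rw [tendsto_iff_dist_tendsto_zero]
    have h1 : Tendsto (fun τ => C * exp (α * τ)) atBot (𝓝 0) := by
      simpa using (Real.tendsto_exp_atBot.comp (tendsto_id.const_mul_atBot hα)).const_mul C
    refine squeeze_zero' (Eventually.of_forall fun _ => dist_nonneg) ?_ h1
    filter_upwards [eventually_le_atBot 0] with τ hτ using hC τ hτ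
  have hlim' : Tendsto (fun t => γ (t - t₀)) atBot (𝓝 (0, d, 0)) :=
    hlim.comp (tendsto_atBot_add_const_right _ (-t₀) tendsto_id)
  have hl2 := (continuous_snd.tendsto _).comp hlim'
  refine ⟨fun t => (γ (t - t₀)).2.1, fun t => (γ (t - t₀)).2.2, ⟨fun t ht => ?_, fun t ht => ?_,
    (continuous_fst.tendsto _).comp hl2, (continuous_snd.tendsto _).comp hl2⟩, ?_, ?_⟩
  · have h1 := (hu (t - t₀) (by linarith)).comp t (hsub t) hshift
    rw [mul_one] at h1
    exact h1
  · refine ((hp (t - t₀) (by linarith)).comp t (hsub t) hshift).congr_deriv ?_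
    rw [hθ (t - t₀) (by linarith), sin_polar_sq]
    ring_nf
  · simp [h0]
  · simp [h0]

theorem mem_strongUnstable {lam d t₀ : ℝ} (hd : ∀ t ≤ t₀, shootU lam d t ^ 2 ≤ 1) :
    (polar t₀, shootU lam d t₀, shootP lam d t₀) ∈ strongUnstable (shootField lam) (0, d, 0) := by
  set c := |d| * (4 * |lam| * growth (4 * |lam|) (t₀ + 1)) with hc
  have hc0 : 0 ≤ c := by
    have := growth_pos (4 * |lam|) (t₀ + 1)
    positivity
  -- The rate `1` is dictated by `θ`, bounded by `2 eᵗ`; the components `u` and `p` converge at the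
  -- faster rate `2`.
  refine ⟨fun τ => (polar (t₀ + τ), shootU lam d (t₀ + τ), shootP lam d (t₀ + τ)), by simp,
    fun τ hτ => ?_, 2 * exp t₀ + c * exp (2 * t₀), 1, one_pos, fun τ hτ => ?_⟩
  · have hadd : HasDerivAt (fun τ => t₀ + τ) 1 τ := (hasDerivAt_id τ).const_add t₀
    have h1 := (hasDerivAt_polar (t₀ + τ)).comp τ hadd
    have h2 := (hasDerivAt_shootU lam d (t₀ + τ)).comp τ hadd
    have h3 := (hasDerivAt_shootP (hd (t₀ + τ) (by linarith))).comp τ hadd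
    refine ((h1.prodMk (h2.prodMk h3)).congr_deriv ?_).hasDerivWithinAt
    simp only [shootField, sin_polar_sq, mul_one]
    congr 2
    ring
  · have hle : exp (2 * (t₀ + τ)) ≤ exp (2 * t₀) * exp (1 * τ) := by
      rw [← Real.exp_add]
      exact Real.exp_le_exp.2 (by linarith)
    have hb := (isProfile_profile lam (sq_nonneg d)).bounds (sq_nonneg d) le_rfl
      (T := t₀ + 1) (t := t₀ + τ) (by linarith)
    have hmain : c * exp (2 * (t₀ + τ)) ≤ (2 * exp t₀ + c * exp (2 * t₀)) * exp (1 * τ) := by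
      have h1 := mul_le_mul_of_nonneg_left hle hc0
      have h2 : 0 ≤ 2 * exp t₀ * exp (1 * τ) := by positivity
      linarith
    rw [Prod.dist_eq, Prod.dist_eq]
    refine max_le ?_ (max_le ?_ ?_)
    · simp only [Real.dist_eq, sub_zero]
      rw [abs_of_pos (polar_mem _).1]
      refine (polar_le _).trans ?_
      have h1 : exp (t₀ + τ) = exp t₀ * exp (1 * τ) := by rw [one_mul, Real.exp_add]
      have h2 : 0 ≤ c * exp (2 * t₀) * exp (1 * τ) := by positivity
      rw [h1]
      linarith
    · refine le_trans ?_ hmain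
      simp only [Real.dist_eq]
      have h1 : shootU lam d (t₀ + τ) - d = d * ((profile lam (d ^ 2)).1 (t₀ + τ) - 1) := by
        rw [shootU]; ring
      rw [h1, abs_mul, hc, mul_assoc]
      exact mul_le_mul_of_nonneg_left hb.2.2 (abs_nonneg d)
    · refine le_trans ?_ hmain
      simp only [Real.dist_eq, sub_zero]
      rw [shootP, abs_mul, hc, mul_assoc]
      exact mul_le_mul_of_nonneg_left hb.2.1 (abs_nonneg d)

/-! ### Time reversal between stable and unstable manifolds -/

theorem mem_strongStable_of_mem_strongUnstable {lam e θ u p : ℝ}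
    (h : (π - θ, u, -p) ∈ strongUnstable (shootField lam) (0, e, 0)) :
    (θ, u, p) ∈ strongStable (shootField lam) (π, e, 0) := by
  obtain ⟨γ, h0, hγ, C, α, hα, hC⟩ := h
  refine ⟨fun τ => (π - (γ (-τ)).1, (γ (-τ)).2.1, -(γ (-τ)).2.2), by simp [h0], fun τ hτ => ?_,
    C, α, hα, fun τ hτ => ?_⟩
  · have hmaps : MapsTo (fun s : ℝ => -s) (Ici 0) (Iic 0) := fun s hs => by simpa using hs
    have h1 := (hγ (-τ) (by linarith)).scomp τ (hasDerivAt_neg τ).hasDerivWithinAt hmaps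
    have hsnd := hasDerivWithinAt_snd h1
    refine (((hasDerivWithinAt_fst h1).const_sub π).prodMk ((hasDerivWithinAt_fst hsnd).prodMk
      (hasDerivWithinAt_snd hsnd).neg)).congr_deriv ?_
    simp [shootField]
  · refine le_of_eq_of_le ?_ ((hC (-τ) (by linarith)).trans_eq (by rw [mul_neg]))
    rw [Prod.dist_eq, Prod.dist_eq, Prod.dist_eq, Prod.dist_eq]
    simp only [Real.dist_eq, sub_zero, abs_neg]
    rw [show π - (γ (-τ)).1 - π = -(γ (-τ)).1 by ring, abs_neg]

theorem mem_strongUnstable_of_mem_strongStable {lam e θ u p : ℝ}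
    (h : (θ, u, p) ∈ strongStable (shootField lam) (π, e, 0)) :
    (π - θ, u, -p) ∈ strongUnstable (shootField lam) (0, e, 0) := by
  obtain ⟨γ, h0, hγ, C, α, hα, hC⟩ := h
  refine ⟨fun τ => (π - (γ (-τ)).1, (γ (-τ)).2.1, -(γ (-τ)).2.2), by simp [h0], fun τ hτ => ?_,
    C, α, hα, fun τ hτ => ?_⟩
  · have hmaps : MapsTo (fun s : ℝ => -s) (Iic 0) (Ici 0) := fun s hs => by simpa using hs
    have h1 := (hγ (-τ) (by linarith)).scomp τ (hasDerivAt_neg τ).hasDerivWithinAt hmaps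
    have hsnd := hasDerivWithinAt_snd h1
    refine (((hasDerivWithinAt_fst h1).const_sub π).prodMk ((hasDerivWithinAt_fst hsnd).prodMk
      (hasDerivWithinAt_snd hsnd).neg)).congr_deriv ?_
    simp [shootField]
  · refine le_of_eq_of_le ?_ ((hC (-τ) (by linarith)).trans_eq (by rw [mul_neg, neg_neg]))
    rw [Prod.dist_eq, Prod.dist_eq, Prod.dist_eq, Prod.dist_eq]
    simp only [Real.dist_eq, sub_zero, abs_neg]
    rw [abs_sub_comm π]

/-! ### Tangent vectors at the origin -/

/-- Here `t₀` may lie beyond the equator and `λ` is arbitrary: smallness of `d` replaces the energy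
bound and keeps the cutoff inactive. -/
theorem eventually_shootU_sq_le (lam t₀ : ℝ) :
    ∀ᶠ d in 𝓝 (0 : ℝ), ∀ t ≤ t₀, shootU lam d t ^ 2 ≤ 1 := by
  set g := growth (4 * |lam|) (t₀ + 1) with hg
  have h1 : Tendsto (fun d : ℝ => |d| * g) (𝓝 0) (𝓝 0) := by
    have : Continuous fun d : ℝ => |d| * g := by fun_prop
    simpa using this.tendsto 0
  filter_upwards [h1.eventually (gt_mem_nhds one_pos)] with d hd t ht
  have hb := ((isProfile_profile lam (sq_nonneg d)).bounds (sq_nonneg d) le_rfl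
      (T := t₀ + 1) (t := t) (by linarith)).1
  rw [sq_le_one_iff_abs_le_one, shootU, abs_mul]
  exact (mul_le_mul_of_nonneg_left hb (abs_nonneg d)).trans hd.le

theorem hasDerivAt_mul_self_of_continuousAt {g : ℝ → ℝ} (hg : ContinuousAt g 0) :
    HasDerivAt (fun d => d * g d) (g 0) 0 := by
  rw [hasDerivAt_iff_tendsto_slope]
  refine (hg.tendsto.mono_left nhdsWithin_le_nhds).congr' ?_
  filter_upwards [self_mem_nhdsWithin] with d hd
  have : d ≠ 0 := hd
  rw [slope_def_field]
  field_simp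
  ring

/-- The shooting solution is `d` times a continuous function of `d²`, so its derivative at `0` is
the value of that function; no variational equation is needed. -/
theorem hasDerivAt_shoot_zero (lam t : ℝ) :
    HasDerivAt (fun d => (shootU lam d t, shootP lam d t))
      ((profile lam 0).1 t, (profile lam 0).2 t) 0 := by
  have h := tendsto_profile (l := 𝓝 (0 : ℝ)) (f := fun _ => lam) (g := fun d => d ^ 2)
    (κ₀ := 0 ^ 2) (sq_nonneg 0) tendsto_const_nhds ((continuous_pow 2).tendsto 0)
    (Eventually.of_forall fun d => sq_nonneg d) t
  have h1 := hasDerivAt_mul_self_of_continuousAt (g := fun d => (profile lam (d ^ 2)).1 t) h.1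
  have h2 := hasDerivAt_mul_self_of_continuousAt (g := fun d => (profile lam (d ^ 2)).2 t) h.2
  simp only [zero_pow two_ne_zero] at h1 h2
  exact h1.prodMk h2

/-- By uniqueness of half orbits any admissible parametrization agrees with the shooting solution
for `d` near `0`, so the tangent does not depend on its choice. -/
theorem isUnstableTangent_iff {lam θ : ℝ} (hθ : θ ∈ Ioo 0 π) (w : ℝ × ℝ) :
    IsUnstableTangent lam θ 0 w ↔
      w = ((profile lam 0).1 (polarInv θ), (profile lam 0).2 (polarInv θ)) := by
  have hsmall := eventually_shootU_sq_le lam (polarInv θ)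
  constructor
  · rintro ⟨c, hc, hcw⟩
    refine hcw.unique ((hasDerivAt_shoot_zero lam (polarInv θ)).congr_of_eventuallyEq ?_)
    filter_upwards [hc, hsmall] with d h1 h2
    have h3 : (polar (polarInv θ), (c d).1, (c d).2) ∈
        strongUnstable (shootField lam) (0, d, 0) := by
      rw [polar_polarInv hθ]
      exact h1
    obtain ⟨u, p, hup, hu, hp⟩ := exists_halfOrbit h3
    have h4 := hup.eq_shoot h2 le_rfl
    rw [hu, hp] at h4
    exact Prod.ext h4.1 h4.2
  · rintro rfl
    refine ⟨fun d => (shootU lam d (polarInv θ), shootP lam d (polarInv θ)), ?_,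
      hasDerivAt_shoot_zero lam (polarInv θ)⟩
    filter_upwards [hsmall] with d hd
    have := mem_strongUnstable hd
    rwa [polar_polarInv hθ] at this

theorem exists_isUnstableTangentAngle {lam : ℝ} (hlam : 0 ≤ lam) :
    ∃ ν, IsUnstableTangentAngle lam 0 ν := by
  obtain ⟨h, -⟩ := isAngle_profileAngle hlam (le_refl (0 : ℝ))
  refine ⟨fun θ => profileAngle lam 0 (polarInv θ), fun θ hθ => ?_,
    h.lim.comp tendsto_polarInv_zero, fun θ hθ => ?_⟩
  · exact (h.cont.continuousAt.comp (continuousAt_polarInv hθ)).continuousWithinAt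
  · refine ⟨√((profile lam 0).1 (polarInv θ) ^ 2 + (profile lam 0).2 (polarInv θ) ^ 2),
      Real.sqrt_pos.2 ((isProfile_profile lam le_rfl).ne_zero le_rfl _), ?_⟩
    rw [isUnstableTangent_iff hθ, ← h.eq_cos, ← h.eq_sin]

theorem IsUnstableTangentAngle.eq_linearAngle {lam : ℝ} (hlam : 0 ≤ lam) {ν : ℝ → ℝ}
    (h : IsUnstableTangentAngle lam 0 ν) : ν (π / 2) = linearAngle lam := by
  obtain ⟨hc, hl, ht⟩ := h
  obtain ⟨ha, -⟩ := isAngle_profileAngle hlam (le_refl (0 : ℝ))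
  set y := (profile lam 0).1
  set p := (profile lam 0).2
  have key : ∀ t, y t = √(y t ^ 2 + p t ^ 2) * cos (ν (polar t)) ∧
      p t = -(√(y t ^ 2 + p t ^ 2) * sin (ν (polar t))) := by
    intro t
    obtain ⟨r, hr, hw⟩ := ht (polar t) (polar_mem t)
    rw [isUnstableTangent_iff (polar_mem t), polarInv_polar, Prod.mk.injEq] at hw
    obtain ⟨h1, h2⟩ := hw
    have h3 : y t ^ 2 + p t ^ 2 = r ^ 2 := by
      rw [show y t = _ from h1.symm, show p t = _ from h2.symm]
      linear_combination r ^ 2 * Real.sin_sq_add_cos_sq (ν (polar t))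
    rw [h3, Real.sqrt_sq hr.le]
    exact ⟨h1.symm, h2.symm⟩
  have hν : IsAngle y p (fun t => ν (polar t)) := by
    refine ⟨continuous_iff_continuousAt.2 fun t => ?_, hl.comp tendsto_polar_atBot,
      fun t => (key t).1, fun t => (key t).2⟩
    have hpm := polar_mem t
    exact (hc.continuousAt (Ioo_mem_nhds hpm.1 hpm.2)).comp (hasDerivAt_polar t).continuousAt
  have := hν.unique ha ((isProfile_profile lam le_rfl).ne_zero le_rfl) 0
  simp only [polar_zero] at this
  exact this

/-! ### Full orbits -/

/-- `(u, p)` solves the shooting system on all of `ℝ` and tends to `(d, 0)` and `(e, 0)`. -/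
structure IsFullOrbit (lam d e : ℝ) (u p : ℝ → ℝ) : Prop where
  deriv_u : ∀ t, HasDerivAt u (p t) t
  deriv_p : ∀ t, HasDerivAt p (-(lam * sech2 t * (u t * (1 - u t ^ 2)))) t
  lim_u : Tendsto u atBot (𝓝 d)
  lim_p : Tendsto p atBot (𝓝 0)
  lim_u' : Tendsto u atTop (𝓝 e)
  lim_p' : Tendsto p atTop (𝓝 0)

namespace IsFullOrbit

variable {lam d e : ℝ} {u p : ℝ → ℝ}

theorem neg (h : IsFullOrbit lam d e u p) :
    IsFullOrbit lam (-d) (-e) (fun t => -u t) (fun t => -p t) where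
  deriv_u t := (h.deriv_u t).neg
  deriv_p t := (h.deriv_p t).neg.congr_deriv (by ring)
  lim_u := h.lim_u.neg
  lim_p := by simpa using h.lim_p.neg
  lim_u' := h.lim_u'.neg
  lim_p' := by simpa using h.lim_p'.neg

theorem reverse (h : IsFullOrbit lam d e u p) :
    IsFullOrbit lam e d (fun t => u (-t)) (fun t => -p (-t)) where
  deriv_u t := ((h.deriv_u (-t)).comp t (hasDerivAt_neg t)).congr_deriv (by ring)
  deriv_p t := ((h.deriv_p (-t)).comp t (hasDerivAt_neg t)).neg.congr_deriv (by
    rw [sech2_neg]; ring)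
  lim_u := h.lim_u'.comp tendsto_neg_atBot_atTop
  lim_p := by simpa using (h.lim_p'.comp tendsto_neg_atBot_atTop).neg
  lim_u' := h.lim_u.comp tendsto_neg_atTop_atBot
  lim_p' := by simpa using (h.lim_p.comp tendsto_neg_atTop_atBot).neg

theorem halfOrbit (h : IsFullOrbit lam d e u p) (t₀ : ℝ) : IsHalfOrbit lam d t₀ u p where
  deriv_u t _ := (h.deriv_u t).hasDerivWithinAt
  deriv_p t _ := (h.deriv_p t).hasDerivWithinAt
  lim_u := h.lim_u
  lim_p := h.lim_p

/-- If `d > 1`, the orbit starts with `u > 1` and `p > 0`, and above `1` the equation makes `u`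
convex. Both components then never decrease, so `p` cannot tend to `0`. -/
theorem le_one (h : IsFullOrbit lam d e u p) (hlam : 0 < lam) : d ≤ 1 := by
  by_contra! hd
  have huc : Continuous u := continuous_iff_continuousAt.2 fun t => (h.deriv_u t).continuousAt
  have hpc : Continuous p := continuous_iff_continuousAt.2 fun t => (h.deriv_p t).continuousAt
  have hpos : ∀ t, 1 < u t → 0 < -(lam * sech2 t * (u t * (1 - u t ^ 2))) := by
    intro t ht
    have h1 := sech2_pos t
    have h2 : 0 < u t ^ 2 - 1 := by nlinarith
    have h3 : 0 < u t := by linarith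
    have h4 : 0 < lam * sech2 t * (u t * (u t ^ 2 - 1)) := by positivity
    linarith
  obtain ⟨τ, hτ⟩ := eventually_atBot.1 (h.lim_u.eventually (lt_mem_nhds hd))
  set a := τ - 1 with ha
  have hua : 1 < u a := hτ a (by rw [ha]; linarith)
  have hpa : 0 < p a := lt_of_deriv_pos_atBot (T := τ) (fun s _ => h.deriv_p s)
    (fun s hs => hpos s (hτ s hs.le)) h.lim_p (by rw [ha]; linarith)
  have mono : ∀ T, a ≤ T → (∀ s ∈ Ioo a T, 1 < u s ∧ 0 < p s) → u a ≤ u T ∧ p a ≤ p T := by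
    intro T hT hs
    constructor
    · have hm : MonotoneOn u (Icc a T) := by
        apply monotoneOn_of_deriv_nonneg (convex_Icc _ _) huc.continuousOn
        · exact fun s _ => (h.deriv_u s).differentiableAt.differentiableWithinAt
        · intro s hs'
          rw [interior_Icc] at hs'
          rw [(h.deriv_u s).deriv]
          exact (hs s hs').2.le
      exact hm ⟨le_rfl, hT⟩ ⟨hT, le_rfl⟩ hT
    · have hm : MonotoneOn p (Icc a T) := by
        apply monotoneOn_of_deriv_nonneg (convex_Icc _ _) hpc.continuousOn
        · exact fun s _ => (h.deriv_p s).differentiableAt.differentiableWithinAt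
        · intro s hs'
          rw [interior_Icc] at hs'
          rw [(h.deriv_p s).deriv]
          exact (hpos s (hs s hs').1).le
      exact hm ⟨le_rfl, hT⟩ ⟨hT, le_rfl⟩ hT
  have hall : ∀ t, a ≤ t → 0 < min (u t - 1) (p t) := by
    intro t ht
    by_contra! hcon
    obtain ⟨T, hT, hT0, hTpos⟩ := exists_first_zero (f := fun t => min (u t - 1) (p t)) (a := a)
      (b := t) (Continuous.continuousOn (by fun_prop)) (lt_min (by linarith) hpa) ⟨ht, le_rfl⟩ hcon
    have h1 := mono T hT.1.le fun s hs => by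
      have := lt_min_iff.1 (hTpos s ⟨hs.1.le, hs.2⟩)
      exact ⟨by linarith [this.1], this.2⟩
    have h2 : 0 < min (u T - 1) (p T) := lt_min (by linarith [h1.1]) (by linarith [h1.2])
    linarith
  have hge : ∀ t, a ≤ t → p a ≤ p t := fun t ht => (mono t ht fun s hs => by
    have := lt_min_iff.1 (hall s hs.1.le)
    exact ⟨by linarith [this.1], this.2⟩).2
  have := ge_of_tendsto h.lim_p' (eventually_atTop.2 ⟨a, hge⟩)
  linarith

theorem sq_le_one (h : IsFullOrbit lam d e u p) (hlam : 0 < lam) : d ^ 2 ≤ 1 := by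
  have h1 := h.le_one hlam
  have h2 := h.neg.le_one hlam
  nlinarith

end IsFullOrbit

theorem hasDerivAt_ite {f g : ℝ → ℝ} {f' t₀ t : ℝ} (heq : f t₀ = g t₀)
    (hf : t ≤ t₀ → HasDerivWithinAt f f' (Iic t₀) t)
    (hg : t₀ ≤ t → HasDerivWithinAt g f' (Ici t₀) t) :
    HasDerivAt (fun s => if s ≤ t₀ then f s else g s) f' t := by
  rcases lt_trichotomy t t₀ with h | h | h
  · refine (hasDerivWithinAt_of_lt (hf h.le) h).congr_of_eventuallyEq ?_
    filter_upwards [gt_mem_nhds h] with s hs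
    rw [if_pos (le_of_lt hs)]
  · subst h
    rw [← hasDerivWithinAt_univ, ← Iic_union_Ici (a := t)]
    refine HasDerivWithinAt.union ?_ ?_
    · exact (hf le_rfl).congr (fun s hs => if_pos hs) (if_pos le_rfl)
    · refine (hg le_rfl).congr (fun s hs => ?_) (by rw [if_pos le_rfl, heq])
      rcases (mem_Ici.1 hs).eq_or_lt with h | h
      · rw [← h, if_pos le_rfl, heq]
      · rw [if_neg (not_le.2 h)]
  · refine ((hg h.le).hasDerivAt (Ici_mem_nhds h)).congr_of_eventuallyEq ?_
    filter_upwards [lt_mem_nhds h] with s hs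
    rw [if_neg (not_le.2 hs)]

/-- The second half orbit is run backwards from `t₀`; both pieces satisfy the same equation there,
so the one-sided derivatives agree. -/
theorem exists_fullOrbit {lam d e t₀ : ℝ} {u p v q : ℝ → ℝ} (h : IsHalfOrbit lam d t₀ u p)
    (h' : IsHalfOrbit lam e (-t₀) v q) (huv : u t₀ = v (-t₀)) (hpq : p t₀ = -q (-t₀)) :
    ∃ U P, IsFullOrbit lam d e U P ∧ U t₀ = u t₀ ∧ P t₀ = p t₀ := by
  have hmaps : MapsTo (fun s : ℝ => -s) (Ici t₀) (Iic (-t₀)) := fun s hs => by simpa using hs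
  have hneg : ∀ t, HasDerivWithinAt (fun s : ℝ => -s) (-1) (Ici t₀) t := fun t =>
    (hasDerivAt_neg t).hasDerivWithinAt
  set U : ℝ → ℝ := fun s => if s ≤ t₀ then u s else v (-s) with hU
  set P : ℝ → ℝ := fun s => if s ≤ t₀ then p s else -q (-s) with hP
  have hUle : ∀ t ≤ t₀, U t = u t := fun t ht => if_pos ht
  have hPle : ∀ t ≤ t₀, P t = p t := fun t ht => if_pos ht
  have hUge : ∀ t, t₀ ≤ t → U t = v (-t) := by
    intro t ht
    rcases ht.eq_or_lt with rfl | ht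
    · rw [hUle _ le_rfl, huv]
    · exact if_neg (not_le.2 ht)
  have hPge : ∀ t, t₀ ≤ t → P t = -q (-t) := by
    intro t ht
    rcases ht.eq_or_lt with rfl | ht
    · rw [hPle _ le_rfl, hpq]
    · exact if_neg (not_le.2 ht)
  refine ⟨U, P, ⟨fun t => ?_, fun t => ?_, ?_, ?_, ?_, ?_⟩, hUle _ le_rfl, hPle _ le_rfl⟩
  · refine hasDerivAt_ite (g := fun s => v (-s)) huv (fun ht => ?_) fun ht => ?_
    · rw [hPle t ht]
      exact h.deriv_u t ht
    · rw [hPge t ht]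
      have h1 := (h'.deriv_u (-t) (by linarith)).comp t (hneg t) hmaps
      rw [mul_neg_one] at h1
      exact h1
  · refine hasDerivAt_ite (g := fun s => -q (-s)) hpq (fun ht => ?_) fun ht => ?_
    · rw [hUle t ht]
      exact h.deriv_p t ht
    · rw [hUge t ht]
      have h1 := ((h'.deriv_p (-t) (by linarith)).comp t (hneg t) hmaps).neg
      rw [mul_neg_one, neg_neg, sech2_neg] at h1
      exact h1
  · refine h.lim_u.congr' ?_
    filter_upwards [eventually_le_atBot t₀] with t ht using (hUle t ht).symm
  · refine h.lim_p.congr' ?_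
    filter_upwards [eventually_le_atBot t₀] with t ht using (hPle t ht).symm
  · refine (h'.lim_u.comp tendsto_neg_atTop_atBot).congr' ?_
    filter_upwards [eventually_ge_atTop t₀] with t ht using (hUge t ht).symm
  · rw [← neg_zero]
    refine (h'.lim_p.comp tendsto_neg_atTop_atBot).neg.congr' ?_
    filter_upwards [eventually_ge_atTop t₀] with t ht using (hPge t ht).symm

/-! ### Equilibria -/

/-- The initial values of the shooting solutions that are even or odd about the equator. -/
def symmetricValues (lam : ℝ) : Set ℝ :=
  {d | d ^ 2 ≤ 1 ∧ (shootU lam d 0 = 0 ∨ shootP lam d 0 = 0)}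

theorem shoot_even {lam d : ℝ} (h : shootP lam d 0 = 0) (t : ℝ) :
    shootU lam d (-t) = shootU lam d t ∧ shootP lam d (-t) = -shootP lam d t := by
  rcases mul_eq_zero.1 h with rfl | h
  · simp [shootU, shootP]
  · have := (isProfile_profile lam (sq_nonneg d)).even_of_p (sq_nonneg d) h t
    simp [shootU, shootP, this.1, this.2]

theorem shoot_odd {lam d : ℝ} (h : shootU lam d 0 = 0) (t : ℝ) :
    shootU lam d (-t) = -shootU lam d t ∧ shootP lam d (-t) = shootP lam d t := by
  rcases mul_eq_zero.1 h with rfl | h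
  · simp [shootU, shootP]
  · have := (isProfile_profile lam (sq_nonneg d)).odd_of_y (sq_nonneg d) h t
    simp [shootU, shootP, this.1, this.2]

theorem shootU_sq_le_one {lam d : ℝ} (hlam : 0 < lam) (hd : d ∈ symmetricValues lam) (t : ℝ) :
    shootU lam d t ^ 2 ≤ 1 := by
  rcases le_total t 0 with ht | ht
  · exact (shootU_sq_le hlam hd.1 ht).trans hd.1
  · have h1 := (shootU_sq_le hlam hd.1 (neg_nonpos.2 ht)).trans hd.1
    rcases hd.2 with h | h
    · rwa [(shoot_odd h t).1, neg_sq] at h1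
    · rwa [(shoot_even h t).1] at h1

theorem energy_abs (lam d : ℝ) : energy lam (shootU lam |d| 0) (shootP lam |d| 0) =
    energy lam (shootU lam d 0) (shootP lam d 0) := by
  rcases abs_choice d with h | h
  · rw [h]
  · rw [h, shootU_neg, shootP_neg, energy, energy]
    ring

theorem abs_eq_of_energy_eq {lam d e : ℝ} (hlam : 0 < lam) (hd : d ^ 2 ≤ 1) (he : e ^ 2 ≤ 1)
    (h : energy lam (shootU lam d 0) (shootP lam d 0) =
      energy lam (shootU lam e 0) (shootP lam e 0)) : |d| = |e| := by
  rw [← energy_abs lam d, ← energy_abs lam e] at h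
  exact (strictMonoOn_energy hlam).injOn
    ⟨abs_nonneg d, (sq_le_one_iff_abs_le_one d).1 hd⟩
    ⟨abs_nonneg e, (sq_le_one_iff_abs_le_one e).1 he⟩ h

/-- The orbit and its reversal are shooting solutions for `d` and `e` on the first hemisphere, and
at the equator they differ only in the sign of `p`. Equal energy gives `e = ±d`; then `e = d` forces
`p = 0` and `e = -d` forces `u = 0` there. -/
theorem IsFullOrbit.eq_shoot {lam d e : ℝ} {u p : ℝ → ℝ} (h : IsFullOrbit lam d e u p)
    (hlam : 0 < lam) :
    d ∈ symmetricValues lam ∧ ∀ t, u t = shootU lam d t ∧ p t = shootP lam d t := by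
  have hd := h.sq_le_one hlam
  have he := h.reverse.sq_le_one hlam
  have hleft : ∀ t ≤ 0, u t = shootU lam d t ∧ p t = shootP lam d t := fun t ht =>
    (h.halfOrbit 0).eq_shoot (fun s hs => (shootU_sq_le hlam hd hs).trans hd) ht
  have hright : ∀ t ≤ 0, u (-t) = shootU lam e t ∧ -p (-t) = shootP lam e t := fun t ht =>
    (h.reverse.halfOrbit 0).eq_shoot (fun s hs => (shootU_sq_le hlam he hs).trans he) ht
  have h0 := hleft 0 le_rfl
  have h0' := hright 0 le_rfl
  rw [neg_zero] at h0'
  have hU : shootU lam d 0 = shootU lam e 0 := h0.1.symm.trans h0'.1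
  have hP : shootP lam d 0 = -shootP lam e 0 := by rw [← h0'.2, neg_neg, h0.2]
  have habs : |d| = |e| := abs_eq_of_energy_eq hlam hd he (by
    rw [hU, hP, energy, energy]; ring)
  rcases abs_eq_abs.1 habs with rfl | hde
  · have hP0 : shootP lam d 0 = 0 := by linarith
    refine ⟨⟨hd, Or.inr hP0⟩, fun t => ?_⟩
    rcases le_total t 0 with ht | ht
    · exact hleft t ht
    · have h1 := hright (-t) (neg_nonpos.2 ht)
      rw [neg_neg, (shoot_even hP0 t).1, (shoot_even hP0 t).2] at h1
      exact ⟨h1.1, by linarith [h1.2]⟩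
  · have hed : e = -d := by linarith
    subst hed
    rw [shootU_neg] at hU
    have hU0 : shootU lam d 0 = 0 := by linarith
    refine ⟨⟨hd, Or.inl hU0⟩, fun t => ?_⟩
    rcases le_total t 0 with ht | ht
    · exact hleft t ht
    · have h1 := hright (-t) (neg_nonpos.2 ht)
      rw [neg_neg, shootU_neg, shootP_neg, (shoot_odd hU0 t).1, (shoot_odd hU0 t).2] at h1
      exact ⟨by linarith [h1.1], by linarith [h1.2]⟩

/-- A common point of the two manifolds joins two half orbits into a full orbit, and full orbits are
the symmetric shooting solutions. The index set on the right is therefore independent of `θ`. -/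
theorem crossSection_inter_eq {lam θ : ℝ} (hlam : 0 < lam) (hθ : θ ∈ Ioo 0 π) :
    crossSection (unstableShooting lam) θ ∩ crossSection (stableShooting lam) θ =
      (fun d => (shootU lam d (polarInv θ), shootP lam d (polarInv θ))) ''
        symmetricValues lam := by
  set t := polarInv θ with ht
  have hpt : polar t = θ := polar_polarInv hθ
  have hpnt : polar (-t) = π - θ := by rw [polar_neg, hpt]
  ext ⟨u₀, p₀⟩
  simp only [crossSection, unstableShooting, stableShooting, mem_inter_iff, mem_ofPred_eq,
    mem_iUnion, mem_image, Prod.mk.injEq]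
  constructor
  · rintro ⟨⟨d, hd⟩, e, he⟩
    have he' := mem_strongUnstable_of_mem_strongStable he
    rw [← hpt] at hd
    rw [← hpnt] at he'
    obtain ⟨u, p, hup, hu, hp⟩ := exists_halfOrbit hd
    obtain ⟨v, q, hvq, hv, hq⟩ := exists_halfOrbit he'
    obtain ⟨U, P, hUP, hUt, hPt⟩ := exists_fullOrbit hup hvq (by rw [hu, hv]) (by
      rw [hp, hq, neg_neg])
    obtain ⟨hmem, heq⟩ := hUP.eq_shoot hlam
    exact ⟨d, hmem, by rw [← (heq t).1, hUt, hu], by rw [← (heq t).2, hPt, hp]⟩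
  · rintro ⟨d, hd, rfl, rfl⟩
    have hle := shootU_sq_le_one hlam hd
    refine ⟨⟨d, ?_⟩, ?_⟩
    · have := mem_strongUnstable (t₀ := t) fun s _ => hle s
      rwa [hpt] at this
    · rcases hd.2 with h | h
      · refine ⟨-d, mem_strongStable_of_mem_strongUnstable ?_⟩
        have := mem_strongUnstable (lam := lam) (d := -d) (t₀ := -t) fun s _ => by
          rw [shootU_neg, neg_sq]; exact hle s
        rwa [shootU_neg, shootP_neg, (shoot_odd h t).1, (shoot_odd h t).2, neg_neg, hpnt] at this
      · refine ⟨d, mem_strongStable_of_mem_strongUnstable ?_⟩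
        have := mem_strongUnstable (t₀ := -t) fun s _ => hle s
        rwa [(shoot_even h t).1, (shoot_even h t).2, hpnt] at this

theorem injOn_shoot {lam : ℝ} (hlam : 0 < lam) (t : ℝ) :
    InjOn (fun d => (shootU lam d t, shootP lam d t)) (symmetricValues lam) := by
  intro d hd e he hde
  simp only [Prod.mk.injEq] at hde
  have h1 := shootU_sq_le_one hlam hd
  have h2 := shootU_sq_le_one hlam he
  have hz : ∀ s, shootU lam d s = shootU lam e s := fun s => by
    have := (eq_zero_of_initial (u := fun t => shootU lam d t - shootU lam e t)
      (p := fun t => shootP lam d t - shootP lam e t) (M := 2 * lam) (a := t) (by positivity)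
      (fun s => (hasDerivAt_shootU lam d s).sub (hasDerivAt_shootU lam e s))
      (fun s => (hasDerivAt_shootP (h1 s)).sub (hasDerivAt_shootP (h2 s))) (fun s => by
        set U := shootU lam d s
        set V := shootU lam e s
        have e : -(lam * sech2 s * (U * (1 - U ^ 2))) - -(lam * sech2 s * (V * (1 - V ^ 2))) =
            -(lam * sech2 s * ((1 - (U ^ 2 + U * V + V ^ 2)) * (U - V))) := by ring
        rw [e, abs_neg, abs_mul, abs_mul, abs_mul, abs_of_pos hlam, abs_of_pos (sech2_pos s)]
        have h3 := abs_one_sub_le (h1 s) (h2 s)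
        have h4 := sech2_le_one s
        calc _ ≤ lam * 1 * (2 * |U - V|) := by gcongr
          _ = _ := by ring) (sub_eq_zero.2 hde.1) (sub_eq_zero.2 hde.2) s).1
    exact sub_eq_zero.1 this
  exact tendsto_nhds_unique ((tendsto_shootU lam d).congr hz) (tendsto_shootU lam e)

theorem symmetricValues_pos_iff {lam d : ℝ} (hlam : 0 < lam) (hd : d ∈ Ioc (0 : ℝ) 1) :
    d ∈ symmetricValues lam ↔ ∃ n : ℕ, equatorAngle lam d = n * (π / 2) := by
  have h := isAngle_profileAngle hlam.le (sq_nonneg d)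
  have h1 := h.1.vanish_iff ((isProfile_profile lam (sq_nonneg d)).ne_zero (sq_nonneg d) 0) (h.2 0)
  have habs : |d| ≤ 1 := by rw [abs_of_pos hd.1]; exact hd.2
  rw [equatorAngle, ← h1]
  simp [symmetricValues, habs, shootU, shootP, hd.1.ne']

theorem encard_symmetricValues {lam : ℝ} (hlam : 0 < lam) {k : ℕ}
    (h1 : k * (π / 2) < linearAngle lam) (h2 : linearAngle lam ≤ (k + 1 : ℕ) * (π / 2)) :
    (symmetricValues lam).encard = 2 * k + 3 := by
  have hanti := strictAntiOn_equatorAngle hlam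
  have hex : ∀ n ∈ Finset.range (k + 1), ∃ d ∈ Ioc (0 : ℝ) 1, equatorAngle lam d = n * (π / 2) := by
    intro n hn
    have hnk : (n : ℝ) ≤ k := by
      have := Finset.mem_range.1 hn
      exact_mod_cast Nat.lt_succ_iff.1 this
    have hlt : n * (π / 2) < equatorAngle lam 0 := by
      rw [equatorAngle_zero]
      refine lt_of_le_of_lt ?_ h1
      gcongr
    obtain ⟨d, hd, hdn⟩ := intermediate_value_Icc' zero_le_one
      (continuous_equatorAngle hlam.le).continuousOn
      ⟨by rw [equatorAngle_one hlam.le]; positivity, hlt.le⟩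
    refine ⟨d, ⟨lt_of_le_of_ne hd.1 ?_, hd.2⟩, hdn⟩
    rintro rfl
    linarith
  choose! δ hδ hδn using hex
  set S : Set ℝ := δ '' (Finset.range (k + 1) : Set ℕ) with hS
  have hinj : InjOn δ (Finset.range (k + 1) : Set ℕ) := by
    intro m hm n hn hmn
    have h3 := hδn m hm
    rw [hmn, hδn n hn] at h3
    have h4 := mul_right_cancel₀ (by positivity) h3
    exact_mod_cast h4.symm
  have hScard : S.encard = k + 1 := by
    rw [hS, hinj.encard_image, Set.encard_coe_eq_coe_finsetCard, Finset.card_range]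
    push_cast
    rfl
  have hSiff : ∀ d, d ∈ S ↔ d ∈ Ioc (0 : ℝ) 1 ∧ d ∈ symmetricValues lam := by
    intro d
    constructor
    · rintro ⟨n, hn, rfl⟩
      exact ⟨hδ n hn, (symmetricValues_pos_iff hlam (hδ n hn)).2 ⟨n, hδn n hn⟩⟩
    · rintro ⟨hd, hmem⟩
      obtain ⟨n, hn⟩ := (symmetricValues_pos_iff hlam hd).1 hmem
      -- Strictness here is what excludes `n = k + 1`, even when `linearAngle` equals `(k + 1) π /
      -- 2`.
      have hlt : equatorAngle lam d < equatorAngle lam 0 :=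
        hanti ⟨le_rfl, zero_le_one⟩ ⟨hd.1.le, hd.2⟩ hd.1
      rw [equatorAngle_zero, hn] at hlt
      have h3 := lt_of_mul_lt_mul_right (hlt.trans_le h2) (by positivity)
      have h4 : n < k + 1 := by exact_mod_cast h3
      have hnr : n ∈ Finset.range (k + 1) := Finset.mem_range.2 h4
      refine ⟨n, hnr, ?_⟩
      have h5 := hδ n hnr
      exact hanti.injOn ⟨h5.1.le, h5.2⟩ ⟨hd.1.le, hd.2⟩ (by rw [hδn n hnr, hn])
  have hnegmem : ∀ d, -d ∈ symmetricValues lam ↔ d ∈ symmetricValues lam := by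
    intro d
    simp [symmetricValues, shootU_neg, shootP_neg]
  have hunion : symmetricValues lam = insert 0 (S ∪ (fun d => -d) '' S) := by
    ext d
    have hSneg : d ∈ (fun d => -d) '' S ↔ -d ∈ S := by simp
    rw [mem_insert_iff, mem_union, hSneg, hSiff, hSiff, hnegmem]
    constructor
    · intro hd
      have h3 := abs_le.1 ((sq_le_one_iff_abs_le_one d).1 hd.1)
      rcases lt_trichotomy d 0 with h | h | h
      · exact Or.inr (Or.inr ⟨⟨by linarith, by linarith [h3.1]⟩, hd⟩)
      · exact Or.inl h
      · exact Or.inr (Or.inl ⟨⟨h, h3.2⟩, hd⟩)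
    · rintro (rfl | h | h)
      · simp [symmetricValues, shootU]
      · exact h.2
      · exact h.2
  have hpos : ∀ d ∈ S, 0 < d := fun d hd => ((hSiff d).1 hd).1.1
  have hdisj : Disjoint S ((fun d => -d) '' S) := by
    rw [Set.disjoint_left]
    rintro d hd ⟨e, he, rfl⟩
    linarith [hpos _ hd, hpos _ he]
  have h0 : (0 : ℝ) ∉ S ∪ (fun d => -d) '' S := by
    rintro (h | ⟨e, he, h⟩)
    · exact lt_irrefl _ (hpos _ h)
    · simp only at h
      linarith [hpos _ he]
  rw [hunion, Set.encard_insert_of_notMem h0, Set.encard_union_eq hdisj,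
    (neg_injective.injOn (s := S)).encard_image, hScard]
  norm_cast
  ring

end ChafeeInfante

open ChafeeInfante in
theorem mainTheorem7 (k : ℕ) :
    (∀ lam ∈ Set.Ioo (axisymEigenvalue k) (axisymEigenvalue (k + 1)),
      ∀ θ ∈ Set.Ioo 0 Real.pi,
        (crossSection (unstableShooting lam) θ ∩ crossSection (stableShooting lam) θ).encard
          = 2 * k + 3) ∧
    (∀ lam : ℝ, 0 ≤ lam → ∃ ν : ℝ → ℝ, IsUnstableTangentAngle lam 0 ν) ∧
    (∀ lam : ℝ, 0 ≤ lam → ∀ ν : ℝ → ℝ, IsUnstableTangentAngle lam 0 ν →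
      (ν (Real.pi / 2) = (k + 1) * (Real.pi / 2) ↔ lam = axisymEigenvalue (k + 1))) := by
  obtain ⟨hk0, hk⟩ := linearAngle_axisymEigenvalue k
  obtain ⟨hk0', hk'⟩ := linearAngle_axisymEigenvalue (k + 1)
  refine ⟨fun lam hlam θ hθ => ?_, fun lam hlam => exists_isUnstableTangentAngle hlam,
    fun lam hlam ν hν => ?_⟩
  · have hpos : 0 < lam := hk0.trans_lt hlam.1
    rw [crossSection_inter_eq hpos hθ, (injOn_shoot hpos _).encard_image]
    refine encard_symmetricValues hpos ?_ ?_
    · rw [← hk]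
      exact strictMonoOn_linearAngle hk0 hpos.le hlam.1
    · rw [← hk']
      exact (strictMonoOn_linearAngle hpos.le hk0' hlam.2).le
  · rw [hν.eq_linearAngle hlam]
    push_cast at hk'
    rw [← hk']
    exact strictMonoOn_linearAngle.injOn.eq_iff hlam hk0'
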